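/- Let $(Q,\langle\cdot,\cdot\rangle)$ be a complete, connected, smooth $n$-dimensional Riemannian manifold with Levi-Civita connection $\nabla$, curvature $R(X,Y)Z=\nabla_X\nabla_YZ-\nabla_Y\nabla_XZ-\nabla_{[X,Y]}Z$, and covariant derivative $\frac{D}{dt}$ along curves. Let $V:Q\to\mathbb R$ be smooth and non-negative. Let $T>0$ and $\xi=(q_0,v_0),\ \eta=(q_T,v_T)\in TQ$. Let $\Omega$ be the set of piecewise smooth $C^1$ curves $\gamma:[0,T]\to Q$ with $(\gamma(0),\dot\gamma(0))=\xi$ and $(\gamma(T),\dot\gamma(T))=\eta$. For $q\in\Omega$ let $T_q\Omega$ be the space of piecewise smooth $C^1$ vector fields $X$ along $q$ with $X=\frac{D}{dt}X=0$ at $t=0$ and at $t=T$. Put $$J(q)=\int_0^T\Big(\tfrac12\big\|\tfrac{D}{dt}\dot q\big\|^2+V(q)\Big)dt .$$ A modified cubic polynomial is a smooth curve $q$ on $[0,T]$ with $\frac{D^3}{dt^3}\dot q+R\big(\frac{D}{dt}\dot q,\dot q\big)\dot q+\operatorname{grad}V(q)=0$. For a vector field $X$ along such a $q$, write $Y=\dot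 q$, $\nabla_Y=\frac{D}{dt}$ (acting on vector fields and on tensor fields along $q$), and let $$\begin{aligned}F(X,\dot q)={}&(\nabla^2_YR)(X,Y)Y+(\nabla_XR)(\nabla_YY,Y)Y+R(R(X,Y)Y,Y)Y+R(X,\nabla_Y^2Y)Y\\&+2\big[(\nabla_YR)(\nabla_YX,Y)Y+(\nabla_YR)(X,\nabla_YY)Y+R(\nabla_Y^2X,Y)Y\big]\\&+3\big[(\nabla_YR)(X,Y)\nabla_YY+R(X,Y)\nabla_Y^2Y+R(X,\nabla_YY)\nabla_YY\big]+4R(\nabla_YX,Y)\nabla_YY .\end{aligned}$$ The index form on $T_q\Omega$ is $$I(X,Z)=\int_0^T\Big[\big\langle \tfrac{D^2X}{dt^2},\tfrac{D^2Z}{dt^2}\big\rangle+\big\langle Z,\,F(X,\dot q)+\nabla_X\operatorname{grad}V\big\rangle\Big]dt .$$ A modified bi-Jacobi field along $q$ is a smooth vector field $X$ along $q$ on $[0,T]$ with $\frac{D^4}{dt^4}X+F(X,\dot q)+\nabla_X\operatorname{grad}V(q)\equiv0$. Points $t_1,t_2\in[0,T]$ are biconjugate along $q$ if there is a modified bi-Jacobi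 field $X\not\equiv0$ with $X(t_1)=X(t_2)=0$ and $\frac{D}{dt}X(t_1)=\frac{D}{dt}X(t_2)=0$. **Proposition.** Let $q\in\Omega$ be a modified cubic polynomial and suppose that $0\le t_1<t_2<T$ are biconjugate along $q$. Then there is $X\in T_q\Omega$ with $I(X,X)<0$. Moreover $q$ is not a minimizer of $J$ on $\Omega$: every $C^1$-neighbourhood of $q$ in $\Omega$ contains a curve $\gamma$ with $J(\gamma)<J(q)$, so $q$ is not an $\Omega$-local minimizer, and in particular not a global minimizer, of $J$ on $\Omega$. -/

import Mathlib

open Set Bundle Manifold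
open scoped ContDiff

noncomputable section

namespace ObstacleAvoidance

variable {n : ℕ} {Q : Type*} [TopologicalSpace Q] [ChartedSpace (EuclideanSpace ℝ (Fin n)) Q]
  [IsManifold (𝓡 n) ∞ Q] [RiemannianBundle (fun x : Q => TangentSpace (𝓡 n) x)]

/-! ### Levi-Civita connection and curvature in a chart

Below, `x : Q` selects the preferred chart `φ = extChartAt (𝓡 n) x` around `x`, and `y` is a point
of the target of `φ`. The induced trivialization of `TQ` is `dφ`; on the fibre over the base point
`x` itself it is the identity, so that a coordinate expression in the chart at `x`, evaluated at
`y = φ x`, is a vector of `T_x Q`. -/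

/-- The Riemannian metric read in the chart at `x`:
`chartMetric x y u v = ⟪d(φ⁻¹)_y u, d(φ⁻¹)_y v⟫`. -/
def chartMetric (x : Q) (y : EuclideanSpace ℝ (Fin n)) :
    EuclideanSpace ℝ (Fin n) →L[ℝ] EuclideanSpace ℝ (Fin n) →L[ℝ] ℝ :=
  let p : Q := (extChartAt (𝓡 n) x).symm y
  let A : EuclideanSpace ℝ (Fin n) →L[ℝ] TangentSpace (𝓡 n) p :=
    (trivializationAt (EuclideanSpace ℝ (Fin n)) (TangentSpace (𝓡 n)) x).symmL ℝ p
  (innerSL ℝ (E := TangentSpace (𝓡 n) p)).bilinearComp A A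

/-- The vector represented, through the metric at `y`, by the covector `f` (index raising):
`chartMetric x y (sharp x y f) w = f w`. -/
def sharp (x : Q) (y : EuclideanSpace ℝ (Fin n)) (f : EuclideanSpace ℝ (Fin n) →L[ℝ] ℝ) :
    EuclideanSpace ℝ (Fin n) :=
  (chartMetric x y).inverse f

/-- The Christoffel map of the Levi-Civita connection, `Γ(u, v) = Γᵏᵢⱼ uⁱ vʲ ∂ₖ`, determined by
`2 g(Γ(u, v), w) = (∂_u g)(v, w) + (∂_v g)(u, w) - (∂_w g)(u, v)`. -/
def christoffel (x : Q) (y u v : EuclideanSpace ℝ (Fin n)) : EuclideanSpace ℝ (Fin n) :=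
  let dg := fderiv ℝ (chartMetric x) y
  sharp x y ((1 / 2 : ℝ) • (dg u v + dg v u - (dg.flip u).flip v))

/-- `R(u, v)w = ∇_u ∇_v w - ∇_v ∇_u w` for constant coordinate fields `u, v, w`. -/
def chartCurv (x : Q) (y u v w : EuclideanSpace ℝ (Fin n)) : EuclideanSpace ℝ (Fin n) :=
  fderiv ℝ (fun z => christoffel x z v w) y u - fderiv ℝ (fun z => christoffel x z u w) y v
    + christoffel x y u (christoffel x y v w) - christoffel x y v (christoffel x y u w)

/-- The covariant derivative of the curvature tensor, `(∇_a R)(u, v)w`. -/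
def chartNablaCurv (x : Q) (y a u v w : EuclideanSpace ℝ (Fin n)) : EuclideanSpace ℝ (Fin n) :=
  fderiv ℝ (fun z => chartCurv x z u v w) y a + christoffel x y a (chartCurv x y u v w)
    - chartCurv x y (christoffel x y a u) v w
    - chartCurv x y u (christoffel x y a v) w
    - chartCurv x y u v (christoffel x y a w)

/-- The second covariant derivative of the curvature tensor,
`(∇²_{b,a} R)(u, v)w = (∇_b (∇R))(a; u, v)w`. -/
def chartNabla2Curv (x : Q) (y b a u v w : EuclideanSpace ℝ (Fin n)) :
    EuclideanSpace ℝ (Fin n) :=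
  fderiv ℝ (fun z => chartNablaCurv x z a u v w) y b
    + christoffel x y b (chartNablaCurv x y a u v w)
    - chartNablaCurv x y (christoffel x y b a) u v w
    - chartNablaCurv x y a (christoffel x y b u) v w
    - chartNablaCurv x y a u (christoffel x y b v) w
    - chartNablaCurv x y a u v (christoffel x y b w)

/-- The gradient vector field of `V` in the chart at `x`. -/
def chartGrad (V : Q → ℝ) (x : Q) (y : EuclideanSpace ℝ (Fin n)) : EuclideanSpace ℝ (Fin n) :=
  sharp x y (fderiv ℝ (V ∘ (extChartAt (𝓡 n) x).symm) y)

/-! ### The corresponding tensors on `Q` -/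

/-- The curvature endomorphism `R(u, v)w` on `T_x Q`. -/
def curv (x : Q) (u v w : TangentSpace (𝓡 n) x) : TangentSpace (𝓡 n) x :=
  chartCurv x (extChartAt (𝓡 n) x x) u v w

/-- `(∇_a R)(u, v)w` on `T_x Q`. -/
def nablaCurv (x : Q) (a u v w : TangentSpace (𝓡 n) x) : TangentSpace (𝓡 n) x :=
  chartNablaCurv x (extChartAt (𝓡 n) x x) a u v w

/-- `(∇²_{b,a} R)(u, v)w` on `T_x Q`. -/
def nabla2Curv (x : Q) (b a u v w : TangentSpace (𝓡 n) x) : TangentSpace (𝓡 n) x :=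
  chartNabla2Curv x (extChartAt (𝓡 n) x x) b a u v w

/-- The gradient of `V` at `x`. -/
def grad (V : Q → ℝ) (x : Q) : TangentSpace (𝓡 n) x :=
  chartGrad V x (extChartAt (𝓡 n) x x)

/-- `∇_u grad V` at `x`. -/
def nablaGrad (V : Q → ℝ) (x : Q) (u : TangentSpace (𝓡 n) x) : TangentSpace (𝓡 n) x :=
  let y : EuclideanSpace ℝ (Fin n) := extChartAt (𝓡 n) x x
  let u' : EuclideanSpace ℝ (Fin n) := u
  fderiv ℝ (chartGrad V x) y u' + christoffel x y u' (chartGrad V x y)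

/-! ### Curves on `[0, T]` and vector fields along them

A curve is a function `γ : ℝ → Q` of which only the restriction to `[0, T]` matters; derivatives
are taken within `[0, T]`, hence are one-sided at the end points. -/

/-- The velocity `γ'(t)`. -/
def velocity (T : ℝ) (γ : ℝ → Q) (t : ℝ) : TangentSpace (𝓡 n) (γ t) :=
  mfderivWithin 𝓘(ℝ, ℝ) (𝓡 n) γ (Icc 0 T) t (1 : ℝ)

/-- The covariant derivative `DX/dt` along `γ` of a vector field `X` along `γ`; at time `t` it is
computed in the chart at `γ t`. -/
def covDeriv (T : ℝ) (γ : ℝ → Q) (X : ∀ t, TangentSpace (𝓡 n) (γ t)) (t : ℝ) :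
    TangentSpace (𝓡 n) (γ t) :=
  let Xc : ℝ → EuclideanSpace ℝ (Fin n) := fun s =>
    (trivializationAt (EuclideanSpace ℝ (Fin n)) (TangentSpace (𝓡 n)) (γ t) ⟨γ s, X s⟩).2
  let v : EuclideanSpace ℝ (Fin n) := velocity T γ t
  derivWithin Xc (Icc 0 T) t + christoffel (γ t) (extChartAt (𝓡 n) (γ t) (γ t)) v (Xc t)

/-- `c` is of class `C¹` on `[0, T]` and piecewise smooth: there are
`0 = s₀ ≤ s₁ ≤ ⋯ ≤ s_k = T` such that `c` is smooth on each `[s_i, s_{i+1}]`. -/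
def IsPiecewiseSmoothC1 {E H M : Type*} [NormedAddCommGroup E] [NormedSpace ℝ E]
    [TopologicalSpace H] (I : ModelWithCorners ℝ E H) [TopologicalSpace M] [ChartedSpace H M]
    (T : ℝ) (c : ℝ → M) : Prop :=
  ContMDiffOn 𝓘(ℝ, ℝ) I 1 c (Icc 0 T) ∧
    ∃ (k : ℕ) (s : ℕ → ℝ), Monotone s ∧ s 0 = 0 ∧ s k = T ∧
      ∀ i < k, ContMDiffOn 𝓘(ℝ, ℝ) I ∞ c (Icc (s i) (s (i + 1)))

/-- The space `Ω` of piecewise smooth `C¹` curves on `[0, T]` joining the tangent vector `ξ` to the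
tangent vector `η`. -/
def Omega (T : ℝ) (ξ η : TangentBundle (𝓡 n) Q) : Set (ℝ → Q) :=
  {γ | IsPiecewiseSmoothC1 (𝓡 n) T γ ∧
    (⟨γ 0, velocity T γ 0⟩ : TangentBundle (𝓡 n) Q) = ξ ∧
    (⟨γ T, velocity T γ T⟩ : TangentBundle (𝓡 n) Q) = η}

/-- The tangent space `T_q Ω`: piecewise smooth `C¹` vector fields along `q` that vanish together
with their covariant derivative at `0` and `T`. -/
def TangentOmega (T : ℝ) (q : ℝ → Q) : Set (∀ t, TangentSpace (𝓡 n) (q t)) :=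
  {X | IsPiecewiseSmoothC1 (𝓡 n).tangent T (fun t => (⟨q t, X t⟩ : TangentBundle (𝓡 n) Q)) ∧
    X 0 = 0 ∧ X T = 0 ∧ covDeriv T q X 0 = 0 ∧ covDeriv T q X T = 0}

/-- The action `J(q) = ∫₀ᵀ (½ ‖Dq'/dt‖² + V(q)) dt`. -/
def action (V : Q → ℝ) (T : ℝ) (q : ℝ → Q) : ℝ :=
  ∫ t in (0 : ℝ)..T, ((1 / 2) * ‖covDeriv (n := n) T q (velocity T q) t‖ ^ 2 + V (q t))

/-- `q` is a modified cubic polynomial: a smooth curve on `[0, T]` satisfying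
`D³q'/dt³ + R(Dq'/dt, q')q' + grad V(q) = 0`. -/
def IsModifiedCubic (V : Q → ℝ) (T : ℝ) (q : ℝ → Q) : Prop :=
  ContMDiffOn 𝓘(ℝ, ℝ) (𝓡 n) ∞ q (Icc 0 T) ∧
    ∀ t ∈ Icc 0 T,
      (covDeriv (n := n) T q)^[3] (velocity T q) t
        + curv (q t) (covDeriv T q (velocity T q) t) (velocity T q t) (velocity T q t)
        + grad V (q t) = 0

/-- The field `F(X, q')` along `q`, where `F(X, Y)` is
`(∇²_Y R)(X,Y)Y + (∇_X R)(∇_Y Y,Y)Y + R(R(X,Y)Y,Y)Y + R(X,∇²_Y Y)Y`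
`+ 2[(∇_Y R)(∇_Y X,Y)Y + (∇_Y R)(X,∇_Y Y)Y + R(∇²_Y X,Y)Y]`
`+ 3[(∇_Y R)(X,Y)∇_Y Y + R(X,Y)∇²_Y Y + R(X,∇_Y Y)∇_Y Y] + 4R(∇_Y X,Y)∇_Y Y`.
Here `∇_Y X`, `∇²_Y X` are `DX/dt`, `D²X/dt²`, and likewise `∇²_Y R` is the second
covariant derivative of `R` along `q`, that is `D²R/dt² = ∇²_{q',q'} R + ∇_{Dq'/dt} R`. -/
def fieldF (T : ℝ) (q : ℝ → Q) (X : ∀ t, TangentSpace (𝓡 n) (q t)) (t : ℝ) :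
    TangentSpace (𝓡 n) (q t) :=
  let X₀ := X t
  let X₁ := covDeriv T q X t
  let X₂ := (covDeriv T q)^[2] X t
  let Y := velocity T q t
  let Y₁ := covDeriv T q (velocity T q) t
  let Y₂ := (covDeriv T q)^[2] (velocity T q) t
  let R := curv (q t)
  let dR := nablaCurv (q t)
  (nabla2Curv (q t) Y Y X₀ Y Y + dR Y₁ X₀ Y Y) + dR X₀ Y₁ Y Y + R (R X₀ Y Y) Y Y + R X₀ Y₂ Y
    + (2 : ℝ) • (dR Y X₁ Y Y + dR Y X₀ Y₁ Y + R X₂ Y Y)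
    + (3 : ℝ) • (dR Y X₀ Y Y₁ + R X₀ Y Y₂ + R X₀ Y₁ Y₁)
    + (4 : ℝ) • R X₁ Y Y₁

/-- The index form
`I(X, Y) = ∫₀ᵀ (⟪D²X/dt², D²Y/dt²⟫ + ⟪Y, F(X, q') + ∇_X grad V⟫) dt`. -/
def indexForm (V : Q → ℝ) (T : ℝ) (q : ℝ → Q) (X Y : ∀ t, TangentSpace (𝓡 n) (q t)) : ℝ :=
  ∫ t in (0 : ℝ)..T,
    (inner ℝ ((covDeriv T q)^[2] X t) ((covDeriv T q)^[2] Y t)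
      + inner ℝ (Y t) (fieldF T q X t + nablaGrad V (q t) (X t)))

/-- `X` is a modified bi-Jacobi field along `q`: a smooth vector field on `[0, T]` satisfying
`D⁴X/dt⁴ + F(X, q') + ∇_X grad V = 0`. -/
def IsBiJacobi (V : Q → ℝ) (T : ℝ) (q : ℝ → Q) (X : ∀ t, TangentSpace (𝓡 n) (q t)) : Prop :=
  ContMDiffOn 𝓘(ℝ, ℝ) (𝓡 n).tangent ∞ (fun t => (⟨q t, X t⟩ : TangentBundle (𝓡 n) Q)) (Icc 0 T) ∧
    ∀ t ∈ Icc 0 T,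
      (covDeriv T q)^[4] X t + fieldF T q X t + nablaGrad V (q t) (X t) = 0

/-- `t₁` and `t₂` are biconjugate along `q`: some modified bi-Jacobi field, not identically zero on
`[0, T]`, vanishes together with its covariant derivative at `t₁` and at `t₂`. -/
def AreBiconjugate (V : Q → ℝ) (T : ℝ) (q : ℝ → Q) (t₁ t₂ : ℝ) : Prop :=
  ∃ X : ∀ t, TangentSpace (𝓡 n) (q t), IsBiJacobi V T q X ∧ (∃ t ∈ Icc 0 T, X t ≠ 0) ∧
    X t₁ = 0 ∧ X t₂ = 0 ∧ covDeriv T q X t₁ = 0 ∧ covDeriv T q X t₂ = 0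

/-- `q` is a global minimizer of `J` on `Ω`. -/
def IsGlobalMinimizer (V : Q → ℝ) (T : ℝ) (ξ η : TangentBundle (𝓡 n) Q) (q : ℝ → Q) : Prop :=
  q ∈ Omega T ξ η ∧ ∀ γ ∈ Omega T ξ η, action (n := n) V T q ≤ action (n := n) V T γ

/-- `q` is an `Ω`-local minimizer of `J`: it minimizes `J` among the curves of `Ω` in some `C¹`
neighbourhood of `q`. As `[0, T]` is compact, a base of `C¹` neighbourhoods of `q` is given by the
sets of curves `γ` with `(t, γ t, γ'(t)) ∈ W` for all `t ∈ [0, T]`, where `W ⊆ ℝ × TQ` is open and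
contains all `(t, q t, q'(t))`. -/
def IsOmegaLocalMinimizer (V : Q → ℝ) (T : ℝ) (ξ η : TangentBundle (𝓡 n) Q) (q : ℝ → Q) : Prop :=
  q ∈ Omega T ξ η ∧ ∃ W : Set (ℝ × TangentBundle (𝓡 n) Q), IsOpen W ∧
    (∀ t ∈ Icc 0 T, (t, (⟨q t, velocity T q t⟩ : TangentBundle (𝓡 n) Q)) ∈ W) ∧
    ∀ γ ∈ Omega T ξ η,
      (∀ t ∈ Icc 0 T, (t, (⟨γ t, velocity T γ t⟩ : TangentBundle (𝓡 n) Q)) ∈ W) →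
        action (n := n) V T q ≤ action (n := n) V T γ

end ObstacleAvoidance

end

open Set Bundle Manifold
open scoped ContDiff

noncomputable section

namespace ObstacleAvoidance

open ContinuousLinearMap Topology

set_option linter.unusedSectionVars false

/-! ### Covariant calculus along maps into an open subset of a normed space -/

/-! Write I for the index form and let X be the bi-Jacobi field whose 1-jet vanishes at t₁ and t₂.
Its truncation X̂, equal to X on [t₁, t₂] and to 0 elsewhere, is only C¹. Integration by parts gives
I(X̂, X̂) = 0, because every boundary term contains X or DX/dt at an end. For a field Z supported
near t₂ the same computation leaves I(X̂, Z) = ⟨D²X, DZ⟩ − ⟨D³X, Z⟩ at t₂. With Z(t₂) = −D³X(t₂) and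
DZ(t₂) = D²X(t₂) this is B = |D²X(t₂)|² + |D³X(t₂)|². Here B > 0, since otherwise the 3-jet of X
vanishes at t₂ and X, a solution of a linear equation of order four, is identically zero. By
symmetry of I, I(X̂ + uZ, X̂ + uZ) = 2uB + u² I(Z, Z), which is negative for small u < 0. The strict
inequality t₂ < T is what leaves room for Z.

The broken field X̂ is replaced by smooth fields φ_k X with compact support in (t₁, t₂). With w = (t
− t₁)(t₂ − t), the cutoffs cost factors w⁻¹ and w⁻² in their first two derivatives, and these are
compensated by DX = O(w) and X = O(w²). The second derivatives of φ_k X therefore stay bounded and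
dominated convergence applies. The outcome, `exists_indexForm_neg`, is a smooth field W with compact
support in (0, T) and I(W, W) < 0.

Such a W is the variation field of a smooth family of curves f s that agree with q near both ends
(`exists_isVariation`); they lie in Ω and are C¹-close to q for small s. As q solves the
Euler-Lagrange equation, the second derivative at s = 0 of the action of f s is I(W, W)
(`IsVariation.integral_second_variation`). This contradicts local minimality.

The geometric core is `vcov_eulerL`: differentiating the Euler-Lagrange expression along a
variation, and commuting covariant derivatives at the price of curvature terms, produces exactly D⁴Z
+ F(Z) + ∇_Z grad V. Combined with the first variation formula it yields the second variation.
Applied to a two-parameter variation, whose mixed partial derivatives commute, it also yields the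
symmetry of I (`indexForm_comm`), which cannot be read off from F. These computations take place in
one chart, for maps from a parameter space into it. Transition maps are isometries of the chart
metrics, and covariant derivatives and curvature are natural under isometries, so the results pass
to objects on Q. -/

/-- Shortcut instances for iterated spaces of continuous linear maps. -/
@[reducible] def clmNormedAddCommGroup {E F : Type*} [NormedAddCommGroup E]
    [NormedSpace ℝ E] [NormedAddCommGroup F] [NormedSpace ℝ F] : NormedAddCommGroup (E →L[ℝ] F) :=
  ContinuousLinearMap.toNormedAddCommGroup

@[reducible] def clmNormedSpace {E F : Type*} [NormedAddCommGroup E]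
    [NormedSpace ℝ E] [NormedAddCommGroup F] [NormedSpace ℝ F] : NormedSpace ℝ (E →L[ℝ] F) :=
  ContinuousLinearMap.toNormedSpace

@[reducible] def clmAddCommGroup {E F : Type*} [NormedAddCommGroup E]
    [NormedSpace ℝ E] [NormedAddCommGroup F] [NormedSpace ℝ F] : AddCommGroup (E →L[ℝ] F) :=
  clmNormedAddCommGroup.toAddCommGroup

@[reducible] def clmAddCommMonoid {E F : Type*} [NormedAddCommGroup E]
    [NormedSpace ℝ E] [NormedAddCommGroup F] [NormedSpace ℝ F] : AddCommMonoid (E →L[ℝ] F) :=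
  clmNormedAddCommGroup.toAddCommGroup.toAddCommMonoid

@[reducible] def clmTopologicalSpace {E F : Type*} [NormedAddCommGroup E]
    [NormedSpace ℝ E] [NormedAddCommGroup F] [NormedSpace ℝ F] : TopologicalSpace (E →L[ℝ] F) :=
  clmNormedAddCommGroup.toSeminormedAddCommGroup.toPseudoMetricSpace.toUniformSpace.toTopologicalSpace

@[reducible] def clmModule {E F : Type*} [NormedAddCommGroup E]
    [NormedSpace ℝ E] [NormedAddCommGroup F] [NormedSpace ℝ F] : Module ℝ (E →L[ℝ] F) :=
  clmNormedSpace.toModule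

attribute [local instance 2000] clmNormedAddCommGroup clmNormedSpace clmAddCommGroup
  clmAddCommMonoid clmTopologicalSpace clmModule

section LocalCalculus

variable {E F P : Type*} [NormedAddCommGroup E] [NormedSpace ℝ E]
  [NormedAddCommGroup F] [NormedSpace ℝ F] [NormedAddCommGroup P] [NormedSpace ℝ P]

/-- The action of `End E` on `Hom(E, F)` induced by an action on `F`. -/
def homAct (ρ : (E →L[ℝ] E) →L[ℝ] F →L[ℝ] F) :
    (E →L[ℝ] E) →L[ℝ] (E →L[ℝ] F) →L[ℝ] (E →L[ℝ] F) :=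
  (compL ℝ E F F).comp ρ - (compL ℝ E E F).flip

theorem homAct_apply (ρ : (E →L[ℝ] E) →L[ℝ] F →L[ℝ] F) (h : E →L[ℝ] E) (S : E →L[ℝ] F) (u : E) :
    homAct ρ h S u = ρ h (S u) - S (h u) := by
  simp [homAct]

/-- The covariant derivative in the direction `e` of a field `W` along the map `c`, with values in
a space `F` on which `End E` acts. -/
def cov (ρ : (E →L[ℝ] E) →L[ℝ] F →L[ℝ] F) (Γ : E → E →L[ℝ] E →L[ℝ] E) (c : P → E) (e : P)
    (W : P → F) (p : P) : F :=
  fderiv ℝ W p e + ρ (Γ (c p) (fderiv ℝ c p e)) (W p)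

/-- The covariant derivative of vector fields along `c`. -/
abbrev vcov (Γ : E → E →L[ℝ] E →L[ℝ] E) (c : P → E) (e : P) (W : P → E) (p : P) : E :=
  cov (.id ℝ (E →L[ℝ] E)) Γ c e W p

theorem vcov_apply (Γ : E → E →L[ℝ] E →L[ℝ] E) (c : P → E) (e : P) (W : P → E) (p : P) :
    vcov Γ c e W p = fderiv ℝ W p e + Γ (c p) (fderiv ℝ c p e) (W p) := rfl

/-- The covariant derivative of a tensor field. -/
def nabla (ρ : (E →L[ℝ] E) →L[ℝ] F →L[ℝ] F) (Γ : E → E →L[ℝ] E →L[ℝ] E) (S : E → F) (y : E) :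
    E →L[ℝ] F :=
  fderiv ℝ S y + (ρ.flip (S y)).comp (Γ y)

theorem nabla_apply (ρ : (E →L[ℝ] E) →L[ℝ] F →L[ℝ] F) (Γ : E → E →L[ℝ] E →L[ℝ] E) (S : E → F)
    (y a : E) : nabla ρ Γ S y a = fderiv ℝ S y a + ρ (Γ y a) (S y) := rfl

variable {ρ : (E →L[ℝ] E) →L[ℝ] F →L[ℝ] F} {Γ : E → E →L[ℝ] E →L[ℝ] E} {c : P → E}
  {O : Set P} {U : Set E}

theorem cov_congr (hO : IsOpen O) {W W' : P → F} (h : EqOn W W' O) (e : P) :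
    EqOn (cov ρ Γ c e W) (cov ρ Γ c e W') O := by
  intro p hp
  have : W =ᶠ[𝓝 p] W' := h.eventuallyEq_of_mem (hO.mem_nhds hp)
  simp only [cov, this.fderiv_eq, this.eq_of_nhds]

theorem fderiv_congr_of_isOpen (hO : IsOpen O) {W W' : P → F} (h : EqOn W W' O) {p : P}
    (hp : p ∈ O) : fderiv ℝ W p = fderiv ℝ W' p :=
  (h.eventuallyEq_of_mem (hO.mem_nhds hp)).fderiv_eq

theorem cov_add {W W' : P → F} {e p : P} (hW : DifferentiableAt ℝ W p)
    (hW' : DifferentiableAt ℝ W' p) :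
    cov ρ Γ c e (fun p => W p + W' p) p = cov ρ Γ c e W p + cov ρ Γ c e W' p := by
  simp only [cov, fderiv_fun_add hW hW', add_apply, map_add]; abel

theorem vcov_congr (hO : IsOpen O) {W W' : P → E} (h : EqOn W W' O) (e : P) :
    EqOn (vcov Γ c e W) (vcov Γ c e W') O := cov_congr hO h e

theorem vcov_add {W W' : P → E} {e p : P} (hW : DifferentiableAt ℝ W p)
    (hW' : DifferentiableAt ℝ W' p) :
    vcov Γ c e (fun p => W p + W' p) p = vcov Γ c e W p + vcov Γ c e W' p := cov_add hW hW'

/-- Leibniz rule. -/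
theorem cov_clm_apply {S : P → E →L[ℝ] F} {A : P → E} {e p : P} (hS : DifferentiableAt ℝ S p)
    (hA : DifferentiableAt ℝ A p) :
    cov ρ Γ c e (fun p => S p (A p)) p
      = cov (homAct ρ) Γ c e S p (A p) + S p (vcov Γ c e A p) := by
  simp only [cov, fderiv_clm_apply hS hA, add_apply, homAct_apply, map_add, comp_apply,
    flip_apply, id_apply]
  abel

/-- Chain rule. -/
theorem cov_comp {S : E → F} {e p : P} (hS : DifferentiableAt ℝ S (c p))
    (hc : DifferentiableAt ℝ c p) :
    cov ρ Γ c e (fun p => S (c p)) p = nabla ρ Γ S (c p) (fderiv ℝ c p e) := by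
  have : fderiv ℝ (fun p => S (c p)) p = (fderiv ℝ S (c p)).comp (fderiv ℝ c p) :=
    fderiv_comp p hS hc
  simp only [cov, nabla_apply, this, comp_apply]

theorem contDiffOn_fderiv_apply {n : WithTop ℕ∞} {W : P → F} (hO : IsOpen O) (hn : n + 1 ≤ ∞)
    (hW : ContDiffOn ℝ ∞ W O) (e : P) : ContDiffOn ℝ n (fun p => fderiv ℝ W p e) O :=
  (hW.fderiv_of_isOpen hO hn).clm_apply contDiffOn_const

theorem contDiffOn_cov (hO : IsOpen O) (hΓ : ContDiffOn ℝ ∞ Γ U) (hc : ContDiffOn ℝ ∞ c O)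
    (hcU : MapsTo c O U) {W : P → F} (hW : ContDiffOn ℝ ∞ W O) (e : P) :
    ContDiffOn ℝ ∞ (cov ρ Γ c e W) O := by
  have h1 := contDiffOn_fderiv_apply (n := ∞) hO le_rfl hW e
  have h2 := contDiffOn_fderiv_apply (n := ∞) hO le_rfl hc e
  have h3 : ContDiffOn ℝ ∞ (fun p => ρ (Γ (c p) (fderiv ℝ c p e))) O :=
    ρ.contDiff.comp_contDiffOn ((hΓ.comp hc hcU).clm_apply h2)
  exact h1.add (h3.clm_apply hW)

theorem contDiffOn_nabla (hU : IsOpen U) (hΓ : ContDiffOn ℝ ∞ Γ U) {S : E → F}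
    (hS : ContDiffOn ℝ ∞ S U) : ContDiffOn ℝ ∞ (nabla ρ Γ S) U := by
  have h1 : ContDiffOn ℝ ∞ (fderiv ℝ S) U := hS.fderiv_of_isOpen (m := ∞) hU le_rfl
  have h2 : ContDiffOn ℝ ∞ (fun y => ρ.flip (S y)) U := ρ.flip.contDiff.comp_contDiffOn hS
  exact h1.add (h2.clm_comp hΓ)

/-- Partial derivatives commute. -/
theorem fderiv_fderiv_comm (hO : IsOpen O) {W : P → F} (hW : ContDiffOn ℝ ∞ W O) (e f : P) {p : P}
    (hp : p ∈ O) :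
    fderiv ℝ (fun p => fderiv ℝ W p f) p e = fderiv ℝ (fun p => fderiv ℝ W p e) p f := by
  have hs : IsSymmSndFDerivAt ℝ W p :=
    (hW.contDiffAt (hO.mem_nhds hp)).isSymmSndFDerivAt (by simp; exact WithTop.coe_le_coe.2 le_top)
  have hd : DifferentiableAt ℝ (fderiv ℝ W) p :=
    ((hW.fderiv_of_isOpen (m := ∞) hO le_rfl).contDiffAt (hO.mem_nhds hp)).differentiableAt
      (by simp)
  rw [fderiv_clm_apply hd (by fun_prop), fderiv_clm_apply hd (by fun_prop)]
  simpa using hs e f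

theorem ContDiffOn.differentiableAt_of_isOpen {W : P → F} (hW : ContDiffOn ℝ ∞ W O)
    (hO : IsOpen O) {p : P} (hp : p ∈ O) : DifferentiableAt ℝ W p :=
  (hW.contDiffAt (hO.mem_nhds hp)).differentiableAt (by simp)

/-- The curvature of the connection `Γ`. -/
def curvL (Γ : E → E →L[ℝ] E →L[ℝ] E) (y : E) : E →L[ℝ] E →L[ℝ] E →L[ℝ] E :=
  fderiv ℝ Γ y - (fderiv ℝ Γ y).flip
    + ((compL ℝ E E E).bilinearComp (Γ y) (Γ y) - ((compL ℝ E E E).bilinearComp (Γ y) (Γ y)).flip)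

set_option synthInstance.maxHeartbeats 100000 in
theorem curvL_apply (y u v w : E) : curvL Γ y u v w =
    fderiv ℝ Γ y u v w - fderiv ℝ Γ y v u w + (Γ y u (Γ y v w) - Γ y v (Γ y u w)) := by
  simp only [curvL, add_apply, sub_apply, flip_apply, bilinearComp_apply, compL_apply, comp_apply]

/-- In finite dimension a map into a space of linear maps is smooth as soon as its values on fixed
vectors are, so only the explicit formula for the curvature on u, v, w has to be inspected. -/
theorem contDiffOn_curvL [FiniteDimensional ℝ E] (hU : IsOpen U) (hΓ : ContDiffOn ℝ ∞ Γ U) :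
    ContDiffOn ℝ ∞ (curvL Γ) U := by
  have h1 : ContDiffOn ℝ ∞ (fderiv ℝ Γ) U := hΓ.fderiv_of_isOpen (m := ∞) hU le_rfl
  have hΓ1 : ∀ u v : E, ContDiffOn ℝ ∞ (fun y => Γ y u v) U := fun u v =>
    (hΓ.clm_apply contDiffOn_const).clm_apply contDiffOn_const
  have h2 : ∀ u v w : E, ContDiffOn ℝ ∞ (fun y => fderiv ℝ Γ y u v w) U := fun u v w =>
    ((h1.clm_apply contDiffOn_const).clm_apply contDiffOn_const).clm_apply contDiffOn_const
  have h3 : ∀ u v w : E, ContDiffOn ℝ ∞ (fun y => Γ y u (Γ y v w)) U := fun u v w =>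
    (hΓ.clm_apply contDiffOn_const).clm_apply (hΓ1 v w)
  refine contDiffOn_clm_apply.2 fun u => contDiffOn_clm_apply.2 fun v =>
    contDiffOn_clm_apply.2 fun w => ?_
  simp only [curvL_apply]
  exact ((h2 u v w).sub (h2 v u w)).add ((h3 u v w).sub (h3 v u w))

/-- Covariant derivatives commute up to curvature. -/
theorem vcov_vcov (hO : IsOpen O) (hU : IsOpen U) (hΓ : ContDiffOn ℝ ∞ Γ U)
    (hc : ContDiffOn ℝ ∞ c O)
    (hcU : MapsTo c O U) {W : P → E} (hW : ContDiffOn ℝ ∞ W O) (e f : P) {p : P} (hp : p ∈ O) :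
    vcov Γ c e (vcov Γ c f W) p = vcov Γ c f (vcov Γ c e W) p
      + curvL Γ (c p) (fderiv ℝ c p e) (fderiv ℝ c p f) (W p) := by
  have hWp := ContDiffOn.differentiableAt_of_isOpen hW hO hp
  have hcp := ContDiffOn.differentiableAt_of_isOpen hc hO hp
  have hΓp := ContDiffOn.differentiableAt_of_isOpen hΓ hU (hcU hp)
  have hΓc : DifferentiableAt ℝ (fun p => Γ (c p)) p := hΓp.comp p hcp
  -- In this expansion everything is symmetric in e and f except the term with the derivative of Γ
  -- and the term with Γ composed with Γ. Antisymmetrizing these two gives the curvature.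
  have key : ∀ e f : P, vcov Γ c e (vcov Γ c f W) p =
      fderiv ℝ (fun p => fderiv ℝ W p f) p e
      + (fderiv ℝ Γ (c p) (fderiv ℝ c p e) (fderiv ℝ c p f) (W p)
        + Γ (c p) (fderiv ℝ (fun p => fderiv ℝ c p f) p e) (W p)
        + Γ (c p) (fderiv ℝ c p f) (fderiv ℝ W p e))
      + Γ (c p) (fderiv ℝ c p e) (fderiv ℝ W p f)
      + Γ (c p) (fderiv ℝ c p e) (Γ (c p) (fderiv ℝ c p f) (W p)) := by
    intro e f
    have d1 : DifferentiableAt ℝ (fun p => fderiv ℝ W p f) p :=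
      ContDiffOn.differentiableAt_of_isOpen (contDiffOn_fderiv_apply hO le_rfl hW f) hO hp
    have d2 : DifferentiableAt ℝ (fun p => fderiv ℝ c p f) p :=
      ContDiffOn.differentiableAt_of_isOpen (contDiffOn_fderiv_apply hO le_rfl hc f) hO hp
    have d3 : DifferentiableAt ℝ (fun p => Γ (c p) (fderiv ℝ c p f)) p := hΓc.clm_apply d2
    have e1 : fderiv ℝ (vcov Γ c f W) p = fderiv ℝ (fun p => fderiv ℝ W p f) p
        + fderiv ℝ (fun p => Γ (c p) (fderiv ℝ c p f) (W p)) p :=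
      fderiv_fun_add d1 (d3.clm_apply hWp)
    have e2 : fderiv ℝ (fun p => Γ (c p)) p = (fderiv ℝ Γ (c p)).comp (fderiv ℝ c p) :=
      fderiv_comp p hΓp hcp
    rw [vcov_apply, e1, fderiv_clm_apply d3 hWp, fderiv_clm_apply hΓc d2, e2]
    simp only [vcov_apply, add_apply, comp_apply, flip_apply, map_add]
    abel
  rw [key e f, key f e, curvL_apply, fderiv_fderiv_comm hO hW e f hp,
    fderiv_fderiv_comm hO hc e f hp]
  abel

end LocalCalculus

/-! ### Levi-Civita connections on an open set: Leibniz rules and symmetries of the curvature. -/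

section LeviCivita

variable {E P : Type*} [NormedAddCommGroup E] [NormedSpace ℝ E]
  [NormedAddCommGroup P] [NormedSpace ℝ P]

/-- The action of `End E` on trilinear maps. -/
abbrev act₃ (E : Type*) [NormedAddCommGroup E] [NormedSpace ℝ E] :
    (E →L[ℝ] E) →L[ℝ] (E →L[ℝ] E →L[ℝ] E →L[ℝ] E) →L[ℝ] (E →L[ℝ] E →L[ℝ] E →L[ℝ] E) :=
  homAct (homAct (homAct (.id ℝ (E →L[ℝ] E))))

/-- The covariant derivative of the curvature. -/
def nablaCurvL (Γ : E → E →L[ℝ] E →L[ℝ] E) (y : E) : E →L[ℝ] E →L[ℝ] E →L[ℝ] E →L[ℝ] E :=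
  nabla (act₃ E) Γ (curvL Γ) y

/-- The second covariant derivative of the curvature. -/
def nabla2CurvL (Γ : E → E →L[ℝ] E →L[ℝ] E) (y : E) :
    E →L[ℝ] E →L[ℝ] E →L[ℝ] E →L[ℝ] E →L[ℝ] E :=
  nabla (homAct (act₃ E)) Γ (nablaCurvL Γ) y

variable {g : E → E →L[ℝ] E →L[ℝ] ℝ} {Γ : E → E →L[ℝ] E →L[ℝ] E} {U : Set E} {c : P → E}
  {O : Set P}

theorem act₃_apply (h : E →L[ℝ] E) (S : E →L[ℝ] E →L[ℝ] E →L[ℝ] E) (u v w : E) :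
    act₃ E h S u v w = h (S u v w) - S u v (h w) - S u (h v) w - S (h u) v w := by
  simp only [act₃, homAct_apply, sub_apply, id_apply]

theorem nablaCurvL_apply (y a u v w : E) : nablaCurvL Γ y a u v w =
    fderiv ℝ (curvL Γ) y a u v w + (Γ y a (curvL Γ y u v w) - curvL Γ y u v (Γ y a w)
      - curvL Γ y u (Γ y a v) w - curvL Γ y (Γ y a u) v w) := by
  rw [nablaCurvL, nabla_apply, add_apply, add_apply, add_apply, act₃_apply]

theorem nabla2CurvL_apply (y b a u v w : E) : nabla2CurvL Γ y b a u v w =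
    fderiv ℝ (nablaCurvL Γ) y b a u v w + (Γ y b (nablaCurvL Γ y a u v w)
      - nablaCurvL Γ y a u v (Γ y b w) - nablaCurvL Γ y a u (Γ y b v) w
      - nablaCurvL Γ y a (Γ y b u) v w - nablaCurvL Γ y (Γ y b a) u v w) := by
  rw [nabla2CurvL, nabla_apply, add_apply, add_apply, add_apply, add_apply, homAct_apply,
    sub_apply, sub_apply, sub_apply, act₃_apply]

theorem vcov_apply₃ {S : P → E →L[ℝ] E →L[ℝ] E →L[ℝ] E} {A B C : P → E} {e p : P}
    (hS : DifferentiableAt ℝ S p) (hA : DifferentiableAt ℝ A p) (hB : DifferentiableAt ℝ B p)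
    (hC : DifferentiableAt ℝ C p) :
    vcov Γ c e (fun p => S p (A p) (B p) (C p)) p =
      cov (act₃ E) Γ c e S p (A p) (B p) (C p) + S p (vcov Γ c e A p) (B p) (C p)
        + S p (A p) (vcov Γ c e B p) (C p) + S p (A p) (B p) (vcov Γ c e C p) := by
  have h1 : DifferentiableAt ℝ (fun p => S p (A p)) p := hS.clm_apply hA
  have h2 : DifferentiableAt ℝ (fun p => S p (A p) (B p)) p := h1.clm_apply hB
  rw [vcov, cov_clm_apply h2 hC, cov_clm_apply h1 hB, cov_clm_apply hS hA]
  simp only [add_apply]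

theorem vcov_apply₄ {S : P → E →L[ℝ] E →L[ℝ] E →L[ℝ] E →L[ℝ] E} {A B C D : P → E} {e p : P}
    (hS : DifferentiableAt ℝ S p) (hA : DifferentiableAt ℝ A p) (hB : DifferentiableAt ℝ B p)
    (hC : DifferentiableAt ℝ C p) (hD : DifferentiableAt ℝ D p) :
    vcov Γ c e (fun p => S p (A p) (B p) (C p) (D p)) p =
      cov (homAct (act₃ E)) Γ c e S p (A p) (B p) (C p) (D p)
        + S p (vcov Γ c e A p) (B p) (C p) (D p)
        + S p (A p) (vcov Γ c e B p) (C p) (D p) + S p (A p) (B p) (vcov Γ c e C p) (D p)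
        + S p (A p) (B p) (C p) (vcov Γ c e D p) := by
  have h1 : DifferentiableAt ℝ (fun p => S p (A p)) p := hS.clm_apply hA
  rw [vcov_apply₃ h1 hB hC hD, cov_clm_apply hS hA]
  simp only [add_apply]

/-- `Γ` is the Levi-Civita connection of the metric `g` on the open set `U`. -/
structure IsLeviCivitaOn (g : E → E →L[ℝ] E →L[ℝ] ℝ) (Γ : E → E →L[ℝ] E →L[ℝ] E) (U : Set E) :
    Prop where
  isOpen : IsOpen U
  smooth_metric : ContDiffOn ℝ ∞ g U
  smooth : ContDiffOn ℝ ∞ Γ U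
  metric_symm : ∀ y ∈ U, ∀ u v, g y u v = g y v u
  symm : ∀ y ∈ U, ∀ u v, Γ y u v = Γ y v u
  compat : ∀ y ∈ U, ∀ a u v, fderiv ℝ g y a u v = g y (Γ y a u) v + g y u (Γ y a v)
  nondeg : ∀ y ∈ U, ∀ u, (∀ v, g y u v = 0) → u = 0

namespace IsLeviCivitaOn

theorem mono (h : IsLeviCivitaOn g Γ U) {U' : Set E} (hU' : IsOpen U') (hs : U' ⊆ U) :
    IsLeviCivitaOn g Γ U' :=
  ⟨hU', h.smooth_metric.mono hs, h.smooth.mono hs, fun y hy => h.metric_symm y (hs hy),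
    fun y hy => h.symm y (hs hy), fun y hy => h.compat y (hs hy), fun y hy => h.nondeg y (hs hy)⟩

/-- Metric compatibility, pulled back along an arbitrary map c. Every later integration by parts
rests on it. -/
theorem fderiv_metric (h : IsLeviCivitaOn g Γ U) {W Z : P → E} {e p : P}
    (hc : DifferentiableAt ℝ c p) (hcU : c p ∈ U) (hW : DifferentiableAt ℝ W p)
    (hZ : DifferentiableAt ℝ Z p) :
    fderiv ℝ (fun p => g (c p) (W p) (Z p)) p e =
      g (c p) (vcov Γ c e W p) (Z p) + g (c p) (W p) (vcov Γ c e Z p) := by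
  have hg := ContDiffOn.differentiableAt_of_isOpen h.smooth_metric h.isOpen hcU
  have hgc : DifferentiableAt ℝ (fun p => g (c p)) p := hg.comp p hc
  have h1 : fderiv ℝ (fun p => g (c p)) p = (fderiv ℝ g (c p)).comp (fderiv ℝ c p) :=
    fderiv_comp p hg hc
  rw [fderiv_clm_apply (hgc.clm_apply hW) hZ, fderiv_clm_apply hgc hW, h1]
  simp only [add_apply, comp_apply, flip_apply, h.compat _ hcU, vcov_apply, map_add]
  ring

theorem curv_skew (y u v w : E) : curvL Γ y u v w = - curvL Γ y v u w := by
  simp only [curvL_apply]; abel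

/-- Γ is symmetric on an open set, so its derivative is symmetric in the same two slots (`hs`). The
terms of the cyclic sum then cancel in pairs. -/
theorem bianchi (h : IsLeviCivitaOn g Γ U) {y : E} (hy : y ∈ U) (u v w : E) :
    curvL Γ y u v w + curvL Γ y v w u + curvL Γ y w u v = 0 := by
  have hΓ := ContDiffOn.differentiableAt_of_isOpen h.smooth h.isOpen hy
  have hs : ∀ a b d : E, fderiv ℝ Γ y a b d = fderiv ℝ Γ y a d b := by
    intro a b d
    have e1 : ∀ b d : E, fderiv ℝ (fun z => Γ z b d) y a = fderiv ℝ Γ y a b d := by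
      intro b d
      rw [fderiv_clm_apply (hΓ.clm_apply (by fun_prop)) (by fun_prop),
        fderiv_clm_apply hΓ (by fun_prop)]
      simp
    rw [← e1, ← e1, fderiv_congr_of_isOpen h.isOpen (fun z hz => h.symm z hz b d) hy]
  simp only [curvL_apply]
  rw [hs u v w, hs v w u, hs w u v, h.symm y hy v w, h.symm y hy u w, h.symm y hy u v]
  abel

/-- The second partial derivatives of the function q ↦ g q w z commute. Expanding them by
compatibility, each exchange of covariant derivatives leaves a curvature term, one on w and one on
z, and the two must cancel. -/
theorem metric_curv_skew (h : IsLeviCivitaOn g Γ U) {y : E} (hy : y ∈ U) (u v w z : E) :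
    g y (curvL Γ y u v w) z = - g y (curvL Γ y u v z) w := by
  have hid : ContDiffOn ℝ ∞ (id : E → E) U := contDiff_id.contDiffOn
  have hmap : MapsTo (id : E → E) U U := mapsTo_id U
  have hdc : ∀ b : E, ∀ W : E → E, ContDiffOn ℝ ∞ W U →
      ContDiffOn ℝ ∞ (vcov Γ id b W) U := fun b W hW =>
    contDiffOn_cov h.isOpen h.smooth hid hmap hW b
  have hc : ∀ a : E, ContDiffOn ℝ ∞ (fun _ : E => a) U := fun a => contDiffOn_const
  have key : ∀ a b : E, fderiv ℝ (fun p => fderiv ℝ (fun q => g q w z) p b) y a =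
      g y (vcov Γ id a (vcov Γ id b (fun _ => w)) y) z
      + g y (vcov Γ id b (fun _ => w) y) (vcov Γ id a (fun _ => z) y)
      + (g y (vcov Γ id a (fun _ => w) y) (vcov Γ id b (fun _ => z) y)
      + g y w (vcov Γ id a (vcov Γ id b (fun _ => z)) y)) := by
    intro a b
    have e1 : EqOn (fun p => fderiv ℝ (fun q => g q w z) p b)
        (fun p => g p (vcov Γ id b (fun _ => w) p) z
          + g p w (vcov Γ id b (fun _ => z) p)) U := by
      intro p hp
      exact h.fderiv_metric (c := id) (W := fun _ => w) (Z := fun _ => z) differentiableAt_id hp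
        (by fun_prop) (by fun_prop)
    have hw := ContDiffOn.differentiableAt_of_isOpen (hdc b _ (hc w)) h.isOpen hy
    have hz := ContDiffOn.differentiableAt_of_isOpen (hdc b _ (hc z)) h.isOpen hy
    have hg := ContDiffOn.differentiableAt_of_isOpen h.smooth_metric h.isOpen hy
    have d1 : DifferentiableAt ℝ (fun p => g p (vcov Γ id b (fun _ => w) p) z) y :=
      (hg.clm_apply hw).clm_apply (by fun_prop)
    have d2 : DifferentiableAt ℝ (fun p => g p w (vcov Γ id b (fun _ => z) p)) y :=
      (hg.clm_apply (by fun_prop)).clm_apply hz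
    have e2 := h.fderiv_metric (c := id) (W := vcov Γ id b fun _ => w) (Z := fun _ => z)
        (e := a) differentiableAt_id hy hw (by fun_prop)
    have e3 := h.fderiv_metric (c := id) (W := fun _ => w) (Z := vcov Γ id b fun _ => z)
        (e := a) differentiableAt_id hy (by fun_prop) hz
    simp only [id_eq] at e2 e3
    rw [fderiv_congr_of_isOpen h.isOpen e1 hy, fderiv_fun_add d1 d2, add_apply, e2, e3]
  have hgwz : ContDiffOn ℝ ∞ (fun q => g q w z) U :=
    (h.smooth_metric.clm_apply contDiffOn_const).clm_apply contDiffOn_const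
  have hcomm := fderiv_fderiv_comm h.isOpen hgwz u v hy
  rw [key u v, key v u, vcov_vcov h.isOpen h.isOpen h.smooth hid hmap (hc w) u v hy,
    vcov_vcov h.isOpen h.isOpen h.smooth hid hmap (hc z) u v hy] at hcomm
  simp only [fderiv_id, id_apply, id_eq, map_add, add_apply] at hcomm
  linarith [h.metric_symm y hy w (curvL Γ y u v z)]

/-- Pair symmetry of the curvature. -/
theorem metric_curv_pair (h : IsLeviCivitaOn g Γ U) {y : E} (hy : y ∈ U) (u v w z : E) :
    g y (curvL Γ y u v w) z = g y (curvL Γ y w z u) v := by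
  have b : ∀ u v w z, g y (curvL Γ y u v w) z + g y (curvL Γ y v w u) z
      + g y (curvL Γ y w u v) z = 0 := by
    intro u v w z
    rw [← add_apply, ← map_add, ← add_apply, ← map_add, h.bianchi hy]; simp
  have s : ∀ u v w z, g y (curvL Γ y u v w) z = - g y (curvL Γ y v u w) z := by
    intro u v w z
    rw [curv_skew, map_neg, neg_apply]
  have m := fun u v w z => h.metric_curv_skew hy u v w z
  -- Milnor's octahedron argument: the four Bianchi sums, one for each choice of the vector in the
  -- last slot, combined with the two skew symmetries.
  linarith [b u v w z, b v w z u, b w z u v, b z u v w, m u v w z, m v w u z, m w u v z,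
    m v w z u, m w z v u, m z v w u, m w z u v, m z u w v, m u w z v, m z u v w, m u v z w,
    m v z u w, s u v w z, s v w u z, s w u v z, s w z u v, s z u w v, s z v w u, s u w z v,
    s v z u w, s z u v w, s w z v u, s v w z u, s u v z w]

end IsLeviCivitaOn

end LeviCivita

/-! ### The Euler-Lagrange expression in a chart and its linearization. -/

section Variation

/-- The expression `F` as a function of the values of `R`, `∇R`, `∇²R` and of the covariant
derivatives `X, DX/dt, D²X/dt²` and `Y, DY/dt, D²Y/dt²`. -/
def jacobiF {E : Type*} [AddCommGroup E] [Module ℝ E] (R : E → E → E → E)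
    (dR : E → E → E → E → E) (d2R : E → E → E → E → E → E) (X₀ X₁ X₂ Y Y₁ Y₂ : E) : E :=
  (d2R Y Y X₀ Y Y + dR Y₁ X₀ Y Y) + dR X₀ Y₁ Y Y + R (R X₀ Y Y) Y Y + R X₀ Y₂ Y
    + (2 : ℝ) • (dR Y X₁ Y Y + dR Y X₀ Y₁ Y + R X₂ Y Y)
    + (3 : ℝ) • (dR Y X₀ Y Y₁ + R X₀ Y Y₂ + R X₀ Y₁ Y₁)
    + (4 : ℝ) • R X₁ Y Y₁

variable {E P : Type*} [NormedAddCommGroup E] [NormedSpace ℝ E]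
  [NormedAddCommGroup P] [NormedSpace ℝ P]

/-- The covariant derivative of a vector field `G`. -/
def nablaVec (Γ : E → E →L[ℝ] E →L[ℝ] E) (G : E → E) (y u : E) : E :=
  fderiv ℝ G y u + Γ y u (G y)

/-- The Euler-Lagrange expression `D³Y + R(DY, Y)Y + G` of the curves `c` in the direction `t`. -/
def eulerL (Γ : E → E →L[ℝ] E →L[ℝ] E) (G : E → E) (c : P → E) (t : P) (p : P) : E :=
  (vcov Γ c t)^[3] (fun p => fderiv ℝ c p t) p
    + curvL Γ (c p) (vcov Γ c t (fun p => fderiv ℝ c p t) p) (fderiv ℝ c p t) (fderiv ℝ c p t)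
    + G (c p)

/-- The operator `D⁴Z + F(Z) + ∇_Z G`. -/
def jacobiL (Γ : E → E →L[ℝ] E →L[ℝ] E) (G : E → E) (c : P → E) (t : P) (Z : P → E) (p : P) : E :=
  (vcov Γ c t)^[4] Z p
    + jacobiF (fun u v w => curvL Γ (c p) u v w) (fun a u v w => nablaCurvL Γ (c p) a u v w)
      (fun b a u v w => nabla2CurvL Γ (c p) b a u v w) (Z p) (vcov Γ c t Z p)
      ((vcov Γ c t)^[2] Z p) (fderiv ℝ c p t) (vcov Γ c t (fun p => fderiv ℝ c p t) p)
      ((vcov Γ c t)^[2] (fun p => fderiv ℝ c p t) p)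
    + nablaVec Γ G (c p) (Z p)

/-- The Lagrangian `½ |DY|² + V`. -/
def lagrangian (g : E → E →L[ℝ] E →L[ℝ] ℝ) (Γ : E → E →L[ℝ] E →L[ℝ] E) (V : E → ℝ) (c : P → E)
    (t : P) (p : P) : ℝ :=
  (1 / 2) * g (c p) (vcov Γ c t (fun p => fderiv ℝ c p t) p)
      (vcov Γ c t (fun p => fderiv ℝ c p t) p) + V (c p)

/-- The boundary term `⟨DY, DX⟩ - ⟨D²Y, X⟩` of the first variation. -/
def boundaryL (g : E → E →L[ℝ] E →L[ℝ] ℝ) (Γ : E → E →L[ℝ] E →L[ℝ] E) (c : P → E)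
    (t s : P) (p : P) : ℝ :=
  g (c p) (vcov Γ c t (fun p => fderiv ℝ c p t) p) (vcov Γ c t (fun p => fderiv ℝ c p s) p)
    - g (c p) ((vcov Γ c t)^[2] (fun p => fderiv ℝ c p t) p) (fderiv ℝ c p s)

variable {g : E → E →L[ℝ] E →L[ℝ] ℝ} {Γ : E → E →L[ℝ] E →L[ℝ] E} {U : Set E} {c : P → E}
  {O : Set P}

/-- A smooth map from an open set into the domain of a Levi-Civita connection. -/
structure IsSmoothInto (c : P → E) (O : Set P) (U : Set E) : Prop where
  isOpen : IsOpen O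
  smooth : ContDiffOn ℝ ∞ c O
  mapsTo : MapsTo c O U

namespace IsLeviCivitaOn

theorem contDiffOn_vcov (h : IsLeviCivitaOn g Γ U) (hc : IsSmoothInto c O U) {W : P → E}
    (hW : ContDiffOn ℝ ∞ W O) (e : P) : ContDiffOn ℝ ∞ (vcov Γ c e W) O :=
  contDiffOn_cov hc.isOpen h.smooth hc.smooth hc.mapsTo hW e

theorem contDiffOn_vcov_iterate (h : IsLeviCivitaOn g Γ U) (hc : IsSmoothInto c O U) {W : P → E}
    (hW : ContDiffOn ℝ ∞ W O) (e : P) (k : ℕ) : ContDiffOn ℝ ∞ ((vcov Γ c e)^[k] W) O := by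
  induction k with
  | zero => exact hW
  | succ k ih => rw [Function.iterate_succ_apply']; exact h.contDiffOn_vcov hc ih e

theorem contDiffOn_partial (hc : IsSmoothInto c O U) (e : P) :
    ContDiffOn ℝ ∞ (fun p => fderiv ℝ c p e) O :=
  contDiffOn_fderiv_apply hc.isOpen le_rfl hc.smooth e

theorem contDiffOn_metric (h : IsLeviCivitaOn g Γ U) (hc : IsSmoothInto c O U) {W Z : P → E}
    (hW : ContDiffOn ℝ ∞ W O) (hZ : ContDiffOn ℝ ∞ Z O) :
    ContDiffOn ℝ ∞ (fun p => g (c p) (W p) (Z p)) O :=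
  ((h.smooth_metric.comp hc.smooth hc.mapsTo).clm_apply hW).clm_apply hZ

theorem fderiv_metric' (h : IsLeviCivitaOn g Γ U) (hc : IsSmoothInto c O U) {W Z : P → E}
    (hW : ContDiffOn ℝ ∞ W O) (hZ : ContDiffOn ℝ ∞ Z O) (e : P) {p : P} (hp : p ∈ O) :
    fderiv ℝ (fun p => g (c p) (W p) (Z p)) p e =
      g (c p) (vcov Γ c e W p) (Z p) + g (c p) (W p) (vcov Γ c e Z p) :=
  h.fderiv_metric (ContDiffOn.differentiableAt_of_isOpen hc.smooth hc.isOpen hp) (hc.mapsTo hp)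
    (ContDiffOn.differentiableAt_of_isOpen hW hc.isOpen hp)
    (ContDiffOn.differentiableAt_of_isOpen hZ hc.isOpen hp)

/-- Absence of torsion: partial derivatives of c commute and Γ is symmetric. It lets the velocity
and the variation field exchange roles. -/
theorem vcov_partial (h : IsLeviCivitaOn g Γ U) (hc : IsSmoothInto c O U) (e f : P) :
    EqOn (vcov Γ c e (fun p => fderiv ℝ c p f)) (vcov Γ c f (fun p => fderiv ℝ c p e)) O := by
  intro p hp
  rw [vcov_apply, vcov_apply, fderiv_fderiv_comm hc.isOpen hc.smooth e f hp,
    h.symm _ (hc.mapsTo hp)]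

theorem vcov_curvL [FiniteDimensional ℝ E] (h : IsLeviCivitaOn g Γ U) (hc : IsSmoothInto c O U)
    {A B C : P → E} (hA : ContDiffOn ℝ ∞ A O) (hB : ContDiffOn ℝ ∞ B O) (hC : ContDiffOn ℝ ∞ C O)
    (e : P) {p : P} (hp : p ∈ O) :
    vcov Γ c e (fun p => curvL Γ (c p) (A p) (B p) (C p)) p =
      nablaCurvL Γ (c p) (fderiv ℝ c p e) (A p) (B p) (C p)
        + curvL Γ (c p) (vcov Γ c e A p) (B p) (C p)
        + curvL Γ (c p) (A p) (vcov Γ c e B p) (C p)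
        + curvL Γ (c p) (A p) (B p) (vcov Γ c e C p) := by
  have hd := fun {W : P → E} (hW : ContDiffOn ℝ ∞ W O) =>
    ContDiffOn.differentiableAt_of_isOpen hW hc.isOpen hp
  have hR := ContDiffOn.differentiableAt_of_isOpen (contDiffOn_curvL h.isOpen h.smooth) h.isOpen
    (hc.mapsTo hp)
  have hRc : DifferentiableAt ℝ (fun p => curvL Γ (c p)) p := hR.comp p (hd hc.smooth)
  rw [vcov_apply₃ hRc (hd hA) (hd hB) (hd hC), cov_comp hR (hd hc.smooth)]
  rfl

theorem contDiffOn_nablaCurvL [FiniteDimensional ℝ E] (h : IsLeviCivitaOn g Γ U) :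
    ContDiffOn ℝ ∞ (nablaCurvL Γ) U :=
  contDiffOn_nabla h.isOpen h.smooth (contDiffOn_curvL h.isOpen h.smooth)

theorem contDiffOn_nabla2CurvL [FiniteDimensional ℝ E] (h : IsLeviCivitaOn g Γ U) :
    ContDiffOn ℝ ∞ (nabla2CurvL Γ) U :=
  contDiffOn_nabla h.isOpen h.smooth h.contDiffOn_nablaCurvL

theorem vcov_nablaCurvL [FiniteDimensional ℝ E] (h : IsLeviCivitaOn g Γ U)
    (hc : IsSmoothInto c O U)
    {A B C D : P → E} (hA : ContDiffOn ℝ ∞ A O) (hB : ContDiffOn ℝ ∞ B O)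
    (hC : ContDiffOn ℝ ∞ C O) (hD : ContDiffOn ℝ ∞ D O) (e : P) {p : P} (hp : p ∈ O) :
    vcov Γ c e (fun p => nablaCurvL Γ (c p) (A p) (B p) (C p) (D p)) p =
      nabla2CurvL Γ (c p) (fderiv ℝ c p e) (A p) (B p) (C p) (D p)
        + nablaCurvL Γ (c p) (vcov Γ c e A p) (B p) (C p) (D p)
        + nablaCurvL Γ (c p) (A p) (vcov Γ c e B p) (C p) (D p)
        + nablaCurvL Γ (c p) (A p) (B p) (vcov Γ c e C p) (D p)
        + nablaCurvL Γ (c p) (A p) (B p) (C p) (vcov Γ c e D p) := by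
  have hd := fun {W : P → E} (hW : ContDiffOn ℝ ∞ W O) =>
    ContDiffOn.differentiableAt_of_isOpen hW hc.isOpen hp
  have hR := ContDiffOn.differentiableAt_of_isOpen h.contDiffOn_nablaCurvL h.isOpen
    (hc.mapsTo hp)
  have hRc : DifferentiableAt ℝ (fun p => nablaCurvL Γ (c p)) p := hR.comp p (hd hc.smooth)
  rw [vcov_apply₄ hRc (hd hA) (hd hB) (hd hC) (hd hD), cov_comp hR (hd hc.smooth)]
  rfl

theorem contDiffOn_curvL_apply [FiniteDimensional ℝ E] (h : IsLeviCivitaOn g Γ U)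
    (hc : IsSmoothInto c O U)
    {A B C : P → E} (hA : ContDiffOn ℝ ∞ A O) (hB : ContDiffOn ℝ ∞ B O)
    (hC : ContDiffOn ℝ ∞ C O) :
    ContDiffOn ℝ ∞ (fun p => curvL Γ (c p) (A p) (B p) (C p)) O :=
  ((((contDiffOn_curvL h.isOpen h.smooth).comp hc.smooth hc.mapsTo).clm_apply hA).clm_apply
    hB).clm_apply hC

theorem contDiffOn_nablaCurvL_apply [FiniteDimensional ℝ E] (h : IsLeviCivitaOn g Γ U)
    (hc : IsSmoothInto c O U)
    {A B C D : P → E} (hA : ContDiffOn ℝ ∞ A O) (hB : ContDiffOn ℝ ∞ B O)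
    (hC : ContDiffOn ℝ ∞ C O) (hD : ContDiffOn ℝ ∞ D O) :
    ContDiffOn ℝ ∞ (fun p => nablaCurvL Γ (c p) (A p) (B p) (C p) (D p)) O :=
  ((((h.contDiffOn_nablaCurvL.comp hc.smooth hc.mapsTo).clm_apply hA).clm_apply
    hB).clm_apply hC).clm_apply hD

theorem contDiffOn_eulerL [FiniteDimensional ℝ E] (h : IsLeviCivitaOn g Γ U)
    (hc : IsSmoothInto c O U) {G : E → E} (hG : ContDiffOn ℝ ∞ G U) (t : P) :
    ContDiffOn ℝ ∞ (eulerL Γ G c t) O := by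
  have hY := contDiffOn_partial hc t
  exact ((h.contDiffOn_vcov_iterate hc hY t 3).add (h.contDiffOn_curvL_apply hc
    (h.contDiffOn_vcov hc hY t) hY hY)).add (hG.comp hc.smooth hc.mapsTo)

/-- The linearization of the Euler-Lagrange expression. -/
theorem vcov_eulerL [FiniteDimensional ℝ E] (h : IsLeviCivitaOn g Γ U)
    (hc : IsSmoothInto c O U) {G : E → E} (hG : ContDiffOn ℝ ∞ G U) (t r : P) {p : P}
    (hp : p ∈ O) :
    vcov Γ c r (eulerL Γ G c t) p = jacobiL Γ G c t (fun p => fderiv ℝ c p r) p := by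
  have hd := fun {W : P → E} (hW : ContDiffOn ℝ ∞ W O) {p : P} (hp : p ∈ O) =>
    ContDiffOn.differentiableAt_of_isOpen hW hc.isOpen hp
  set Y : P → E := fun p => fderiv ℝ c p t with hYdef
  set Z : P → E := fun p => fderiv ℝ c p r with hZdef
  have hY : ContDiffOn ℝ ∞ Y O := contDiffOn_partial hc t
  have hZ : ContDiffOn ℝ ∞ Z O := contDiffOn_partial hc r
  have hD := fun {W : P → E} (hW : ContDiffOn ℝ ∞ W O) => h.contDiffOn_vcov hc hW t
  have hR := fun {A B C : P → E} (hA : ContDiffOn ℝ ∞ A O) (hB : ContDiffOn ℝ ∞ B O)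
    (hC : ContDiffOn ℝ ∞ C O) => h.contDiffOn_curvL_apply hc hA hB hC
  have hN := fun {A B C D : P → E} (hA : ContDiffOn ℝ ∞ A O) (hB : ContDiffOn ℝ ∞ B O)
    (hC : ContDiffOn ℝ ∞ C O) (hD : ContDiffOn ℝ ∞ D O) =>
    h.contDiffOn_nablaCurvL_apply hc hA hB hC hD
  have comm : ∀ {W : P → E}, ContDiffOn ℝ ∞ W O → ∀ p ∈ O, vcov Γ c r (vcov Γ c t W) p
      = vcov Γ c t (vcov Γ c r W) p + curvL Γ (c p) (Z p) (Y p) (W p) := fun hW p hp =>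
    vcov_vcov hc.isOpen h.isOpen h.smooth hc.smooth hc.mapsTo hW r t hp
  set DY := vcov Γ c t Y with hDY
  set DDY := vcov Γ c t DY with hDDY
  set DZ := vcov Γ c t Z with hDZ
  set DDZ := vcov Γ c t DZ with hDDZ
  -- Absence of torsion starts the recursion with D_r Y = D_t Z. Each further identity moves D_r
  -- past one more D_t, which adds a term R(Z, Y)(·). The t-derivatives of these terms, by the
  -- Leibniz rule, account for most of F.
  have a0 : EqOn (vcov Γ c r Y) DZ O := h.vcov_partial hc r t
  have a1 : EqOn (vcov Γ c r DY) (fun p => DDZ p + curvL Γ (c p) (Z p) (Y p) (Y p)) O := by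
    intro p hp
    rw [hDY, comm (W := Y) hY p hp, vcov_congr (Γ := Γ) (c := c) hc.isOpen a0 t hp]
  have a2 : EqOn (vcov Γ c r DDY) (fun p => vcov Γ c t DDZ p
      + (nablaCurvL Γ (c p) (Y p) (Z p) (Y p) (Y p) + curvL Γ (c p) (DZ p) (Y p) (Y p)
        + curvL Γ (c p) (Z p) (DY p) (Y p) + curvL Γ (c p) (Z p) (Y p) (DY p))
      + curvL Γ (c p) (Z p) (Y p) (DY p)) O := by
    intro p hp
    rw [hDDY, comm (W := DY) (hD hY) p hp, vcov_congr hc.isOpen a1 t hp,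
      vcov_add (hd (hD (hD hZ)) hp) (hd (hR hZ hY hY) hp),
      h.vcov_curvL hc hZ hY hY t hp]
  have a3 : vcov Γ c r (vcov Γ c t DDY) p = vcov Γ c t (vcov Γ c t DDZ) p
      + ((nabla2CurvL Γ (c p) (Y p) (Y p) (Z p) (Y p) (Y p)
          + nablaCurvL Γ (c p) (DY p) (Z p) (Y p) (Y p)
          + nablaCurvL Γ (c p) (Y p) (DZ p) (Y p) (Y p)
          + nablaCurvL Γ (c p) (Y p) (Z p) (DY p) (Y p)
          + nablaCurvL Γ (c p) (Y p) (Z p) (Y p) (DY p))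
        + (nablaCurvL Γ (c p) (Y p) (DZ p) (Y p) (Y p) + curvL Γ (c p) (DDZ p) (Y p) (Y p)
          + curvL Γ (c p) (DZ p) (DY p) (Y p) + curvL Γ (c p) (DZ p) (Y p) (DY p))
        + (nablaCurvL Γ (c p) (Y p) (Z p) (DY p) (Y p) + curvL Γ (c p) (DZ p) (DY p) (Y p)
          + curvL Γ (c p) (Z p) (DDY p) (Y p) + curvL Γ (c p) (Z p) (DY p) (DY p))
        + (nablaCurvL Γ (c p) (Y p) (Z p) (Y p) (DY p) + curvL Γ (c p) (DZ p) (Y p) (DY p)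
          + curvL Γ (c p) (Z p) (DY p) (DY p) + curvL Γ (c p) (Z p) (Y p) (DDY p)))
      + (nablaCurvL Γ (c p) (Y p) (Z p) (Y p) (DY p) + curvL Γ (c p) (DZ p) (Y p) (DY p)
          + curvL Γ (c p) (Z p) (DY p) (DY p) + curvL Γ (c p) (Z p) (Y p) (DDY p))
      + curvL Γ (c p) (Z p) (Y p) (DDY p) := by
    have s1 := hN hY hZ hY hY
    have s2 := hR (hD hZ) hY hY
    have s3 := hR hZ (hD hY) hY
    have s4 := hR hZ hY (hD hY)
    rw [comm (W := DDY) (hD (hD hY)) p hp, vcov_congr hc.isOpen a2 t hp,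
      vcov_add (hd ((hD (hD (hD hZ))).add (((s1.add s2).add s3).add s4)) hp) (hd s4 hp),
      vcov_add (hd (hD (hD (hD hZ))) hp) (hd (((s1.add s2).add s3).add s4) hp),
      vcov_add (hd ((s1.add s2).add s3) hp) (hd s4 hp),
      vcov_add (hd (s1.add s2) hp) (hd s3 hp), vcov_add (hd s1 hp) (hd s2 hp)]
    rw [h.vcov_nablaCurvL hc hY hZ hY hY t hp, h.vcov_curvL hc (hD hZ) hY hY t hp,
      h.vcov_curvL hc hZ (hD hY) hY t hp, h.vcov_curvL hc hZ hY (hD hY) t hp]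
  have hGd : DifferentiableAt ℝ G (c p) :=
    ContDiffOn.differentiableAt_of_isOpen hG h.isOpen (hc.mapsTo hp)
  have a4 : vcov Γ c r (fun p => G (c p)) p = nablaVec Γ G (c p) (Z p) := by
    rw [vcov, cov_comp hGd (hd hc.smooth hp)]; rfl
  have a5 := h.vcov_curvL hc (hD hY) hY hY r hp
  rw [← hDY, a1 hp, a0 hp] at a5
  have a6 : vcov Γ c r (eulerL Γ G c t) p = vcov Γ c r (vcov Γ c t DDY) p
      + vcov Γ c r (fun p => curvL Γ (c p) (DY p) (Y p) (Y p)) p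
      + vcov Γ c r (fun p => G (c p)) p := by
    have s3 := hD (hD (hD hY))
    have s4 := hR (hD hY) hY hY
    have hGc : ContDiffOn ℝ ∞ (fun p => G (c p)) O := hG.comp hc.smooth hc.mapsTo
    rw [← vcov_add (hd s3 hp) (hd s4 hp),
      ← vcov_add (hd (s3.add s4) hp) (hd hGc hp)]
    rfl
  have hb := h.bianchi (hc.mapsTo hp) (DZ p) (DY p) (Y p)
  have hs := curv_skew (Γ := Γ) (c p) (Y p) (DZ p) (DY p)
  rw [a6, a3, a4, a5]
  simp only [jacobiL, jacobiF, Function.iterate_succ_apply', Function.iterate_zero_apply]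
  simp only [← hDZ, ← hDDZ, map_add, add_apply]
  change _ = vcov Γ c t (vcov Γ c t DDZ) p + _ + _
  -- Up to skew symmetry, the terms in DZ, Y and DY collected so far are 3 R(DZ, Y)DY + R(DZ, DY)Y +
  -- R(DY, Y)DZ. The first Bianchi identity turns the last two into one more R(DZ, Y)DY, whence the
  -- coefficient 4 in F.
  have hb' : curvL Γ (c p) (DZ p) (DY p) (Y p) + curvL Γ (c p) (DY p) (Y p) (DZ p)
      = curvL Γ (c p) (DZ p) (Y p) (DY p) := by
    rw [curv_skew (Γ := Γ) (c p) (DZ p) (Y p) (DY p)]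
    exact eq_neg_of_add_eq_zero_left hb
  have hb'' := curv_skew (Γ := Γ) (c p) (DY p) (DZ p) (Y p)
  linear_combination (norm := module) hb' + hb''

end IsLeviCivitaOn

end Variation

/-! ### First and second variation of the Lagrangian in a chart. -/

section VariationFormulas

variable {E P : Type*} [NormedAddCommGroup E] [NormedSpace ℝ E]
  [NormedAddCommGroup P] [NormedSpace ℝ P]
  {g : E → E →L[ℝ] E →L[ℝ] ℝ} {Γ : E → E →L[ℝ] E →L[ℝ] E} {U : Set E} {c : P → E}
  {O : Set P}

namespace IsLeviCivitaOn

theorem contDiffOn_lagrangian (h : IsLeviCivitaOn g Γ U) (hc : IsSmoothInto c O U) {V : E → ℝ}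
    (hV : ContDiffOn ℝ ∞ V U) (t : P) : ContDiffOn ℝ ∞ (lagrangian g Γ V c t) O := by
  have hY := h.contDiffOn_vcov hc (contDiffOn_partial hc t) t
  have h1 := contDiffOn_const (c := (1 / 2 : ℝ)).mul (h.contDiffOn_metric hc hY hY)
  have h2 := h1.add (hV.comp hc.smooth hc.mapsTo)
  refine h2.congr fun p _ => ?_
  simp [lagrangian]

theorem contDiffOn_boundaryL (h : IsLeviCivitaOn g Γ U) (hc : IsSmoothInto c O U) (t s : P) :
    ContDiffOn ℝ ∞ (boundaryL g Γ c t s) O := by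
  have hY := contDiffOn_partial hc t
  have hX := contDiffOn_partial hc s
  exact (h.contDiffOn_metric hc (h.contDiffOn_vcov hc hY t) (h.contDiffOn_vcov hc hX t)).sub
    (h.contDiffOn_metric hc (h.contDiffOn_vcov_iterate hc hY t 2) hX)

/-- First variation formula. -/
theorem fderiv_lagrangian (h : IsLeviCivitaOn g Γ U) (hc : IsSmoothInto c O U)
    {V : E → ℝ} (hV : ContDiffOn ℝ ∞ V U) {G : E → E}
    (hVG : ∀ y ∈ U, ∀ w, g y (G y) w = fderiv ℝ V y w) (t s : P) {p : P} (hp : p ∈ O) :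
    fderiv ℝ (lagrangian g Γ V c t) p s =
      g (c p) (eulerL Γ G c t p) (fderiv ℝ c p s) + fderiv ℝ (boundaryL g Γ c t s) p t := by
  have hd := fun {W : P → ℝ} (hW : ContDiffOn ℝ ∞ W O) =>
    ContDiffOn.differentiableAt_of_isOpen hW hc.isOpen hp
  have hcU := hc.mapsTo hp
  set Y : P → E := fun p => fderiv ℝ c p t with hYdef
  set X : P → E := fun p => fderiv ℝ c p s with hXdef
  have hY : ContDiffOn ℝ ∞ Y O := contDiffOn_partial hc t
  have hX : ContDiffOn ℝ ∞ X O := contDiffOn_partial hc s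
  have hD := fun {W : P → E} (hW : ContDiffOn ℝ ∞ W O) => h.contDiffOn_vcov hc hW t
  have hm := fun {A B : P → E} (hA : ContDiffOn ℝ ∞ A O) (hB : ContDiffOn ℝ ∞ B O) =>
    h.contDiffOn_metric hc hA hB
  set DY := vcov Γ c t Y with hDY
  set DDY := vcov Γ c t DY with hDDY
  set DX := vcov Γ c t X with hDX
  have a0 : EqOn (vcov Γ c s Y) DX O := h.vcov_partial hc s t
  have a1 : vcov Γ c s DY p = vcov Γ c t DX p + curvL Γ (c p) (X p) (Y p) (Y p) := by
    rw [hDY, vcov_vcov hc.isOpen h.isOpen h.smooth hc.smooth hc.mapsTo hY s t hp,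
      vcov_congr (Γ := Γ) (c := c) hc.isOpen a0 t hp]
  have hVd := ContDiffOn.differentiableAt_of_isOpen hV h.isOpen hcU
  have hcd := ContDiffOn.differentiableAt_of_isOpen hc.smooth hc.isOpen hp
  have e1 : fderiv ℝ (lagrangian g Γ V c t) p s =
      (1 / 2) * fderiv ℝ (fun p => g (c p) (DY p) (DY p)) p s + g (c p) (G (c p)) (X p) := by
    have : lagrangian g Γ V c t = fun p => (1 / 2) * g (c p) (DY p) (DY p) + V (c p) := rfl
    have hVc : fderiv ℝ (fun p => V (c p)) p = (fderiv ℝ V (c p)).comp (fderiv ℝ c p) :=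
      fderiv_comp p hVd hcd
    have hVcd : DifferentiableAt ℝ (fun p => V (c p)) p := hVd.comp p hcd
    rw [this, fderiv_fun_add ((hd (hm (hD hY) (hD hY))).const_mul _) hVcd,
      fderiv_const_mul (hd (hm (hD hY) (hD hY))), hVc, hVG _ hcU]
    simp [hXdef]
    rfl
  have e2 : fderiv ℝ (boundaryL g Γ c t s) p t =
      fderiv ℝ (fun p => g (c p) (DY p) (DX p)) p t
        - fderiv ℝ (fun p => g (c p) (DDY p) (X p)) p t := by
    have : boundaryL g Γ c t s = fun p => g (c p) (DY p) (DX p) - g (c p) (DDY p) (X p) := rfl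
    rw [this, fderiv_fun_sub (hd (hm (hD hY) (hD hX))) (hd (hm (hD (hD hY)) hX)), sub_apply]
  have e3 : eulerL Γ G c t p = vcov Γ c t DDY p + curvL Γ (c p) (DY p) (Y p) (Y p) + G (c p) := rfl
  rw [e1, e2, e3, h.fderiv_metric' hc (hD hY) (hD hY) s hp, h.fderiv_metric' hc (hD hY) (hD hX) t hp,
    h.fderiv_metric' hc (hD (hD hY)) hX t hp, a1]
  simp only [map_add, add_apply]
  have q1 := h.metric_symm _ hcU (DY p) (vcov Γ c t DX p)
  have q2 := h.metric_symm _ hcU (DY p) (curvL Γ (c p) (X p) (Y p) (Y p))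
  -- Moving the curvature from the variation field into the Euler-Lagrange expression: ⟨R(X,Y)Y, DY⟩
  -- = ⟨R(Y,DY)X, Y⟩ = −⟨R(Y,DY)Y, X⟩ = ⟨R(DY,Y)Y, X⟩.
  have q3 := h.metric_curv_pair hcU (X p) (Y p) (Y p) (DY p)
  have q4 := h.metric_curv_skew hcU (Y p) (DY p) (X p) (Y p)
  have q5 : g (c p) (curvL Γ (c p) (Y p) (DY p) (Y p)) (X p)
      = - g (c p) (curvL Γ (c p) (DY p) (Y p) (Y p)) (X p) := by
    rw [curv_skew, map_neg, neg_apply]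
  linarith

/-- Second variation formula, in the two directions `s` and `r`. -/
theorem fderiv_fderiv_lagrangian [FiniteDimensional ℝ E] (h : IsLeviCivitaOn g Γ U)
    (hc : IsSmoothInto c O U) {V : E → ℝ} (hV : ContDiffOn ℝ ∞ V U) {G : E → E}
    (hG : ContDiffOn ℝ ∞ G U) (hVG : ∀ y ∈ U, ∀ w, g y (G y) w = fderiv ℝ V y w) (t s r : P)
    {p : P} (hp : p ∈ O) :
    fderiv ℝ (fun p => fderiv ℝ (lagrangian g Γ V c t) p s) p r =
      g (c p) (jacobiL Γ G c t (fun p => fderiv ℝ c p r) p) (fderiv ℝ c p s)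
        + g (c p) (eulerL Γ G c t p) (vcov Γ c r (fun p => fderiv ℝ c p s) p)
        + fderiv ℝ (fun p => fderiv ℝ (boundaryL g Γ c t s) p r) p t := by
  have hd := fun {W : P → ℝ} (hW : ContDiffOn ℝ ∞ W O) =>
    ContDiffOn.differentiableAt_of_isOpen hW hc.isOpen hp
  have hE := h.contDiffOn_eulerL hc hG t
  have hX := contDiffOn_partial hc s
  have hB := h.contDiffOn_boundaryL hc t s
  have e := fun q hq => h.fderiv_lagrangian hc hV hVG t s (p := q) hq
  rw [fderiv_congr_of_isOpen hc.isOpen e hp, fderiv_fun_add (hd (h.contDiffOn_metric hc hE hX))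
    (hd (contDiffOn_fderiv_apply hc.isOpen le_rfl hB t)), add_apply,
    h.fderiv_metric' hc hE hX r hp, h.vcov_eulerL hc hG t r hp,
    fderiv_fderiv_comm hc.isOpen hB r t hp]

end IsLeviCivitaOn

end VariationFormulas

/-! ### Naturality of covariant derivatives, gradient and curvature under local isometries. -/

section Transition

variable {E E' P : Type*} [NormedAddCommGroup E] [NormedSpace ℝ E]
  [NormedAddCommGroup E'] [NormedSpace ℝ E']
  [NormedAddCommGroup P] [NormedSpace ℝ P]
  {g : E → E →L[ℝ] E →L[ℝ] ℝ} {Γ : E → E →L[ℝ] E →L[ℝ] E} {U : Set E}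
  {g' : E' → E' →L[ℝ] E' →L[ℝ] ℝ} {Γ' : E' → E' →L[ℝ] E' →L[ℝ] E'} {U' : Set E'}
  {ψ : E → E'}

/-- A smooth local isometry `ψ` from `U` to `U'`. -/
structure IsIsometryOn (g : E → E →L[ℝ] E →L[ℝ] ℝ) (U : Set E)
    (g' : E' → E' →L[ℝ] E' →L[ℝ] ℝ) (U' : Set E') (ψ : E → E') : Prop where
  smooth : ContDiffOn ℝ ∞ ψ U
  mapsTo : MapsTo ψ U U'
  surjective : ∀ y ∈ U, Function.Surjective (fderiv ℝ ψ y)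
  metric : ∀ y ∈ U, ∀ u v, g y u v = g' (ψ y) (fderiv ℝ ψ y u) (fderiv ℝ ψ y v)

namespace IsIsometryOn

theorem isSmoothInto (hψ : IsIsometryOn g U g' U' ψ) (hU : IsOpen U) : IsSmoothInto ψ U U' :=
  ⟨hU, hψ.smooth, hψ.mapsTo⟩

/-- Transformation law of the Christoffel map. -/
theorem fderiv_christoffel (hψ : IsIsometryOn g U g' U' ψ) (h : IsLeviCivitaOn g Γ U)
    (h' : IsLeviCivitaOn g' Γ' U') {y : E} (hy : y ∈ U) (u v : E) :
    fderiv ℝ ψ y (Γ y u v) = vcov Γ' ψ u (fun z => fderiv ℝ ψ z v) y := by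
  have hs := hψ.isSmoothInto h.isOpen
  have hid : IsSmoothInto (id : E → E) U U := ⟨h.isOpen, contDiff_id.contDiffOn, mapsTo_id U⟩
  have hc : ∀ a : E, ContDiffOn ℝ ∞ (fun _ : E => a) U := fun a => contDiffOn_const
  -- Uniqueness of the Levi-Civita connection. The defect T is symmetric in its two arguments by
  -- absence of torsion, and ⟨T(w,u), dψ v⟩ is skew in u and v by compatibility. A trilinear form
  -- that is symmetric in the first two slots and skew in the last two is zero.
  set T : E → E → E' := fun u v =>
    fderiv ℝ ψ y (Γ y u v) - vcov Γ' ψ u (fun z => fderiv ℝ ψ z v) y with hT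
  have hTsymm : ∀ u v, T u v = T v u := by
    intro u v
    simp only [hT]
    rw [h.symm y hy u v, h'.vcov_partial hs u v hy]
  have hskew : ∀ w u v, g' (ψ y) (T w u) (fderiv ℝ ψ y v)
      + g' (ψ y) (fderiv ℝ ψ y u) (T w v) = 0 := by
    intro w u v
    have e1 := h.fderiv_metric' hid (hc u) (hc v) w hy
    have e2 := h'.fderiv_metric' hs (IsLeviCivitaOn.contDiffOn_partial hs u) (IsLeviCivitaOn.contDiffOn_partial hs v) w hy
    have e3 : EqOn (fun p => g (id p) u v)
      (fun p => g' (ψ p) (fderiv ℝ ψ p u) (fderiv ℝ ψ p v)) U := fun p hp => hψ.metric p hp u v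
    rw [fderiv_congr_of_isOpen h.isOpen e3 hy, e2] at e1
    simp only [vcov_apply _ id, fderiv_fun_const, Pi.zero_apply, zero_apply, fderiv_id, id_apply,
      id_eq, zero_add, hψ.metric y hy] at e1
    simp only [hT, map_sub, sub_apply]
    linarith
  have hzero : ∀ w u v, g' (ψ y) (T w u) (fderiv ℝ ψ y v) = 0 := by
    intro w u v
    have hsk : ∀ w u v, g' (ψ y) (T w u) (fderiv ℝ ψ y v)
        = - g' (ψ y) (T w v) (fderiv ℝ ψ y u) := by
      intro w u v
      linarith [hskew w u v, h'.metric_symm _ (hψ.mapsTo hy) (fderiv ℝ ψ y u) (T w v)]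
    have s1 := hsk w u v
    have s2 := hsk v w u
    have s3 := hsk u v w
    rw [hTsymm v w] at s2
    rw [hTsymm u v, hTsymm u w] at s3
    linarith
  have : T u v = 0 := by
    refine h'.nondeg _ (hψ.mapsTo hy) _ fun z => ?_
    obtain ⟨w, rfl⟩ := hψ.surjective y hy z
    exact hzero u v w
  exact sub_eq_zero.1 this

theorem fderiv_christoffel_apply (hψ : IsIsometryOn g U g' U' ψ) (h : IsLeviCivitaOn g Γ U)
    (h' : IsLeviCivitaOn g' Γ' U') {y : E} (hy : y ∈ U) (u v : E) :
    fderiv ℝ ψ y (Γ y u v) = fderiv ℝ (fderiv ℝ ψ) y u v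
      + Γ' (ψ y) (fderiv ℝ ψ y u) (fderiv ℝ ψ y v) := by
  have hd : DifferentiableAt ℝ (fderiv ℝ ψ) y :=
    ContDiffOn.differentiableAt_of_isOpen (hψ.smooth.fderiv_of_isOpen (m := ∞) h.isOpen le_rfl)
      h.isOpen hy
  rw [hψ.fderiv_christoffel h h' hy, vcov_apply, fderiv_clm_apply hd (by fun_prop)]
  simp

/-- Covariant derivatives are invariant under isometries. -/
theorem fderiv_vcov (hψ : IsIsometryOn g U g' U' ψ) (h : IsLeviCivitaOn g Γ U)
    (h' : IsLeviCivitaOn g' Γ' U') {c : P → E} {W : P → E} {e p : P} (hcU : c p ∈ U)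
    (hc : DifferentiableAt ℝ c p) (hW : DifferentiableAt ℝ W p) :
    fderiv ℝ ψ (c p) (vcov Γ c e W p) =
      vcov Γ' (fun p => ψ (c p)) e (fun p => fderiv ℝ ψ (c p) (W p)) p := by
  have hd : DifferentiableAt ℝ (fderiv ℝ ψ) (c p) :=
    ContDiffOn.differentiableAt_of_isOpen (hψ.smooth.fderiv_of_isOpen (m := ∞) h.isOpen le_rfl)
      h.isOpen hcU
  have hψd := ContDiffOn.differentiableAt_of_isOpen hψ.smooth h.isOpen hcU
  have e1 : fderiv ℝ (fun p => fderiv ℝ ψ (c p)) p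
      = (fderiv ℝ (fderiv ℝ ψ) (c p)).comp (fderiv ℝ c p) := fderiv_comp p hd hc
  have e2 : fderiv ℝ (fun p => ψ (c p)) p = (fderiv ℝ ψ (c p)).comp (fderiv ℝ c p) :=
    fderiv_comp p hψd hc
  have hdc : DifferentiableAt ℝ (fun p => fderiv ℝ ψ (c p)) p := hd.comp p hc
  rw [vcov_apply, vcov_apply, map_add, hψ.fderiv_christoffel_apply h h' hcU, e2,
    fderiv_clm_apply hdc hW, e1]
  simp only [add_apply, comp_apply, flip_apply]
  abel

/-- A gradient is determined by its pairings with all vectors. As the differential of ψ is onto and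
preserves the metric, the claim reduces to the chain rule for V = V' ∘ ψ. -/
theorem fderiv_grad (hψ : IsIsometryOn g U g' U' ψ) (h : IsLeviCivitaOn g Γ U)
    (h' : IsLeviCivitaOn g' Γ' U') {V : E → ℝ} {V' : E' → ℝ} {G : E → E} {G' : E' → E'}
    (hV' : ContDiffOn ℝ ∞ V' U') (hVV' : EqOn V (fun y => V' (ψ y)) U)
    (hVG : ∀ y ∈ U, ∀ w, g y (G y) w = fderiv ℝ V y w)
    (hVG' : ∀ y ∈ U', ∀ w, g' y (G' y) w = fderiv ℝ V' y w) {y : E} (hy : y ∈ U) :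
    fderiv ℝ ψ y (G y) = G' (ψ y) := by
  have hψd := ContDiffOn.differentiableAt_of_isOpen hψ.smooth h.isOpen hy
  have hVd := ContDiffOn.differentiableAt_of_isOpen hV' h'.isOpen (hψ.mapsTo hy)
  refine sub_eq_zero.1 (h'.nondeg _ (hψ.mapsTo hy) _ fun z => ?_)
  obtain ⟨w, rfl⟩ := hψ.surjective y hy z
  have e1 : fderiv ℝ (fun y => V' (ψ y)) y = (fderiv ℝ V' (ψ y)).comp (fderiv ℝ ψ y) :=
    fderiv_comp y hVd hψd
  rw [map_sub, sub_apply, ← hψ.metric y hy, hVG y hy, hVG' _ (hψ.mapsTo hy),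
    fderiv_congr_of_isOpen h.isOpen hVV' hy, e1, comp_apply, sub_self]

theorem fderiv_nablaVec (hψ : IsIsometryOn g U g' U' ψ) (h : IsLeviCivitaOn g Γ U)
    (h' : IsLeviCivitaOn g' Γ' U') {G : E → E} {G' : E' → E'} (hG : ContDiffOn ℝ ∞ G U)
    (hG' : ContDiffOn ℝ ∞ G' U') (hGG' : ∀ y ∈ U, fderiv ℝ ψ y (G y) = G' (ψ y))
    {y : E} (hy : y ∈ U) (u : E) :
    fderiv ℝ ψ y (nablaVec Γ G y u) = nablaVec Γ' G' (ψ y) (fderiv ℝ ψ y u) := by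
  have k := hψ.fderiv_vcov (c := id) (W := G) (e := u) h h' hy differentiableAt_id
    (ContDiffOn.differentiableAt_of_isOpen hG h.isOpen hy)
  have e1 : EqOn (fun p => fderiv ℝ ψ p (G p)) (fun p => G' (ψ p)) U := hGG'
  simp only [id_eq] at k
  rw [vcov_congr (Γ := Γ') (c := ψ) h.isOpen e1 u hy, vcov, vcov,
    cov_comp (ContDiffOn.differentiableAt_of_isOpen hG' h'.isOpen (hψ.mapsTo hy))
    (ContDiffOn.differentiableAt_of_isOpen hψ.smooth h.isOpen hy)] at k
  simpa [nablaVec, nabla_apply, cov] using k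

/-- The curvature is the commutator of covariant derivatives (`vcov_vcov`) and these are natural
under ψ. No transformation of derivatives of Christoffel symbols is needed. -/
theorem fderiv_curvL (hψ : IsIsometryOn g U g' U' ψ) (h : IsLeviCivitaOn g Γ U)
    (h' : IsLeviCivitaOn g' Γ' U') {y : E} (hy : y ∈ U) (u v w : E) :
    fderiv ℝ ψ y (curvL Γ y u v w) =
      curvL Γ' (ψ y) (fderiv ℝ ψ y u) (fderiv ℝ ψ y v) (fderiv ℝ ψ y w) := by
  have hs := hψ.isSmoothInto h.isOpen
  have hid : IsSmoothInto (id : E → E) U U := ⟨h.isOpen, contDiff_id.contDiffOn, mapsTo_id U⟩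
  have hc : ∀ a : E, ContDiffOn ℝ ∞ (fun _ : E => a) U := fun a => contDiffOn_const
  have key : ∀ a b : E, fderiv ℝ ψ y (vcov Γ id a (vcov Γ id b fun _ => w) y) =
      vcov Γ' ψ a (vcov Γ' ψ b fun p => fderiv ℝ ψ p w) y := by
    intro a b
    have hdb := h.contDiffOn_vcov hid (hc w) b
    have e1 : EqOn (fun p => fderiv ℝ ψ p (vcov Γ id b (fun _ => w) p))
        (vcov Γ' ψ b fun p => fderiv ℝ ψ p w) U := fun p hp =>
      hψ.fderiv_vcov (c := id) (W := fun _ => w) h h' hp differentiableAt_id (by fun_prop)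
    rw [← vcov_congr (Γ := Γ') (c := ψ) h.isOpen e1 a hy]
    exact hψ.fderiv_vcov (c := id) h h' hy differentiableAt_id
      (ContDiffOn.differentiableAt_of_isOpen hdb h.isOpen hy)
  have k1 := vcov_vcov hid.isOpen h.isOpen h.smooth hid.smooth hid.mapsTo (hc w) u v hy
  have k2 := vcov_vcov hs.isOpen h'.isOpen h'.smooth hs.smooth hs.mapsTo
    (IsLeviCivitaOn.contDiffOn_partial hs w) u v hy
  have k3 := congrArg (fderiv ℝ ψ y) k1
  rw [map_add, key, key, k2] at k3
  simpa using (add_left_cancel k3).symm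

variable [FiniteDimensional ℝ E] [FiniteDimensional ℝ E']

/-- Compare the Leibniz rule for R on constant fields u, v, w with the Leibniz rule along ψ for
their images under the differential of ψ. All terms except the one with ∇R correspond by naturality
of R and of covariant derivatives. -/
theorem fderiv_nablaCurvL (hψ : IsIsometryOn g U g' U' ψ) (h : IsLeviCivitaOn g Γ U)
    (h' : IsLeviCivitaOn g' Γ' U') {y : E} (hy : y ∈ U) (a u v w : E) :
    fderiv ℝ ψ y (nablaCurvL Γ y a u v w) = nablaCurvL Γ' (ψ y) (fderiv ℝ ψ y a)
      (fderiv ℝ ψ y u) (fderiv ℝ ψ y v) (fderiv ℝ ψ y w) := by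
  have hs := hψ.isSmoothInto h.isOpen
  have hid : IsSmoothInto (id : E → E) U U := ⟨h.isOpen, contDiff_id.contDiffOn, mapsTo_id U⟩
  have hc : ∀ a : E, ContDiffOn ℝ ∞ (fun _ : E => a) U := fun a => contDiffOn_const
  have hp := fun z => IsLeviCivitaOn.contDiffOn_partial hs z
  have hv : ∀ z, fderiv ℝ ψ y (vcov Γ id a (fun _ => z) y)
      = vcov Γ' ψ a (fun p => fderiv ℝ ψ p z) y := fun z =>
    hψ.fderiv_vcov (c := id) (W := fun _ => z) h h' hy differentiableAt_id (by fun_prop)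
  have k1 := h.vcov_curvL hid (hc u) (hc v) (hc w) a hy
  have k2 := h'.vcov_curvL hs (hp u) (hp v) (hp w) a hy
  have k3 := congrArg (fderiv ℝ ψ y) k1
  have e1 : EqOn (fun p => fderiv ℝ ψ p (curvL Γ p u v w)) (fun p => curvL Γ' (ψ p)
      (fderiv ℝ ψ p u) (fderiv ℝ ψ p v) (fderiv ℝ ψ p w)) U := fun p hp =>
    hψ.fderiv_curvL h h' hp u v w
  have k4 := hψ.fderiv_vcov (c := id) (e := a) h h' hy differentiableAt_id
    (ContDiffOn.differentiableAt_of_isOpen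
      (h.contDiffOn_curvL_apply hid (hc u) (hc v) (hc w)) h.isOpen hy)
  simp only [id_eq] at k1 k3 k4
  rw [k4, vcov_congr (Γ := Γ') (c := ψ) h.isOpen e1 a hy, k2] at k3
  simp only [map_add, hψ.fderiv_curvL h h' hy, hv, fderiv_id, id_apply] at k3
  simpa using k3.symm

theorem fderiv_nabla2CurvL (hψ : IsIsometryOn g U g' U' ψ) (h : IsLeviCivitaOn g Γ U)
    (h' : IsLeviCivitaOn g' Γ' U') {y : E} (hy : y ∈ U) (b a u v w : E) :
    fderiv ℝ ψ y (nabla2CurvL Γ y b a u v w) = nabla2CurvL Γ' (ψ y) (fderiv ℝ ψ y b)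
      (fderiv ℝ ψ y a) (fderiv ℝ ψ y u) (fderiv ℝ ψ y v) (fderiv ℝ ψ y w) := by
  have hs := hψ.isSmoothInto h.isOpen
  have hid : IsSmoothInto (id : E → E) U U := ⟨h.isOpen, contDiff_id.contDiffOn, mapsTo_id U⟩
  have hc : ∀ a : E, ContDiffOn ℝ ∞ (fun _ : E => a) U := fun a => contDiffOn_const
  have hp := fun z => IsLeviCivitaOn.contDiffOn_partial hs z
  have hv : ∀ z, fderiv ℝ ψ y (vcov Γ id b (fun _ => z) y)
      = vcov Γ' ψ b (fun p => fderiv ℝ ψ p z) y := fun z =>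
    hψ.fderiv_vcov (c := id) (W := fun _ => z) h h' hy differentiableAt_id (by fun_prop)
  have k1 := h.vcov_nablaCurvL hid (hc a) (hc u) (hc v) (hc w) b hy
  have k2 := h'.vcov_nablaCurvL hs (hp a) (hp u) (hp v) (hp w) b hy
  have k3 := congrArg (fderiv ℝ ψ y) k1
  have e1 : EqOn (fun p => fderiv ℝ ψ p (nablaCurvL Γ p a u v w)) (fun p => nablaCurvL Γ' (ψ p)
      (fderiv ℝ ψ p a) (fderiv ℝ ψ p u) (fderiv ℝ ψ p v) (fderiv ℝ ψ p w)) U := fun p hp =>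
    hψ.fderiv_nablaCurvL h h' hp a u v w
  have k4 := hψ.fderiv_vcov (c := id) (e := b) h h' hy differentiableAt_id
    (ContDiffOn.differentiableAt_of_isOpen
      (h.contDiffOn_nablaCurvL_apply hid (hc a) (hc u) (hc v) (hc w)) h.isOpen hy)
  simp only [id_eq] at k1 k3 k4
  rw [k4, vcov_congr (Γ := Γ') (c := ψ) h.isOpen e1 b hy, k2] at k3
  simp only [map_add, hψ.fderiv_nablaCurvL h h' hy, hv, fderiv_id, id_apply] at k3
  simpa using k3.symm

end IsIsometryOn

end Transition

/-! ### Tangent vectors in charts -/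

section ChartRepresentation

variable {n : ℕ} {Q : Type*} [TopologicalSpace Q] [ChartedSpace (EuclideanSpace ℝ (Fin n)) Q]

local notation "𝔼" => EuclideanSpace ℝ (Fin n)

/-- The transition map between the charts at `x` and `x'`. -/
def transition (x x' : Q) : 𝔼 → 𝔼 := extChartAt (𝓡 n) x' ∘ (extChartAt (𝓡 n) x).symm

/-- The domain of the transition map. -/
def transitionSource (x x' : Q) : Set 𝔼 :=
  (extChartAt (𝓡 n) x).target ∩ (extChartAt (𝓡 n) x).symm ⁻¹' (extChartAt (𝓡 n) x').source

theorem isOpen_transitionSource (x x' : Q) : IsOpen (transitionSource (n := n) x x') :=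
  (continuousOn_extChartAt_symm x).isOpen_inter_preimage (isOpen_extChartAt_target x)
    (isOpen_extChartAt_source x')

theorem mem_transitionSource {x x' p : Q} (h : p ∈ (extChartAt (𝓡 n) x).source)
    (h' : p ∈ (extChartAt (𝓡 n) x').source) :
    extChartAt (𝓡 n) x p ∈ transitionSource x x' :=
  ⟨(extChartAt (𝓡 n) x).map_source h, by
    rw [mem_preimage, (extChartAt (𝓡 n) x).left_inv h]; exact h'⟩

theorem transition_apply {x x' p : Q} (h : p ∈ (extChartAt (𝓡 n) x).source) :
    transition x x' (extChartAt (𝓡 n) x p) = extChartAt (𝓡 n) x' p := by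
  rw [transition, Function.comp_apply, (extChartAt (𝓡 n) x).left_inv h]

variable [IsManifold (𝓡 n) ∞ Q]

/-- The coordinates in the chart at `x` of tangent vectors at `p`. -/
def rep (x p : Q) : 𝔼 →L[ℝ] 𝔼 := tangentCoordChange (𝓡 n) p x p

theorem rep_self (p : Q) (v : 𝔼) : rep p p v = v :=
  tangentCoordChange_self (mem_extChartAt_source p)

theorem fderiv_transition {x x' p : Q} (h : p ∈ (extChartAt (𝓡 n) x).source)
    (h' : p ∈ (extChartAt (𝓡 n) x').source) :
    fderiv ℝ (transition x x') (extChartAt (𝓡 n) x p) = tangentCoordChange (𝓡 n) x x' p := by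
  have := hasFDerivWithinAt_tangentCoordChange (I := 𝓡 n) ⟨h, h'⟩
  simp only [modelWithCornersSelf_coe, range_id, hasFDerivWithinAt_univ] at this
  exact this.fderiv

theorem fderiv_transition_rep {x x' p : Q} (h : p ∈ (extChartAt (𝓡 n) x).source)
    (h' : p ∈ (extChartAt (𝓡 n) x').source) (v : 𝔼) :
    fderiv ℝ (transition x x') (extChartAt (𝓡 n) x p) (rep x p v) = rep x' p v := by
  rw [fderiv_transition h h', rep, rep]
  exact tangentCoordChange_comp ⟨⟨mem_extChartAt_source p, h⟩, h'⟩

theorem fderiv_transition_self {x p : Q} (h : p ∈ (extChartAt (𝓡 n) x).source) :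
    fderiv ℝ (transition p x) (extChartAt (𝓡 n) p p) = rep x p :=
  fderiv_transition (mem_extChartAt_source p) h

/-- The tangent vector at `p` with given coordinates in the chart at `x`. -/
def unrep (x p : Q) : 𝔼 →L[ℝ] 𝔼 := tangentCoordChange (𝓡 n) x p p

theorem unrep_rep {x p : Q} (h : p ∈ (extChartAt (𝓡 n) x).source) (v : 𝔼) :
    unrep x p (rep x p v) = v := by
  rw [unrep, rep, tangentCoordChange_comp ⟨⟨mem_extChartAt_source p, h⟩, mem_extChartAt_source p⟩,
    tangentCoordChange_self (mem_extChartAt_source p)]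

theorem rep_unrep {x p : Q} (h : p ∈ (extChartAt (𝓡 n) x).source) (v : 𝔼) :
    rep x p (unrep x p v) = v := by
  rw [unrep, rep, tangentCoordChange_comp ⟨⟨h, mem_extChartAt_source p⟩, h⟩,
    tangentCoordChange_self h]

theorem rep_injective {x p : Q} (h : p ∈ (extChartAt (𝓡 n) x).source) :
    Function.Injective (rep (n := n) x p) :=
  Function.LeftInverse.injective (unrep_rep h)

theorem contDiffOn_transition (x x' : Q) :
    ContDiffOn ℝ ∞ (transition x x') (transitionSource (n := n) x x') := by
  have h1 : ContMDiffOn 𝓘(ℝ, 𝔼) (𝓡 n) ∞ (extChartAt (𝓡 n) x).symm (extChartAt (𝓡 n) x).target :=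
    contMDiffOn_extChartAt_symm x
  have h2 : ContMDiffOn (𝓡 n) 𝓘(ℝ, 𝔼) ∞ (extChartAt (𝓡 n) x') (chartAt 𝔼 x').source :=
    contMDiffOn_extChartAt
  refine contMDiffOn_iff_contDiffOn.1 (h2.comp (h1.mono inter_subset_left) fun y hy => ?_)
  simpa using hy.2

variable [RiemannianBundle (fun x : Q => TangentSpace (𝓡 n) x)]

/-- The inner product of two tangent vectors at `p`. -/
def metricAt (p : Q) (u v : TangentSpace (𝓡 n) p) : ℝ := inner ℝ u v

theorem chartMetric_apply {x p : Q} (h : p ∈ (extChartAt (𝓡 n) x).source) (u v : 𝔼) :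
    chartMetric x (extChartAt (𝓡 n) x p) u v = metricAt p (unrep x p u) (unrep x p v) := by
  have h1 : (extChartAt (𝓡 n) x).symm (extChartAt (𝓡 n) x p) = p :=
    (extChartAt (𝓡 n) x).left_inv h
  have h2 : p ∈ (chartAt 𝔼 x).source := by simpa using h
  -- The inner product lives on the fibre over φ⁻¹(φ(p)), which is only provably equal to p. The
  -- base point is made a variable so that the equality can be substituted.
  have key : ∀ p' : Q, p' = p → ∀ u v : 𝔼,
      metricAt p' ((trivializationAt 𝔼 (TangentSpace (𝓡 n)) x).symmL ℝ p' u)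
        ((trivializationAt 𝔼 (TangentSpace (𝓡 n)) x).symmL ℝ p' v)
      = metricAt p (unrep x p u) (unrep x p v) := by
    rintro p' rfl u v
    rw [TangentBundle.symmL_trivializationAt_eq_core h2]
    rfl
  exact key _ h1 u v

theorem chartMetric_rep {x p : Q} (h : p ∈ (extChartAt (𝓡 n) x).source)
    (u v : TangentSpace (𝓡 n) p) :
    chartMetric x (extChartAt (𝓡 n) x p) (rep x p u) (rep x p v) = metricAt p u v :=
  (chartMetric_apply h _ _).trans (congrArg₂ (metricAt p) (unrep_rep h u) (unrep_rep h v))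

/-- The coordinate fields of the chart are constant in its trivialization, hence smooth sections of
the tangent bundle. Their inner products, the entries of the metric, are smooth because the
Riemannian structure is. -/
theorem contDiffOn_chartMetric [IsContMDiffRiemannianBundle (𝓡 n) ∞ 𝔼
    (fun x : Q => TangentSpace (𝓡 n) x)] (x : Q) :
    ContDiffOn ℝ ∞ (chartMetric (n := n) x) (extChartAt (𝓡 n) x).target := by
  have hs : ∀ u : 𝔼, ContMDiffOn 𝓘(ℝ, 𝔼) (𝓡 n).tangent ∞ (fun y : 𝔼 =>
      (⟨(extChartAt (𝓡 n) x).symm y, (trivializationAt 𝔼 (TangentSpace (𝓡 n)) x).symmL ℝ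
        ((extChartAt (𝓡 n) x).symm y) u⟩ : TangentBundle (𝓡 n) Q)) (extChartAt (𝓡 n) x).target := by
    intro u
    have h1 : ContMDiffOn 𝓘(ℝ, 𝔼) (𝓡 n) ∞ (extChartAt (𝓡 n) x).symm
      (extChartAt (𝓡 n) x).target := contMDiffOn_extChartAt_symm x
    have hm : ∀ y ∈ (extChartAt (𝓡 n) x).target,
        (extChartAt (𝓡 n) x).symm y ∈ (trivializationAt 𝔼 (TangentSpace (𝓡 n)) x).baseSet := by
      intro y hy
      have := (extChartAt (𝓡 n) x).map_target hy
      simpa using this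
    refine ((Trivialization.contMDiffOn_iff (e := trivializationAt 𝔼 (TangentSpace (𝓡 n)) x)
      fun y hy => ?_).2 ⟨h1, ?_⟩)
    · exact (Trivialization.mem_source _).2 (hm y hy)
    · refine (contMDiffOn_const (c := u)).congr fun y hy => ?_
      have := (trivializationAt 𝔼 (TangentSpace (𝓡 n)) x).continuousLinearMapAt_symmL (R := ℝ)
        (hm y hy) u
      rwa [Trivialization.continuousLinearMapAt_apply,
        Trivialization.coe_linearMapAt_of_mem _ (hm y hy)] at this
  refine contDiffOn_clm_apply.2 fun u => contDiffOn_clm_apply.2 fun v => ?_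
  exact contMDiffOn_iff_contDiffOn.1 (ContMDiffOn.inner_bundle (hs u) (hs v))

end ChartRepresentation

/-! ### The Koszul formula and the existence of the Levi-Civita connection. -/

section KoszulConnection

variable {E : Type*} [NormedAddCommGroup E] [NormedSpace ℝ E]

/-- Half the sum in the Koszul formula. -/
def koszulL (dg : E →L[ℝ] E →L[ℝ] E →L[ℝ] ℝ) : E →L[ℝ] E →L[ℝ] E →L[ℝ] ℝ :=
  (1 / 2 : ℝ) • (dg + dg.flip - ((flipₗᵢ ℝ E E ℝ).toContinuousLinearEquiv :
    (E →L[ℝ] E →L[ℝ] ℝ) →L[ℝ] (E →L[ℝ] E →L[ℝ] ℝ)).comp dg.flip)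

theorem koszulL_apply (dg : E →L[ℝ] E →L[ℝ] E →L[ℝ] ℝ) (u v w : E) :
    koszulL dg u v w = (1 / 2) * (dg u v w + dg v u w - dg w u v) := rfl

/-- The Christoffel map of the metric `g`. -/
def leviCivitaL (g : E → E →L[ℝ] E →L[ℝ] ℝ) (y : E) : E →L[ℝ] E →L[ℝ] E :=
  (compL ℝ E (E →L[ℝ] ℝ) E (g y).inverse).comp (koszulL (fderiv ℝ g y))

theorem leviCivitaL_apply (g : E → E →L[ℝ] E →L[ℝ] ℝ) (y u v : E) :
    leviCivitaL g y u v = (g y).inverse (koszulL (fderiv ℝ g y) u v) := rfl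

variable [FiniteDimensional ℝ E] {g : E → E →L[ℝ] E →L[ℝ] ℝ} {U : Set E}

theorem exists_equiv_of_nondeg {b : E →L[ℝ] E →L[ℝ] ℝ} (hb : ∀ u, (∀ v, b u v = 0) → u = 0) :
    ∃ e : E ≃L[ℝ] (E →L[ℝ] ℝ), (e : E →L[ℝ] (E →L[ℝ] ℝ)) = b := by
  have hfin : Module.finrank ℝ E = Module.finrank ℝ (E →L[ℝ] ℝ) := by
    rw [← (LinearMap.toContinuousLinearMap : (E →ₗ[ℝ] ℝ) ≃ₗ[ℝ] E →L[ℝ] ℝ).finrank_eq]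
    exact (Subspace.dual_finrank_eq (K := ℝ) (V := E)).symm
  have hinj : Function.Injective (b : E →ₗ[ℝ] (E →L[ℝ] ℝ)) := by
    refine (injective_iff_map_eq_zero _).2 fun u hu => hb u fun v => ?_
    exact DFunLike.congr_fun hu v
  refine ⟨(LinearMap.linearEquivOfInjective _ hinj hfin).toContinuousLinearEquiv, ?_⟩
  ext u v
  rfl

theorem inverse_nondeg_apply {b : E →L[ℝ] E →L[ℝ] ℝ} (hb : ∀ u, (∀ v, b u v = 0) → u = 0)
    (f : E →L[ℝ] ℝ) (w : E) : b (b.inverse f) w = f w := by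
  obtain ⟨e, rfl⟩ := exists_equiv_of_nondeg hb
  rw [ContinuousLinearMap.inverse_equiv]
  simp

/-- Nondegeneracy makes g y invertible by a dimension count, and inversion is smooth at invertible
maps. -/
theorem contDiffOn_inverse_apply (hg : ContDiffOn ℝ ∞ g U)
    (hn : ∀ y ∈ U, ∀ u, (∀ v, g y u v = 0) → u = 0) {f : E → E →L[ℝ] ℝ}
    (hf : ContDiffOn ℝ ∞ f U) : ContDiffOn ℝ ∞ (fun y => (g y).inverse (f y)) U := by
  have hinv : ContDiffOn ℝ ∞ (fun y => (g y).inverse) U := by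
    intro y hy
    obtain ⟨e, he⟩ := exists_equiv_of_nondeg (hn y hy)
    have h1 : ContDiffAt ℝ ∞ (ContinuousLinearMap.inverse : (E →L[ℝ] (E →L[ℝ] ℝ)) → _)
        (g y) := by
      rw [← he]
      exact contDiffAt_map_inverse e
    exact h1.comp_contDiffWithinAt y (hg y hy)
  exact hinv.clm_apply hf

/-- The fundamental theorem of Riemannian geometry, in coordinates. -/
theorem isLeviCivitaOn_leviCivitaL (hU : IsOpen U) (hg : ContDiffOn ℝ ∞ g U)
    (hs : ∀ y ∈ U, ∀ u v, g y u v = g y v u)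
    (hn : ∀ y ∈ U, ∀ u, (∀ v, g y u v = 0) → u = 0) : IsLeviCivitaOn g (leviCivitaL g) U := by
  have hdg : ContDiffOn ℝ ∞ (fderiv ℝ g) U := hg.fderiv_of_isOpen (m := ∞) hU le_rfl
  have hdsymm : ∀ y ∈ U, ∀ a u v, fderiv ℝ g y a u v = fderiv ℝ g y a v u := by
    intro y hy a u v
    have hgd := ContDiffOn.differentiableAt_of_isOpen hg hU hy
    have e1 : ∀ u v : E, fderiv ℝ (fun z => g z u v) y a = fderiv ℝ g y a u v := by
      intro u v
      rw [fderiv_clm_apply (hgd.clm_apply (by fun_prop)) (by fun_prop),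
        fderiv_clm_apply hgd (by fun_prop)]
      simp
    rw [← e1, ← e1, fderiv_congr_of_isOpen hU (fun z hz => hs z hz u v) hy]
  have hk : ∀ u v : E, ContDiffOn ℝ ∞ (fun y => koszulL (fderiv ℝ g y) u v) U := by
    intro u v
    refine contDiffOn_clm_apply.2 fun w => ?_
    have h3 : ∀ a b d : E, ContDiffOn ℝ ∞ (fun y => fderiv ℝ g y a b d) U := fun a b d =>
      ((hdg.clm_apply contDiffOn_const).clm_apply contDiffOn_const).clm_apply contDiffOn_const
    exact (contDiffOn_const (c := (1 / 2 : ℝ))).mul (((h3 u v w).add (h3 v u w)).sub (h3 w u v))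
  have hkos : ∀ y ∈ U, ∀ u v w, g y (leviCivitaL g y u v) w =
      (1 / 2) * (fderiv ℝ g y u v w + fderiv ℝ g y v u w - fderiv ℝ g y w u v) := by
    intro y hy u v w
    rw [leviCivitaL_apply, inverse_nondeg_apply (hn y hy), koszulL_apply]
  refine ⟨hU, hg, ?_, hs, ?_, ?_, hn⟩
  · refine contDiffOn_clm_apply.2 fun u => contDiffOn_clm_apply.2 fun v => ?_
    exact contDiffOn_inverse_apply hg hn (hk u v)
  · intro y hy u v
    rw [← sub_eq_zero]
    refine hn y hy _ fun w => ?_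
    rw [map_sub, sub_apply, hkos y hy, hkos y hy, hdsymm y hy w u v]
    ring
  · intro y hy a u v
    rw [hs y hy u, hkos y hy, hkos y hy]
    linarith [hdsymm y hy u v a, hdsymm y hy v u a, hdsymm y hy a u v]

end KoszulConnection

/-! ### The Levi-Civita connection in the charts of Q. -/

section ChartConnection

variable {n : ℕ} {Q : Type*} [TopologicalSpace Q] [ChartedSpace (EuclideanSpace ℝ (Fin n)) Q]

local notation "𝔼" => EuclideanSpace ℝ (Fin n)

variable [IsManifold (𝓡 n) ∞ Q]

theorem contDiffOn_potential {V : Q → ℝ} (hV : ContMDiff (𝓡 n) 𝓘(ℝ, ℝ) ∞ V) (x : Q) :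
    ContDiffOn ℝ ∞ (V ∘ (extChartAt (𝓡 n) x).symm) (extChartAt (𝓡 n) x).target :=
  contMDiffOn_iff_contDiffOn.1 (hV.comp_contMDiffOn (contMDiffOn_extChartAt_symm x))

variable [RiemannianBundle (fun x : Q => TangentSpace (𝓡 n) x)]

theorem metricAt_self_pos {p : Q} {v : TangentSpace (𝓡 n) p} (hv : v ≠ 0) : 0 < metricAt p v v :=
  real_inner_self_pos.2 hv

theorem chartMetric_symm (x : Q) (y u v : 𝔼) : chartMetric x y u v = chartMetric x y v u :=
  real_inner_comm (F := TangentSpace (𝓡 n) ((extChartAt (𝓡 n) x).symm y)) _ _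

theorem chartMetric_pos {x : Q} {y : 𝔼} (hy : y ∈ (extChartAt (𝓡 n) x).target) {u : 𝔼}
    (hu : u ≠ 0) : 0 < chartMetric x y u u := by
  obtain ⟨p, hp, rfl⟩ : ∃ p ∈ (extChartAt (𝓡 n) x).source, extChartAt (𝓡 n) x p = y :=
    ⟨_, (extChartAt (𝓡 n) x).map_target hy, (extChartAt (𝓡 n) x).right_inv hy⟩
  rw [chartMetric_apply hp]
  refine metricAt_self_pos fun h0 => hu ?_
  have : rep x p (unrep x p u) = rep x p 0 := congrArg (rep x p) h0
  rwa [rep_unrep hp, map_zero] at this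

theorem chartMetric_nondeg {x : Q} {y : 𝔼} (hy : y ∈ (extChartAt (𝓡 n) x).target) (u : 𝔼)
    (hu : ∀ v, chartMetric x y u v = 0) : u = 0 := by
  by_contra h
  exact (chartMetric_pos hy h).ne' (hu u)

theorem chartMetric_sharp {x : Q} {y : 𝔼} (hy : y ∈ (extChartAt (𝓡 n) x).target)
    (f : 𝔼 →L[ℝ] ℝ) (w : 𝔼) : chartMetric x y (sharp x y f) w = f w :=
  inverse_nondeg_apply (chartMetric_nondeg hy) f w

theorem contDiffOn_sharp [IsContMDiffRiemannianBundle (𝓡 n) ∞ 𝔼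
    (fun x : Q => TangentSpace (𝓡 n) x)] (x : Q) {f : 𝔼 → 𝔼 →L[ℝ] ℝ}
    (hf : ContDiffOn ℝ ∞ f (extChartAt (𝓡 n) x).target) :
    ContDiffOn ℝ ∞ (fun y => sharp x y (f y)) (extChartAt (𝓡 n) x).target :=
  contDiffOn_inverse_apply (contDiffOn_chartMetric x) (fun _ hy => chartMetric_nondeg hy) hf

/-- The Christoffel map as a field of bilinear maps. -/
def christoffelL (x : Q) (y : 𝔼) : 𝔼 →L[ℝ] 𝔼 →L[ℝ] 𝔼 := leviCivitaL (chartMetric x) y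

theorem christoffelL_apply (x : Q) (y u v : 𝔼) : christoffelL x y u v = christoffel x y u v := rfl

theorem chartMetric_chartGrad (V : Q → ℝ) (x : Q) :
    ∀ y ∈ (extChartAt (𝓡 n) x).target, ∀ w, chartMetric x y (chartGrad V x y) w
      = fderiv ℝ (V ∘ (extChartAt (𝓡 n) x).symm) y w := fun _ hy w =>
  chartMetric_sharp hy _ w

variable [IsContMDiffRiemannianBundle (𝓡 n) ∞ (EuclideanSpace ℝ (Fin n))
    (fun x : Q => TangentSpace (𝓡 n) x)]

theorem isLeviCivitaOn_chart (x : Q) :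
    IsLeviCivitaOn (chartMetric x) (christoffelL x) (extChartAt (𝓡 n) x).target :=
  isLeviCivitaOn_leviCivitaL (isOpen_extChartAt_target x) (contDiffOn_chartMetric x)
    (fun y _ u v => chartMetric_symm x y u v) fun _ hy => chartMetric_nondeg hy

/-- Both chart metrics express the inner product of the same two vectors of a tangent space of Q,
and the derivative of the transition map exchanges the two sets of coordinates of a vector. -/
theorem isIsometryOn_transition (x x' : Q) :
    IsIsometryOn (chartMetric x) (transitionSource x x') (chartMetric x')
      (extChartAt (𝓡 n) x').target (transition x x') := by
  have key : ∀ y ∈ transitionSource (n := n) x x', ∃ p ∈ (extChartAt (𝓡 n) x).source,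
      p ∈ (extChartAt (𝓡 n) x').source ∧ extChartAt (𝓡 n) x p = y := fun y hy =>
    ⟨_, (extChartAt (𝓡 n) x).map_target hy.1, hy.2, (extChartAt (𝓡 n) x).right_inv hy.1⟩
  refine ⟨contDiffOn_transition x x', ?_, ?_, ?_⟩
  · rintro y hy
    exact (extChartAt (𝓡 n) x').map_source hy.2
  · rintro y hy v
    obtain ⟨p, hp, hp', rfl⟩ := key y hy
    refine ⟨rep x p (unrep x' p v), ?_⟩
    rw [fderiv_transition_rep hp hp', rep_unrep hp']
  · rintro y hy u v
    obtain ⟨p, hp, hp', rfl⟩ := key y hy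
    have hu := rep_unrep hp u
    have hv := rep_unrep hp v
    rw [← hu, ← hv, fderiv_transition_rep hp hp', fderiv_transition_rep hp hp', transition_apply hp,
      chartMetric_rep hp (unrep x p u) (unrep x p v), chartMetric_rep hp' (unrep x p u) (unrep x p v)]

theorem isLeviCivitaOn_transitionSource (x x' : Q) :
    IsLeviCivitaOn (chartMetric x) (christoffelL x) (transitionSource (n := n) x x') :=
  (isLeviCivitaOn_chart x).mono (isOpen_transitionSource x x') inter_subset_left

/-! ### The tensors of `Q` in terms of the local calculus -/

theorem chartCurv_eq {x : Q} {y : 𝔼} (hy : y ∈ (extChartAt (𝓡 n) x).target) (u v w : 𝔼) :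
    chartCurv x y u v w = curvL (christoffelL x) y u v w := by
  have hΓ := ContDiffOn.differentiableAt_of_isOpen (isLeviCivitaOn_chart (n := n) x).smooth
    (isOpen_extChartAt_target x) hy
  have e : ∀ a b d : 𝔼, fderiv ℝ (fun z => christoffel x z b d) y a
      = fderiv ℝ (christoffelL x) y a b d := by
    intro a b d
    change fderiv ℝ (fun z => christoffelL x z b d) y a = _
    rw [fderiv_clm_apply (hΓ.clm_apply (by fun_prop)) (by fun_prop),
      fderiv_clm_apply hΓ (by fun_prop)]
    simp
  rw [chartCurv, e, e, curvL_apply]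
  simp only [christoffelL_apply]
  abel

theorem chartNablaCurv_eq {x : Q} {y : 𝔼} (hy : y ∈ (extChartAt (𝓡 n) x).target)
    (a u v w : 𝔼) : chartNablaCurv x y a u v w = nablaCurvL (christoffelL x) y a u v w := by
  have h := isLeviCivitaOn_chart (n := n) x
  have hR := ContDiffOn.differentiableAt_of_isOpen (contDiffOn_curvL h.isOpen h.smooth)
    h.isOpen hy
  have e : fderiv ℝ (fun z => chartCurv x z u v w) y a
      = fderiv ℝ (curvL (christoffelL x)) y a u v w := by
    have e1 : EqOn (fun z => chartCurv x z u v w) (fun z => curvL (christoffelL x) z u v w)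
      (extChartAt (𝓡 n) x).target := fun z hz => chartCurv_eq hz u v w
    have d1 := hR.clm_apply (differentiableAt_const (c := u))
    have d2 := d1.clm_apply (differentiableAt_const (c := v))
    rw [fderiv_congr_of_isOpen h.isOpen e1 hy, fderiv_clm_apply d2 (by fun_prop),
      fderiv_clm_apply d1 (by fun_prop), fderiv_clm_apply hR (by fun_prop)]
    simp
  rw [chartNablaCurv, e, nablaCurvL_apply]
  simp only [chartCurv_eq hy, christoffelL_apply]
  abel

theorem chartNabla2Curv_eq {x : Q} {y : 𝔼} (hy : y ∈ (extChartAt (𝓡 n) x).target)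
    (b a u v w : 𝔼) :
    chartNabla2Curv x y b a u v w = nabla2CurvL (christoffelL x) y b a u v w := by
  have h := isLeviCivitaOn_chart (n := n) x
  have hR := ContDiffOn.differentiableAt_of_isOpen h.contDiffOn_nablaCurvL h.isOpen hy
  have e : fderiv ℝ (fun z => chartNablaCurv x z a u v w) y b
      = fderiv ℝ (nablaCurvL (christoffelL x)) y b a u v w := by
    have e1 : EqOn (fun z => chartNablaCurv x z a u v w)
      (fun z => nablaCurvL (christoffelL x) z a u v w)
      (extChartAt (𝓡 n) x).target := fun z hz => chartNablaCurv_eq hz a u v w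
    have d0 := hR.clm_apply (differentiableAt_const (c := a))
    have d1 := d0.clm_apply (differentiableAt_const (c := u))
    have d2 := d1.clm_apply (differentiableAt_const (c := v))
    rw [fderiv_congr_of_isOpen h.isOpen e1 hy, fderiv_clm_apply d2 (by fun_prop),
      fderiv_clm_apply d1 (by fun_prop), fderiv_clm_apply d0 (by fun_prop),
      fderiv_clm_apply hR (by fun_prop)]
    simp
  rw [chartNabla2Curv, e, nabla2CurvL_apply]
  simp only [chartNablaCurv_eq hy, christoffelL_apply]
  abel

section Potential

variable {V : Q → ℝ}

theorem contDiffOn_chartGrad (hV : ContMDiff (𝓡 n) 𝓘(ℝ, ℝ) ∞ V) (x : Q) :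
    ContDiffOn ℝ ∞ (chartGrad V x) (extChartAt (𝓡 n) x).target :=
  contDiffOn_sharp x ((contDiffOn_potential hV x).fderiv_of_isOpen (m := ∞)
    (isOpen_extChartAt_target x) le_rfl)

theorem fderiv_transition_chartGrad (hV : ContMDiff (𝓡 n) 𝓘(ℝ, ℝ) ∞ V) (x x' : Q) :
    ∀ y ∈ transitionSource (n := n) x x', fderiv ℝ (transition x x') y (chartGrad V x y)
      = chartGrad V x' (transition x x' y) := by
  intro y hy
  refine (isIsometryOn_transition x x').fderiv_grad (isLeviCivitaOn_transitionSource x x')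
    (isLeviCivitaOn_chart x') (contDiffOn_potential hV x') (V := V ∘ (extChartAt (𝓡 n) x).symm)
    (fun z hz => ?_) (fun z hz => chartMetric_chartGrad V x z hz.1) (chartMetric_chartGrad V x') hy
  simp only [transition, Function.comp_apply]
  rw [(extChartAt (𝓡 n) x').left_inv hz.2]

/-- The tensors at p are defined in the chart centred at p, so along a curve the chart changes from
point to point. This and the following `rep_` statements express them in one fixed chart at x, where
they can be differentiated along the curve. -/
theorem rep_grad (hV : ContMDiff (𝓡 n) 𝓘(ℝ, ℝ) ∞ V) {x p : Q}
    (hp : p ∈ (extChartAt (𝓡 n) x).source) :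
    rep x p (grad V p) = chartGrad V x (extChartAt (𝓡 n) x p) := by
  have h := fderiv_transition_chartGrad hV p x _
    (mem_transitionSource (mem_extChartAt_source p) hp)
  rwa [fderiv_transition_self hp, transition_apply (mem_extChartAt_source p)] at h

theorem rep_nablaGrad (hV : ContMDiff (𝓡 n) 𝓘(ℝ, ℝ) ∞ V) {x p : Q}
    (hp : p ∈ (extChartAt (𝓡 n) x).source) (u : 𝔼) :
    rep x p (nablaGrad V p u)
      = nablaVec (christoffelL x) (chartGrad V x) (extChartAt (𝓡 n) x p) (rep x p u) := by
  have h := (isIsometryOn_transition p x).fderiv_nablaVec (isLeviCivitaOn_transitionSource p x)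
    (isLeviCivitaOn_chart x) ((contDiffOn_chartGrad hV p).mono inter_subset_left)
    (contDiffOn_chartGrad hV x) (fderiv_transition_chartGrad hV p x)
    (mem_transitionSource (mem_extChartAt_source p) hp) u
  rwa [fderiv_transition_self hp, transition_apply (mem_extChartAt_source p)] at h

end Potential

theorem rep_curv {x p : Q} (hp : p ∈ (extChartAt (𝓡 n) x).source) (u v w : 𝔼) :
    rep x p (curv p u v w) = curvL (christoffelL x) (extChartAt (𝓡 n) x p) (rep x p u)
      (rep x p v) (rep x p w) := by
  have h := (isIsometryOn_transition p x).fderiv_curvL (isLeviCivitaOn_transitionSource p x)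
    (isLeviCivitaOn_chart x) (mem_transitionSource (mem_extChartAt_source p) hp) u v w
  rw [fderiv_transition_self hp, transition_apply (mem_extChartAt_source p),
    ← chartCurv_eq (mem_extChartAt_target p) u v w] at h
  exact h

theorem rep_nablaCurv {x p : Q} (hp : p ∈ (extChartAt (𝓡 n) x).source)
    (a u v w : 𝔼) :
    rep x p (nablaCurv p a u v w) = nablaCurvL (christoffelL x) (extChartAt (𝓡 n) x p) (rep x p a)
      (rep x p u) (rep x p v) (rep x p w) := by
  have h := (isIsometryOn_transition p x).fderiv_nablaCurvL (isLeviCivitaOn_transitionSource p x)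
    (isLeviCivitaOn_chart x) (mem_transitionSource (mem_extChartAt_source p) hp) a u v w
  rw [fderiv_transition_self hp, transition_apply (mem_extChartAt_source p),
    ← chartNablaCurv_eq (mem_extChartAt_target p) a u v w] at h
  exact h

set_option maxRecDepth 4000 in
theorem rep_nabla2Curv {x p : Q} (hp : p ∈ (extChartAt (𝓡 n) x).source)
    (b a u v w : 𝔼) :
    rep x p (nabla2Curv p b a u v w) = nabla2CurvL (christoffelL x) (extChartAt (𝓡 n) x p)
      (rep x p b) (rep x p a) (rep x p u) (rep x p v) (rep x p w) := by
  have h := (isIsometryOn_transition p x).fderiv_nabla2CurvL (isLeviCivitaOn_transitionSource p x)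
    (isLeviCivitaOn_chart x) (mem_transitionSource (mem_extChartAt_source p) hp) b a u v w
  rw [fderiv_transition_self hp, transition_apply (mem_extChartAt_source p)] at h
  exact (congrArg (rep x p) (chartNabla2Curv_eq (mem_extChartAt_target p) b a u v w)).trans h

end ChartConnection

/-! ### Velocity and covariant derivative of a curve in an arbitrary chart. -/

section Curves

variable {n : ℕ} {Q : Type*} [TopologicalSpace Q] [ChartedSpace (EuclideanSpace ℝ (Fin n)) Q]
  [IsManifold (𝓡 n) ∞ Q] [RiemannianBundle (fun x : Q => TangentSpace (𝓡 n) x)]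

local notation "𝔼" => EuclideanSpace ℝ (Fin n)

variable {T t : ℝ} {γ : ℝ → Q} {x : Q}

theorem eventually_mem_source (hγ : ContinuousWithinAt γ (Icc 0 T) t)
    (hx : γ t ∈ (extChartAt (𝓡 n) x).source) :
    ∀ᶠ s in 𝓝[Icc 0 T] t, γ s ∈ (extChartAt (𝓡 n) x).source :=
  hγ.eventually ((isOpen_extChartAt_source x).mem_nhds hx)

/-- The coordinates in the chart at `x` of a vector field along `γ`. -/
def coord (x : Q) (γ : ℝ → Q) (X : ∀ t, TangentSpace (𝓡 n) (γ t)) (t : ℝ) : 𝔼 := rep x (γ t) (X t)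

/-- In the chart centred at γ t the manifold derivative at t is by definition the derivative of the
coordinate expression. Other charts are reached through the transition map. -/
theorem hasDerivWithinAt_chart_self (hγ : MDifferentiableWithinAt 𝓘(ℝ, ℝ) (𝓡 n) γ (Icc 0 T) t) :
    HasDerivWithinAt (fun s => extChartAt (𝓡 n) (γ t) (γ s)) (coord (γ t) γ (velocity T γ) t)
      (Icc 0 T) t := by
  let L : ℝ →L[ℝ] 𝔼 := mfderivWithin 𝓘(ℝ, ℝ) (𝓡 n) γ (Icc 0 T) t
  have h1 : HasFDerivWithinAt (fun s => extChartAt (𝓡 n) (γ t) (γ s)) L (Icc 0 T) t := by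
    have h := hγ.hasMFDerivWithinAt.2
    simp only [mfld_simps] at h
    exact h
  exact h1.hasDerivWithinAt.congr_deriv
    (rep_self (γ t) (velocity (n := n) T γ t)).symm

theorem fderiv_transition_coord (x : Q) {x' : Q} (X : ∀ t, TangentSpace (𝓡 n) (γ t))
    (hx : γ t ∈ (extChartAt (𝓡 n) x).source) (hx' : γ t ∈ (extChartAt (𝓡 n) x').source) :
    fderiv ℝ (transition x x') (extChartAt (𝓡 n) x (γ t)) (coord x γ X t) = coord x' γ X t :=
  fderiv_transition_rep hx hx' (X t)

theorem hasDerivWithinAt_chart (hγ : MDifferentiableWithinAt 𝓘(ℝ, ℝ) (𝓡 n) γ (Icc 0 T) t)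
    (ht : t ∈ Icc 0 T) (hx : γ t ∈ (extChartAt (𝓡 n) x).source) :
    HasDerivWithinAt (fun s => extChartAt (𝓡 n) x (γ s)) (coord x γ (velocity T γ) t)
      (Icc 0 T) t := by
  have hself := mem_extChartAt_source (I := 𝓡 n) (γ t)
  have h1 := hasDerivWithinAt_chart_self hγ
  have hm := mem_transitionSource hself hx
  have h2 := (ContDiffOn.differentiableAt_of_isOpen (contDiffOn_transition (γ t) x)
    (isOpen_transitionSource _ _) hm).hasFDerivAt
  have h3 := h2.comp_hasDerivWithinAt t h1
  rw [fderiv_transition_coord (γ t) (velocity T γ) hself hx] at h3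
  refine h3.congr_of_eventuallyEq_of_mem ?_ ht
  filter_upwards [eventually_mem_source hγ.continuousWithinAt hself] with s hs
  exact (transition_apply hs).symm

variable [IsContMDiffRiemannianBundle (𝓡 n) ∞ (EuclideanSpace ℝ (Fin n))
    (fun x : Q => TangentSpace (𝓡 n) x)] {X : ∀ t, TangentSpace (𝓡 n) (γ t)}

theorem coord_self (X : ∀ t, TangentSpace (𝓡 n) (γ t)) (t : ℝ) : coord (γ t) γ X t = X t :=
  rep_self (γ t) (X t)

theorem coord_covDeriv_self (X : ∀ t, TangentSpace (𝓡 n) (γ t)) (t : ℝ) :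
    coord (γ t) γ (covDeriv T γ X) t = derivWithin (coord (γ t) γ X) (Icc 0 T) t
      + christoffelL (γ t) (extChartAt (𝓡 n) (γ t) (γ t)) (coord (γ t) γ (velocity T γ) t)
        (coord (γ t) γ X t) := by
  rw [coord_self (velocity T γ) t]
  exact rep_self (γ t) (covDeriv T γ X t)

/-- The covariant derivative in an arbitrary chart. -/
theorem hasDerivWithinAt_coord (hγ : MDifferentiableWithinAt 𝓘(ℝ, ℝ) (𝓡 n) γ (Icc 0 T) t)
    (ht : t ∈ Icc 0 T) (hx : γ t ∈ (extChartAt (𝓡 n) x).source)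
    (hX : DifferentiableWithinAt ℝ (coord (γ t) γ X) (Icc 0 T) t) :
    HasDerivWithinAt (coord x γ X)
      (coord x γ (covDeriv T γ X) t - christoffelL x (extChartAt (𝓡 n) x (γ t))
        (coord x γ (velocity T γ) t) (coord x γ X t)) (Icc 0 T) t := by
  have hself := mem_extChartAt_source (I := 𝓡 n) (γ t)
  have hm := mem_transitionSource hself hx
  have hd : DifferentiableAt ℝ (fderiv ℝ (transition (γ t) x)) (extChartAt (𝓡 n) (γ t) (γ t)) :=
    ContDiffOn.differentiableAt_of_isOpen
      ((contDiffOn_transition (γ t) x).fderiv_of_isOpen (m := ∞) (isOpen_transitionSource _ _)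
        le_rfl) (isOpen_transitionSource _ _) hm
  have h1 := hd.hasFDerivAt.comp_hasDerivWithinAt t (hasDerivWithinAt_chart_self hγ)
  have h2 := h1.clm_apply hX.hasDerivWithinAt
  refine HasDerivWithinAt.congr_deriv (h2.congr_of_eventuallyEq_of_mem ?_ ht) ?_
  · filter_upwards [eventually_mem_source hγ.continuousWithinAt hself,
      eventually_mem_source hγ.continuousWithinAt hx] with s hs hs'
    exact (fderiv_transition_coord (γ t) X hs hs').symm
  -- The product rule has produced a second derivative of the transition map. The transformation law
  -- of the Christoffel map absorbs it.
  have k := (isIsometryOn_transition (γ t) x).fderiv_christoffel_apply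
    (isLeviCivitaOn_transitionSource (γ t) x) (isLeviCivitaOn_chart x) hm
    (coord (γ t) γ (velocity T γ) t) (coord (γ t) γ X t)
  have e := congrArg (fderiv ℝ (transition (γ t) x) (extChartAt (𝓡 n) (γ t) (γ t)))
    (coord_covDeriv_self (T := T) X t)
  rw [map_add, k, fderiv_transition_coord (γ t) _ hself hx,
    fderiv_transition_coord (γ t) _ hself hx, fderiv_transition_coord (γ t) _ hself hx,
    transition_apply hself] at e
  rw [e, Function.comp_apply]
  abel

end Curves

theorem jacobiF_map {E E' : Type*} [NormedAddCommGroup E] [NormedSpace ℝ E]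
    [NormedAddCommGroup E'] [NormedSpace ℝ E'] (L : E →L[ℝ] E') {R : E → E → E → E}
    {dR : E → E → E → E → E} {d2R : E → E → E → E → E → E} {R' : E' → E' → E' → E'}
    {dR' : E' → E' → E' → E' → E'} {d2R' : E' → E' → E' → E' → E' → E'}
    (h : ∀ u v w, L (R u v w) = R' (L u) (L v) (L w))
    (h1 : ∀ a u v w, L (dR a u v w) = dR' (L a) (L u) (L v) (L w))
    (h2 : ∀ b a u v w, L (d2R b a u v w) = d2R' (L b) (L a) (L u) (L v) (L w))
    (X₀ X₁ X₂ Y Y₁ Y₂ : E) : L (jacobiF R dR d2R X₀ X₁ X₂ Y Y₁ Y₂)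
      = jacobiF R' dR' d2R' (L X₀) (L X₁) (L X₂) (L Y) (L Y₁) (L Y₂) := by
  simp only [jacobiF, map_add, map_smul, h, h1, h2]

/-! ### Calculus of smooth vector fields along a curve. -/

section SmoothFields

variable {n : ℕ} {Q : Type*} [TopologicalSpace Q] [ChartedSpace (EuclideanSpace ℝ (Fin n)) Q]
  [IsManifold (𝓡 n) ∞ Q] [RiemannianBundle (fun x : Q => TangentSpace (𝓡 n) x)]

local notation "𝔼" => EuclideanSpace ℝ (Fin n)

variable {T t : ℝ} {γ : ℝ → Q} {x : Q} {X Z : ∀ t, TangentSpace (𝓡 n) (γ t)}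

/-- Smooth vector fields along `γ` on `[0, T]`. -/
def IsSmoothField (T : ℝ) (γ : ℝ → Q) (X : ∀ t, TangentSpace (𝓡 n) (γ t)) : Prop :=
  ContMDiffOn 𝓘(ℝ, ℝ) (𝓡 n).tangent ∞ (fun t => (⟨γ t, X t⟩ : TangentBundle (𝓡 n) Q)) (Icc 0 T)

theorem contMDiffWithinAt_field_iff {s : Set ℝ} (hx : γ t ∈ (extChartAt (𝓡 n) x).source) :
    ContMDiffWithinAt 𝓘(ℝ, ℝ) (𝓡 n).tangent ∞ (fun t => (⟨γ t, X t⟩ : TangentBundle (𝓡 n) Q)) s t ↔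
      ContMDiffWithinAt 𝓘(ℝ, ℝ) (𝓡 n) ∞ γ s t ∧ ContDiffWithinAt ℝ ∞ (coord x γ X) s t := by
  rw [Trivialization.contMDiffWithinAt_iff (e := trivializationAt 𝔼 (TangentSpace (𝓡 n)) x)
    ((Trivialization.mem_source _).2 (by simpa using hx)), ← contMDiffWithinAt_iff_contDiffWithinAt]
  rfl

theorem IsSmoothField.contDiffWithinAt (hX : IsSmoothField T γ X) (ht : t ∈ Icc 0 T)
    (hx : γ t ∈ (extChartAt (𝓡 n) x).source) :
    ContDiffWithinAt ℝ ∞ (coord x γ X) (Icc 0 T) t :=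
  ((contMDiffWithinAt_field_iff hx).1 (hX t ht)).2

/-- Reduces smoothness of a field to a coordinate formula f, one for each chart, valid at the times
when the curve is in that chart. -/
theorem isSmoothField_of (hγ : ContMDiffOn 𝓘(ℝ, ℝ) (𝓡 n) ∞ γ (Icc 0 T))
    (h : ∀ x : Q, ∃ f : ℝ → 𝔼, ∀ t ∈ Icc 0 T, γ t ∈ (extChartAt (𝓡 n) x).source →
      coord x γ X t = f t ∧ ContDiffWithinAt ℝ ∞ f (Icc 0 T) t) : IsSmoothField T γ X := by
  intro t ht
  have hx := mem_extChartAt_source (I := 𝓡 n) (γ t)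
  obtain ⟨f, hf⟩ := h (γ t)
  refine (contMDiffWithinAt_field_iff hx).2 ⟨hγ t ht, ?_⟩
  refine (hf t ht hx).2.congr_of_eventuallyEq ?_ (hf t ht hx).1
  filter_upwards [eventually_mem_source (hγ t ht).continuousWithinAt hx, self_mem_nhdsWithin]
    with s hs hs'
  exact (hf s hs' hs).1

theorem contDiffWithinAt_chart (hγ : ContMDiffOn 𝓘(ℝ, ℝ) (𝓡 n) ∞ γ (Icc 0 T)) (ht : t ∈ Icc 0 T)
    (hx : γ t ∈ (extChartAt (𝓡 n) x).source) :
    ContDiffWithinAt ℝ ∞ (fun s => extChartAt (𝓡 n) x (γ s)) (Icc 0 T) t := by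
  have h : ContMDiffAt (𝓡 n) 𝓘(ℝ, 𝔼) ∞ (extChartAt (𝓡 n) x) (γ t) :=
    contMDiffAt_extChartAt' (by simpa using hx)
  exact contMDiffWithinAt_iff_contDiffWithinAt.1 (h.comp_contMDiffWithinAt t (hγ t ht))

theorem contDiffWithinAt_comp_chart {F : Type*} [NormedAddCommGroup F] [NormedSpace ℝ F]
    {S : 𝔼 → F} (hS : ContDiffOn ℝ ∞ S (extChartAt (𝓡 n) x).target)
    (hγ : ContMDiffOn 𝓘(ℝ, ℝ) (𝓡 n) ∞ γ (Icc 0 T)) (ht : t ∈ Icc 0 T)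
    (hx : γ t ∈ (extChartAt (𝓡 n) x).source) :
    ContDiffWithinAt ℝ ∞ (fun s => S (extChartAt (𝓡 n) x (γ s))) (Icc 0 T) t :=
  (hS.contDiffAt ((isOpen_extChartAt_target x).mem_nhds
    ((extChartAt (𝓡 n) x).map_source hx))).comp_contDiffWithinAt t (contDiffWithinAt_chart hγ ht hx)

theorem contDiffWithinAt_derivWithin {F : Type*} [NormedAddCommGroup F] [NormedSpace ℝ F]
    (hT : 0 < T) {f : ℝ → F} (ht : t ∈ Icc 0 T) (hf : ContDiffWithinAt ℝ ∞ f (Icc 0 T) t) :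
    ContDiffWithinAt ℝ ∞ (derivWithin f (Icc 0 T)) (Icc 0 T) t :=
  (hf.fderivWithin_right (m := ∞) (uniqueDiffOn_Icc hT) le_rfl ht).clm_apply
    contDiffWithinAt_const

theorem mdifferentiableWithinAt_of_contMDiffOn (hγ : ContMDiffOn 𝓘(ℝ, ℝ) (𝓡 n) ∞ γ (Icc 0 T))
    (ht : t ∈ Icc 0 T) : MDifferentiableWithinAt 𝓘(ℝ, ℝ) (𝓡 n) γ (Icc 0 T) t :=
  (hγ t ht).mdifferentiableWithinAt (by simp)

theorem coord_velocity (hT : 0 < T) (hγ : ContMDiffOn 𝓘(ℝ, ℝ) (𝓡 n) ∞ γ (Icc 0 T))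
    (ht : t ∈ Icc 0 T) (hx : γ t ∈ (extChartAt (𝓡 n) x).source) :
    coord x γ (velocity T γ) t = derivWithin (fun s => extChartAt (𝓡 n) x (γ s)) (Icc 0 T) t :=
  ((hasDerivWithinAt_chart (mdifferentiableWithinAt_of_contMDiffOn hγ ht) ht hx).derivWithin
    (uniqueDiffOn_Icc hT t ht)).symm

theorem isSmoothField_velocity (hT : 0 < T) (hγ : ContMDiffOn 𝓘(ℝ, ℝ) (𝓡 n) ∞ γ (Icc 0 T)) :
    IsSmoothField T γ (velocity (n := n) T γ) :=
  isSmoothField_of hγ fun (x : Q) => ⟨derivWithin (fun s => extChartAt (𝓡 n) x (γ s)) (Icc 0 T),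
    fun _ ht hx =>
    ⟨coord_velocity (n := n) hT hγ ht hx,
      contDiffWithinAt_derivWithin hT ht (contDiffWithinAt_chart hγ ht hx)⟩⟩

theorem coord_add (X Z : ∀ t, TangentSpace (𝓡 n) (γ t)) (t : ℝ) :
    coord x γ (fun t => X t + Z t) t = coord x γ X t + coord x γ Z t :=
  map_add (rep x (γ t)) (X t : 𝔼) (Z t : 𝔼)

theorem coord_smul (φ : ℝ → ℝ) (X : ∀ t, TangentSpace (𝓡 n) (γ t)) (t : ℝ) :
    coord x γ (fun t => φ t • X t) t = φ t • coord x γ X t :=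
  map_smul (rep x (γ t)) (φ t) (X t : 𝔼)

theorem IsSmoothField.add (hX : IsSmoothField T γ X) (hZ : IsSmoothField T γ Z)
    (hγ : ContMDiffOn 𝓘(ℝ, ℝ) (𝓡 n) ∞ γ (Icc 0 T)) : IsSmoothField T γ (fun t => X t + Z t) :=
  isSmoothField_of hγ fun _ => ⟨_, fun _ ht hx => ⟨coord_add X Z _,
    (hX.contDiffWithinAt ht hx).add (hZ.contDiffWithinAt ht hx)⟩⟩

theorem IsSmoothField.smul (hX : IsSmoothField T γ X) {φ : ℝ → ℝ}
    (hφ : ContDiffOn ℝ ∞ φ (Icc 0 T))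
    (hγ : ContMDiffOn 𝓘(ℝ, ℝ) (𝓡 n) ∞ γ (Icc 0 T)) : IsSmoothField T γ (fun t => φ t • X t) :=
  isSmoothField_of hγ fun _ => ⟨_, fun t ht hx => ⟨coord_smul φ X _,
    (hφ t ht).smul (hX.contDiffWithinAt ht hx)⟩⟩

variable [IsContMDiffRiemannianBundle (𝓡 n) ∞ (EuclideanSpace ℝ (Fin n))
    (fun x : Q => TangentSpace (𝓡 n) x)]

theorem IsSmoothField.hasDerivWithinAt_coord (hX : IsSmoothField T γ X)
    (hγ : ContMDiffOn 𝓘(ℝ, ℝ) (𝓡 n) ∞ γ (Icc 0 T)) (ht : t ∈ Icc 0 T)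
    (hx : γ t ∈ (extChartAt (𝓡 n) x).source) :
    HasDerivWithinAt (coord x γ X)
      (coord x γ (covDeriv T γ X) t - christoffelL x (extChartAt (𝓡 n) x (γ t))
        (coord x γ (velocity T γ) t) (coord x γ X t)) (Icc 0 T) t :=
  ObstacleAvoidance.hasDerivWithinAt_coord (mdifferentiableWithinAt_of_contMDiffOn hγ ht) ht hx
    ((hX.contDiffWithinAt ht (mem_extChartAt_source _)).differentiableWithinAt (by simp))

theorem IsSmoothField.coord_covDeriv (hX : IsSmoothField T γ X) (hT : 0 < T)
    (hγ : ContMDiffOn 𝓘(ℝ, ℝ) (𝓡 n) ∞ γ (Icc 0 T)) (ht : t ∈ Icc 0 T)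
    (hx : γ t ∈ (extChartAt (𝓡 n) x).source) :
    coord x γ (covDeriv T γ X) t = derivWithin (coord x γ X) (Icc 0 T) t
      + christoffelL x (extChartAt (𝓡 n) x (γ t)) (coord x γ (velocity T γ) t) (coord x γ X t) := by
  rw [(hX.hasDerivWithinAt_coord hγ ht hx).derivWithin (uniqueDiffOn_Icc hT t ht)]
  abel

theorem IsSmoothField.covDeriv (hX : IsSmoothField T γ X) (hT : 0 < T)
    (hγ : ContMDiffOn 𝓘(ℝ, ℝ) (𝓡 n) ∞ γ (Icc 0 T)) : IsSmoothField T γ (covDeriv T γ X) :=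
  isSmoothField_of hγ fun x => ⟨_, fun _ ht hx => ⟨hX.coord_covDeriv hT hγ ht hx,
    (contDiffWithinAt_derivWithin hT ht (hX.contDiffWithinAt ht hx)).add
    (((contDiffWithinAt_comp_chart (isLeviCivitaOn_chart x).smooth hγ ht hx).clm_apply
      ((isSmoothField_velocity hT hγ).contDiffWithinAt ht hx)).clm_apply
        (hX.contDiffWithinAt ht hx))⟩⟩

theorem IsSmoothField.covDeriv_iterate (hX : IsSmoothField T γ X) (hT : 0 < T)
    (hγ : ContMDiffOn 𝓘(ℝ, ℝ) (𝓡 n) ∞ γ (Icc 0 T)) (k : ℕ) :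
    IsSmoothField T γ ((ObstacleAvoidance.covDeriv T γ)^[k] X) := by
  induction k with
  | zero => exact hX
  | succ k ih => rw [Function.iterate_succ_apply']; exact ih.covDeriv hT hγ

theorem coord_injective {v w : TangentSpace (𝓡 n) (γ t)}
    (h : rep (γ t) (γ t) v = rep (γ t) (γ t) w) : v = w :=
  rep_injective (mem_extChartAt_source (γ t)) h

theorem covDeriv_add (hT : 0 < T) (hγ : ContMDiffOn 𝓘(ℝ, ℝ) (𝓡 n) ∞ γ (Icc 0 T))
    (hX : IsSmoothField T γ X) (hZ : IsSmoothField T γ Z) (ht : t ∈ Icc 0 T) :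
    covDeriv T γ (fun t => X t + Z t) t = covDeriv T γ X t + covDeriv T γ Z t := by
  have hx := mem_extChartAt_source (I := 𝓡 n) (γ t)
  have h1 := (hX.add hZ hγ).hasDerivWithinAt_coord hγ ht hx
  have h2 := (hX.hasDerivWithinAt_coord hγ ht hx).add (hZ.hasDerivWithinAt_coord hγ ht hx)
  have e : coord (γ t) γ (fun t => X t + Z t) = coord (γ t) γ X + coord (γ t) γ Z :=
    funext (coord_add X Z)
  rw [e] at h1
  have h3 := (uniqueDiffOn_Icc hT t ht).eq_deriv _ h1 h2
  rw [Pi.add_apply, map_add] at h3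
  refine coord_injective ?_
  have h4 : coord (γ t) γ (covDeriv T γ fun t => X t + Z t) t
      = coord (γ t) γ (covDeriv T γ X) t + coord (γ t) γ (covDeriv T γ Z) t := by
    linear_combination (norm := module) h3
  exact h4.trans (coord_add (covDeriv T γ X) (covDeriv T γ Z) t).symm

theorem covDeriv_smul (hT : 0 < T) (hγ : ContMDiffOn 𝓘(ℝ, ℝ) (𝓡 n) ∞ γ (Icc 0 T))
    (hX : IsSmoothField T γ X) {φ φ' : ℝ → ℝ} (hφs : ContDiffOn ℝ ∞ φ (Icc 0 T))
    (hφ : HasDerivWithinAt φ (φ' t) (Icc 0 T) t) (ht : t ∈ Icc 0 T) :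
    covDeriv T γ (fun t => φ t • X t) t = φ' t • X t + φ t • covDeriv T γ X t := by
  have hx := mem_extChartAt_source (I := 𝓡 n) (γ t)
  have h1 := (hX.smul hφs hγ).hasDerivWithinAt_coord hγ ht hx
  have h2 := hφ.smul (hX.hasDerivWithinAt_coord hγ ht hx)
  have e : coord (γ t) γ (fun t => φ t • X t) = φ • coord (γ t) γ X :=
    funext (coord_smul φ X)
  rw [e] at h1
  have h3 := (uniqueDiffOn_Icc hT t ht).eq_deriv _ h1 h2
  rw [Pi.smul_apply', map_smul] at h3
  refine coord_injective ?_
  have h4 : coord (γ t) γ (covDeriv T γ fun t => φ t • X t) t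
      = φ' t • coord (γ t) γ X t + φ t • coord (γ t) γ (covDeriv T γ X) t := by
    linear_combination (norm := module) h3
  refine h4.trans ?_
  rw [← coord_smul φ', ← coord_smul φ, ← coord_add]
  rfl

/-- Differentiation of inner products. -/
theorem hasDerivWithinAt_metricAt (hγ : ContMDiffOn 𝓘(ℝ, ℝ) (𝓡 n) ∞ γ (Icc 0 T))
    (hX : IsSmoothField T γ X) (hZ : IsSmoothField T γ Z) (ht : t ∈ Icc 0 T) :
    HasDerivWithinAt (fun t => metricAt (γ t) (X t) (Z t))
      (metricAt (γ t) (covDeriv T γ X t) (Z t) + metricAt (γ t) (X t) (covDeriv T γ Z t))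
      (Icc 0 T) t := by
  have hx := mem_extChartAt_source (I := 𝓡 n) (γ t)
  have hm := (extChartAt (𝓡 n) (γ t)).map_source hx
  have h := isLeviCivitaOn_chart (n := n) (γ t)
  have hg := (ContDiffOn.differentiableAt_of_isOpen h.smooth_metric h.isOpen hm).hasFDerivAt
  have h1 := hg.comp_hasDerivWithinAt t
    (hasDerivWithinAt_chart (mdifferentiableWithinAt_of_contMDiffOn hγ ht) ht hx)
  have h2 := (h1.clm_apply (hX.hasDerivWithinAt_coord hγ ht hx)).clm_apply
    (hZ.hasDerivWithinAt_coord hγ ht hx)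
  refine HasDerivWithinAt.congr_deriv (h2.congr_of_eventuallyEq_of_mem ?_ ht) ?_
  · filter_upwards [eventually_mem_source (hγ t ht).continuousWithinAt hx] with s hs
    exact (chartMetric_rep hs (X s) (Z s)).symm
  rw [← chartMetric_rep hx, ← chartMetric_rep hx]
  change _ = chartMetric (γ t) (extChartAt (𝓡 n) (γ t) (γ t)) (coord (γ t) γ (covDeriv T γ X) t)
      (coord (γ t) γ Z t) + chartMetric (γ t) (extChartAt (𝓡 n) (γ t) (γ t)) (coord (γ t) γ X t)
      (coord (γ t) γ (covDeriv T γ Z) t)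
  simp only [Function.comp_apply, add_apply, h.compat _ hm, map_sub, sub_apply]
  ring

theorem contDiffOn_metricAt (hγ : ContMDiffOn 𝓘(ℝ, ℝ) (𝓡 n) ∞ γ (Icc 0 T))
    (hX : IsSmoothField T γ X) (hZ : IsSmoothField T γ Z) :
    ContDiffOn ℝ ∞ (fun t => metricAt (γ t) (X t) (Z t)) (Icc 0 T) := by
  intro t ht
  have hx := mem_extChartAt_source (I := 𝓡 n) (γ t)
  have h1 := ((contDiffWithinAt_comp_chart (isLeviCivitaOn_chart (γ t)).smooth_metric hγ ht
    hx).clm_apply (hX.contDiffWithinAt ht hx)).clm_apply (hZ.contDiffWithinAt ht hx)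
  refine h1.congr_of_eventuallyEq_of_mem ?_ ht
  filter_upwards [eventually_mem_source (hγ t ht).continuousWithinAt hx] with s hs
  exact (chartMetric_rep hs (X s) (Z s)).symm

section Tensors

variable {A B C D : ∀ t, TangentSpace (𝓡 n) (γ t)}

theorem coord_curv (hx : γ t ∈ (extChartAt (𝓡 n) x).source) :
    coord x γ (fun t => curv (γ t) (A t) (B t) (C t)) t = curvL (christoffelL x)
      (extChartAt (𝓡 n) x (γ t)) (coord x γ A t) (coord x γ B t) (coord x γ C t) :=
  rep_curv hx (A t) (B t) (C t)

theorem coord_grad {V : Q → ℝ} (hV : ContMDiff (𝓡 n) 𝓘(ℝ, ℝ) ∞ V)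
    (hx : γ t ∈ (extChartAt (𝓡 n) x).source) :
    coord x γ (fun t => grad V (γ t)) t = chartGrad V x (extChartAt (𝓡 n) x (γ t)) :=
  rep_grad hV hx

set_option maxRecDepth 4000 in
theorem rep_jacobiF (hx : γ t ∈ (extChartAt (𝓡 n) x).source) (a b c d e f : 𝔼) :
    rep x (γ t) (jacobiF (curv (γ t)) (nablaCurv (γ t)) (nabla2Curv (γ t)) a b c d e f) = jacobiF
      (fun u v w => curvL (christoffelL x) (extChartAt (𝓡 n) x (γ t)) u v w)
      (fun a u v w => nablaCurvL (christoffelL x) (extChartAt (𝓡 n) x (γ t)) a u v w)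
      (fun b a u v w => nabla2CurvL (christoffelL x) (extChartAt (𝓡 n) x (γ t)) b a u v w)
      (rep x (γ t) a) (rep x (γ t) b) (rep x (γ t) c) (rep x (γ t) d) (rep x (γ t) e)
      (rep x (γ t) f) := by
  exact jacobiF_map (rep x (γ t)) (fun u v w => rep_curv hx u v w)
    (fun a u v w => rep_nablaCurv hx a u v w) (fun b a u v w => rep_nabla2Curv hx b a u v w)
    _ _ _ _ _ _

end Tensors

end SmoothFields

/-! ### The lower order part of the Jacobi operator as a linear map in coordinates. -/

section JacobiOperator

variable {E : Type*} [NormedAddCommGroup E] [NormedSpace ℝ E] [FiniteDimensional ℝ E]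

/-- The zeroth order part `F + ∇G` of the linearized Euler-Lagrange operator, as a linear function
of `(X, DX/dt, D²X/dt²)`. -/
def jacobiOp (Γ : E → E →L[ℝ] E →L[ℝ] E) (G : E → E) (y Y Y₁ Y₂ : E) : E × E × E →L[ℝ] E :=
  LinearMap.toContinuousLinearMap
    { toFun := fun p => jacobiF (fun u v w => curvL Γ y u v w) (fun a u v w => nablaCurvL Γ y a u v w)
        (fun b a u v w => nabla2CurvL Γ y b a u v w) p.1 p.2.1 p.2.2 Y Y₁ Y₂ + nablaVec Γ G y p.1
      map_add' := fun p p' => by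
        simp only [jacobiF, nablaVec, Prod.fst_add, Prod.snd_add, map_add, add_apply]
        module
      map_smul' := fun r p => by
        simp only [jacobiF, nablaVec, Prod.smul_fst, Prod.smul_snd, map_smul, smul_apply,
          RingHom.id_apply]
        module }

theorem jacobiOp_apply (Γ : E → E →L[ℝ] E →L[ℝ] E) (G : E → E) (y Y Y₁ Y₂ X₀ X₁ X₂ : E) :
    jacobiOp Γ G y Y Y₁ Y₂ (X₀, X₁, X₂) = jacobiF (fun u v w => curvL Γ y u v w)
      (fun a u v w => nablaCurvL Γ y a u v w) (fun b a u v w => nabla2CurvL Γ y b a u v w)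
      X₀ X₁ X₂ Y Y₁ Y₂ + nablaVec Γ G y X₀ := rfl

theorem contDiffWithinAt_jacobiOp {g : E → E →L[ℝ] E →L[ℝ] ℝ} {Γ : E → E →L[ℝ] E →L[ℝ] E}
    {G : E → E} {U : Set E} (h : IsLeviCivitaOn g Γ U) (hG : ContDiffOn ℝ ∞ G U) {s : Set ℝ} {t : ℝ}
    {y Y Y₁ Y₂ X₀ X₁ X₂ : ℝ → E} (hy : ContDiffWithinAt ℝ ∞ y s t) (hU : y t ∈ U)
    (hY : ContDiffWithinAt ℝ ∞ Y s t) (hY₁ : ContDiffWithinAt ℝ ∞ Y₁ s t)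
    (hY₂ : ContDiffWithinAt ℝ ∞ Y₂ s t) (hX₀ : ContDiffWithinAt ℝ ∞ X₀ s t)
    (hX₁ : ContDiffWithinAt ℝ ∞ X₁ s t) (hX₂ : ContDiffWithinAt ℝ ∞ X₂ s t) :
    ContDiffWithinAt ℝ ∞ (fun t => jacobiOp Γ G (y t) (Y t) (Y₁ t) (Y₂ t) (X₀ t, X₁ t, X₂ t)) s t := by
  have hU' := h.isOpen.mem_nhds hU
  have hR : ContDiffWithinAt ℝ ∞ (fun t => curvL Γ (y t)) s t :=
    ((contDiffOn_curvL h.isOpen h.smooth).contDiffAt hU').comp_contDiffWithinAt t hy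
  have hR1 : ContDiffWithinAt ℝ ∞ (fun t => nablaCurvL Γ (y t)) s t :=
    (h.contDiffOn_nablaCurvL.contDiffAt hU').comp_contDiffWithinAt t hy
  have hR2 : ContDiffWithinAt ℝ ∞ (fun t => nabla2CurvL Γ (y t)) s t :=
    (h.contDiffOn_nabla2CurvL.contDiffAt hU').comp_contDiffWithinAt t hy
  have hG0 : ContDiffWithinAt ℝ ∞ (fun t => G (y t)) s t :=
    (hG.contDiffAt hU').comp_contDiffWithinAt t hy
  have hG1 : ContDiffWithinAt ℝ ∞ (fun t => fderiv ℝ G (y t)) s t :=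
    ((hG.fderiv_of_isOpen (m := ∞) h.isOpen le_rfl).contDiffAt hU').comp_contDiffWithinAt t hy
  have hΓ : ContDiffWithinAt ℝ ∞ (fun t => Γ (y t)) s t :=
    (h.smooth.contDiffAt hU').comp_contDiffWithinAt t hy
  have r := fun {A B C : ℝ → E} (hA : ContDiffWithinAt ℝ ∞ A s t)
    (hB : ContDiffWithinAt ℝ ∞ B s t) (hC : ContDiffWithinAt ℝ ∞ C s t) =>
      ((hR.clm_apply hA).clm_apply hB).clm_apply hC
  have r1 := fun {A B C D : ℝ → E} (hA : ContDiffWithinAt ℝ ∞ A s t)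
    (hB : ContDiffWithinAt ℝ ∞ B s t) (hC : ContDiffWithinAt ℝ ∞ C s t)
    (hD : ContDiffWithinAt ℝ ∞ D s t) =>
      (((hR1.clm_apply hA).clm_apply hB).clm_apply hC).clm_apply hD
  have r2 := ((((hR2.clm_apply hY).clm_apply hY).clm_apply hX₀).clm_apply hY).clm_apply hY
  simp only [jacobiOp_apply, jacobiF, nablaVec]
  exact (((((((r2.add (r1 hY₁ hX₀ hY hY)).add (r1 hX₀ hY₁ hY hY)).add (r (r hX₀ hY hY) hY hY)).add
    (r hX₀ hY₂ hY)).add (((r1 hY hX₁ hY hY).add (r1 hY hX₀ hY₁ hY)).add (r hX₂ hY hY)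
      |>.const_smul (2 : ℝ))).add (((r1 hY hX₀ hY hY₁).add (r hX₀ hY hY₂)).add (r hX₀ hY₁ hY₁)
      |>.const_smul (3 : ℝ))).add ((r hX₁ hY hY₁).const_smul (4 : ℝ))).add
    ((hG1.clm_apply hX₀).add ((hΓ.clm_apply hX₀).clm_apply hG0))

end JacobiOperator

/-! ### The lower order part of the Jacobi operator along a curve: linearity and boundedness. -/

section JacobiField

variable {n : ℕ} {Q : Type*} [TopologicalSpace Q] [ChartedSpace (EuclideanSpace ℝ (Fin n)) Q]
  [IsManifold (𝓡 n) ∞ Q] [RiemannianBundle (fun x : Q => TangentSpace (𝓡 n) x)]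

local notation "𝔼" => EuclideanSpace ℝ (Fin n)

variable {T t : ℝ} {γ : ℝ → Q} {x : Q} {X Z A B C : ∀ t, TangentSpace (𝓡 n) (γ t)} {V : Q → ℝ}

/-- The zeroth order part `F + ∇ grad V` of the Jacobi operator along `γ`, as a function of
`(X, DX/dt, D²X/dt²)`. -/
def jacobiAt (V : Q → ℝ) (T : ℝ) (γ : ℝ → Q) (t : ℝ) (a b c : TangentSpace (𝓡 n) (γ t)) :
    TangentSpace (𝓡 n) (γ t) :=
  jacobiF (curv (γ t)) (nablaCurv (γ t)) (nabla2Curv (γ t)) a b c (velocity T γ t)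
    (covDeriv T γ (velocity T γ) t) ((covDeriv T γ)^[2] (velocity T γ) t) + nablaGrad V (γ t) a

variable [IsContMDiffRiemannianBundle (𝓡 n) ∞ (EuclideanSpace ℝ (Fin n))
    (fun x : Q => TangentSpace (𝓡 n) x)]

set_option maxRecDepth 4000 in
theorem rep_jacobiAt (hV : ContMDiff (𝓡 n) 𝓘(ℝ, ℝ) ∞ V) (hx : γ t ∈ (extChartAt (𝓡 n) x).source)
    (a b c : 𝔼) : rep x (γ t) (jacobiAt V T γ t a b c)
      = jacobiOp (christoffelL x) (chartGrad V x) (extChartAt (𝓡 n) x (γ t))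
        (coord x γ (velocity T γ) t) (coord x γ (covDeriv T γ (velocity T γ)) t)
        (coord x γ ((covDeriv T γ)^[2] (velocity T γ)) t)
        (rep x (γ t) a, rep x (γ t) b, rep x (γ t) c) := by
  rw [jacobiOp_apply]
  have h1 := rep_jacobiF hx a b c (velocity (n := n) T γ t)
    (covDeriv T γ (velocity T γ) t) ((covDeriv T γ)^[2] (velocity T γ) t)
  have h2 := rep_nablaGrad hV hx a
  exact (map_add (rep x (γ t)) _ _).trans (congrArg₂ (· + ·) h1 h2)

set_option maxRecDepth 4000 in
theorem coord_jacobiAt (hV : ContMDiff (𝓡 n) 𝓘(ℝ, ℝ) ∞ V)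
    (hx : γ t ∈ (extChartAt (𝓡 n) x).source) :
    coord x γ (fun t => jacobiAt V T γ t (A t) (B t) (C t)) t
      = jacobiOp (christoffelL x) (chartGrad V x) (extChartAt (𝓡 n) x (γ t))
        (coord x γ (velocity T γ) t) (coord x γ (covDeriv T γ (velocity T γ)) t)
        (coord x γ ((covDeriv T γ)^[2] (velocity T γ)) t)
        (coord x γ A t, coord x γ B t, coord x γ C t) :=
  rep_jacobiAt hV hx (A t) (B t) (C t)

theorem contDiffWithinAt_jacobiOp_chart (hV : ContMDiff (𝓡 n) 𝓘(ℝ, ℝ) ∞ V) (hT : 0 < T)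
    (hγ : ContMDiffOn 𝓘(ℝ, ℝ) (𝓡 n) ∞ γ (Icc 0 T)) (ht : t ∈ Icc 0 T)
    (hx : γ t ∈ (extChartAt (𝓡 n) x).source) {a b c : ℝ → 𝔼}
    (ha : ContDiffWithinAt ℝ ∞ a (Icc 0 T) t) (hb : ContDiffWithinAt ℝ ∞ b (Icc 0 T) t)
    (hc : ContDiffWithinAt ℝ ∞ c (Icc 0 T) t) :
    ContDiffWithinAt ℝ ∞ (fun t => jacobiOp (christoffelL x) (chartGrad V x)
        (extChartAt (𝓡 n) x (γ t))
        (coord x γ (velocity T γ) t) (coord x γ (covDeriv T γ (velocity T γ)) t)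
        (coord x γ ((covDeriv T γ)^[2] (velocity T γ)) t) (a t, b t, c t)) (Icc 0 T) t :=
  contDiffWithinAt_jacobiOp (isLeviCivitaOn_chart x) (contDiffOn_chartGrad hV x)
    (contDiffWithinAt_chart hγ ht hx) ((extChartAt (𝓡 n) x).map_source hx)
    ((isSmoothField_velocity hT hγ).contDiffWithinAt ht hx)
    (((isSmoothField_velocity hT hγ).covDeriv hT hγ).contDiffWithinAt ht hx)
    (((isSmoothField_velocity hT hγ).covDeriv_iterate hT hγ 2).contDiffWithinAt ht hx) ha hb hc

theorem isSmoothField_jacobiAt (hV : ContMDiff (𝓡 n) 𝓘(ℝ, ℝ) ∞ V) (hT : 0 < T)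
    (hγ : ContMDiffOn 𝓘(ℝ, ℝ) (𝓡 n) ∞ γ (Icc 0 T)) (hA : IsSmoothField T γ A)
    (hB : IsSmoothField T γ B) (hC : IsSmoothField T γ C) :
    IsSmoothField T γ (fun t => jacobiAt V T γ t (A t) (B t) (C t)) :=
  isSmoothField_of hγ fun _ => ⟨_, fun _ ht hx => ⟨coord_jacobiAt hV hx,
    contDiffWithinAt_jacobiOp_chart hV hT hγ ht hx (hA.contDiffWithinAt ht hx)
      (hB.contDiffWithinAt ht hx) (hC.contDiffWithinAt ht hx)⟩⟩

-- On Q the curvature tensors are bare functions of their arguments, so linearity in the 2-jet of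
-- the field is not visible. It is inherited from `jacobiOp` through the injective map `rep`.
set_option maxRecDepth 4000 in
theorem jacobiAt_add (hV : ContMDiff (𝓡 n) 𝓘(ℝ, ℝ) ∞ V) (a b c a' b' c' : TangentSpace (𝓡 n) (γ t)) :
    jacobiAt V T γ t (a + a') (b + b') (c + c')
      = jacobiAt V T γ t a b c + jacobiAt V T γ t a' b' c' := by
  have hx := mem_extChartAt_source (I := 𝓡 n) (γ t)
  have e := fun a b c : 𝔼 => rep_jacobiAt (T := T) hV hx a b c
  refine coord_injective ?_
  refine (e _ _ _).trans ?_
  refine Eq.trans ?_ (map_add (rep (γ t) (γ t)) (jacobiAt V T γ t a b c : 𝔼)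
    (jacobiAt V T γ t a' b' c' : 𝔼)).symm
  refine Eq.trans ?_ (congrArg₂ (· + ·) (e a b c) (e a' b' c')).symm
  rw [← map_add]
  refine congrArg _ ?_
  exact Prod.ext (map_add (rep (γ t) (γ t)) (a : 𝔼) a')
    (Prod.ext (map_add (rep (γ t) (γ t)) (b : 𝔼) b') (map_add (rep (γ t) (γ t)) (c : 𝔼) c'))

set_option maxRecDepth 4000 in
theorem jacobiAt_smul (hV : ContMDiff (𝓡 n) 𝓘(ℝ, ℝ) ∞ V) (r : ℝ)
    (a b c : TangentSpace (𝓡 n) (γ t)) :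
    jacobiAt V T γ t (r • a) (r • b) (r • c) = r • jacobiAt V T γ t a b c := by
  have hx := mem_extChartAt_source (I := 𝓡 n) (γ t)
  have e := fun a b c : 𝔼 => rep_jacobiAt (T := T) hV hx a b c
  refine coord_injective ?_
  refine (e _ _ _).trans ?_
  refine Eq.trans ?_ (map_smul (rep (γ t) (γ t)) r (jacobiAt V T γ t a b c : 𝔼)).symm
  refine Eq.trans ?_ (congrArg (r • ·) (e a b c)).symm
  rw [← map_smul]
  refine congrArg _ ?_
  exact Prod.ext (map_smul (rep (γ t) (γ t)) r (a : 𝔼))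
    (Prod.ext (map_smul (rep (γ t) (γ t)) r (b : 𝔼)) (map_smul (rep (γ t) (γ t)) r (c : 𝔼)))

/-- The fibre norms vary continuously, so near x they are uniformly equivalent to the coordinate
norm. This allows estimates made in a chart to be restated with the norms of the tangent spaces. -/
theorem exists_norm_rep_le (x : Q) : ∃ K > 0, ∀ᶠ p in 𝓝 x, ∀ v : TangentSpace (𝓡 n) p,
    ‖rep x p v‖ ≤ K * ‖v‖ ∧ ‖v‖ ≤ K * ‖rep x p v‖ := by
  have : IsContinuousRiemannianBundle (EuclideanSpace ℝ (Fin n))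
      (fun x : Q => TangentSpace (𝓡 n) x) := by
    obtain ⟨g, hg, hgi⟩ := IsContMDiffRiemannianBundle.exists_contMDiff (IB := 𝓡 n) (n := ∞)
      (F := EuclideanSpace ℝ (Fin n)) (E := fun x : Q => TangentSpace (𝓡 n) x)
    exact ⟨g, hg.continuous, hgi⟩
  obtain ⟨K, hK, h1⟩ := eventually_norm_trivializationAt_lt 𝔼
    (fun x : Q => TangentSpace (𝓡 n) x) x
  obtain ⟨K', hK', h2⟩ := eventually_norm_symmL_trivializationAt_lt 𝔼
    (fun x : Q => TangentSpace (𝓡 n) x) x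
  refine ⟨max K K', by positivity, ?_⟩
  filter_upwards [h1, h2, (isOpen_extChartAt_source (I := 𝓡 n) x).mem_nhds
    (mem_extChartAt_source x)] with p hp1 hp2 hp v
  have hb : p ∈ (trivializationAt 𝔼 (TangentSpace (𝓡 n)) x).baseSet := by simpa using hp
  have e : (trivializationAt 𝔼 (TangentSpace (𝓡 n)) x).continuousLinearMapAt ℝ p v = rep x p v := by
    rw [Trivialization.continuousLinearMapAt_apply, Trivialization.coe_linearMapAt_of_mem _ hb]
    rfl
  constructor
  · rw [← e]
    exact (ContinuousLinearMap.le_of_opNorm_le _ hp1.le v).trans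
      (mul_le_mul_of_nonneg_right (le_max_left _ _) (norm_nonneg _))
  · have e2 := (trivializationAt 𝔼 (TangentSpace (𝓡 n)) x).symmL_continuousLinearMapAt (R := ℝ) hb v
    rw [e] at e2
    calc ‖v‖ = ‖(trivializationAt 𝔼 (TangentSpace (𝓡 n)) x).symmL ℝ p (rep x p v)‖ := by rw [e2]
      _ ≤ K' * ‖rep x p v‖ := ContinuousLinearMap.le_of_opNorm_le _ hp2.le _
      _ ≤ _ := mul_le_mul_of_nonneg_right (le_max_right _ _) (norm_nonneg _)

set_option maxRecDepth 4000 in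
/-- The zeroth order part of the Jacobi operator is bounded on `[0, T]`. -/
theorem exists_norm_jacobiAt_le (hV : ContMDiff (𝓡 n) 𝓘(ℝ, ℝ) ∞ V) (hT : 0 < T)
    (hγ : ContMDiffOn 𝓘(ℝ, ℝ) (𝓡 n) ∞ γ (Icc 0 T)) : ∃ K ≥ 0, ∀ t ∈ Icc 0 T,
      ∀ a b c : TangentSpace (𝓡 n) (γ t), ‖jacobiAt V T γ t a b c‖ ≤ K * (‖a‖ + ‖b‖ + ‖c‖) := by
  -- The bound is local: near each time the coordinate operator is continuous and the norms are
  -- comparable. Compactness of [0, T] makes it global, since the property passes to subsets and to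
  -- unions of two sets.
  let p : Set ℝ → Prop := fun S => ∃ K ≥ 0, ∀ t ∈ S,
    ∀ a b c : TangentSpace (𝓡 n) (γ t), ‖jacobiAt V T γ t a b c‖ ≤ K * (‖a‖ + ‖b‖ + ‖c‖)
  refine isCompact_Icc.induction_on (p := p) ⟨0, le_rfl, by simp⟩
    (fun S S' h ⟨K, hK, H⟩ => ⟨K, hK, fun t ht => H t (h ht)⟩) ?_ ?_
  · rintro S S' ⟨K, hK, H⟩ ⟨K', hK', H'⟩
    refine ⟨K + K', by positivity, ?_⟩
    rintro t (ht | ht) a b c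
    · refine (H t ht a b c).trans (mul_le_mul_of_nonneg_right (by linarith) (by positivity))
    · refine (H' t ht a b c).trans (mul_le_mul_of_nonneg_right (by linarith) (by positivity))
  · intro t₀ ht₀
    have hx := mem_extChartAt_source (I := 𝓡 n) (γ t₀)
    obtain ⟨K, hK, h1⟩ := exists_norm_rep_le (n := n) (γ t₀)
    let Λ : ℝ → 𝔼 × 𝔼 × 𝔼 →L[ℝ] 𝔼 := fun t => jacobiOp (christoffelL (γ t₀)) (chartGrad V (γ t₀))
        (extChartAt (𝓡 n) (γ t₀) (γ t))
        (coord (γ t₀) γ (velocity T γ) t) (coord (γ t₀) γ (covDeriv T γ (velocity T γ)) t)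
        (coord (γ t₀) γ ((covDeriv T γ)^[2] (velocity T γ)) t)
    have hΛ : ContinuousWithinAt Λ (Icc 0 T) t₀ := by
      refine continuousWithinAt_clm_apply.2 fun v => ?_
      exact (contDiffWithinAt_jacobiOp_chart hV hT hγ ht₀ hx (a := fun _ => v.1)
        (b := fun _ => v.2.1) (c := fun _ => v.2.2) contDiffWithinAt_const contDiffWithinAt_const
        contDiffWithinAt_const).continuousWithinAt
    have h2 : ∀ᶠ t in 𝓝[Icc 0 T] t₀, ‖Λ t‖ < ‖Λ t₀‖ + 1 :=
      hΛ.norm.eventually (gt_mem_nhds (lt_add_one _))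
    have h3 := (hγ t₀ ht₀).continuousWithinAt.eventually h1
    refine ⟨_, Filter.inter_mem (Filter.inter_mem h2 h3) (eventually_mem_source
      (hγ t₀ ht₀).continuousWithinAt hx), K * ((‖Λ t₀‖ + 1) * K), by positivity, ?_⟩
    rintro t ⟨⟨hΛt, ht⟩, hxt⟩ a b c
    have e : rep (γ t₀) (γ t) (jacobiAt V T γ t a b c) = Λ t (rep (γ t₀) (γ t) a,
      rep (γ t₀) (γ t) b, rep (γ t₀) (γ t) c) := rep_jacobiAt hV hxt a b c
    have hprod : ‖(rep (γ t₀) (γ t) a, rep (γ t₀) (γ t) b, rep (γ t₀) (γ t) c)‖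
        ≤ K * (‖a‖ + ‖b‖ + ‖c‖) := by
      have ha := (ht a).1
      have hb := (ht b).1
      have hc := (ht c).1
      have na := mul_nonneg hK.le (norm_nonneg a)
      have nb := mul_nonneg hK.le (norm_nonneg b)
      have nc := mul_nonneg hK.le (norm_nonneg c)
      simp only [Prod.norm_def, mul_add]
      refine max_le (by linarith) (max_le (by linarith) (by linarith))
    calc ‖jacobiAt V T γ t a b c‖ ≤ K * ‖rep (γ t₀) (γ t) (jacobiAt V T γ t a b c)‖ := (ht _).2
      _ ≤ K * ((‖Λ t₀‖ + 1) * (K * (‖a‖ + ‖b‖ + ‖c‖))) := by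
        rw [e]
        refine mul_le_mul_of_nonneg_left ?_ hK.le
        refine (ContinuousLinearMap.le_of_opNorm_le _ (le_of_lt hΛt) _).trans ?_
        exact mul_le_mul_of_nonneg_left hprod (by positivity)
      _ = _ := by ring

end JacobiField

/-! ### Scalar differential inequalities. -/

section ScalarEstimates

/-- Gronwall's lemma for a nonnegative function with a zero. -/
theorem eq_zero_of_abs_deriv_le {T K t₀ : ℝ} {N N' : ℝ → ℝ}
    (hN : ∀ t ∈ Icc 0 T, HasDerivWithinAt N (N' t) (Icc 0 T) t) (h0 : ∀ t, 0 ≤ N t)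
    (hK : ∀ t ∈ Icc 0 T, |N' t| ≤ K * N t) (ht₀ : t₀ ∈ Icc 0 T) (hz : N t₀ = 0) :
    ∀ t ∈ Icc 0 T, N t = 0 := by
  have hint : ∀ t ∈ interior (Icc 0 T), HasDerivAt N (N' t) t ∧ |N' t| ≤ K * N t := fun t ht =>
    ⟨(hN t (interior_subset ht)).hasDerivAt (mem_interior_iff_mem_nhds.1 ht),
      hK t (interior_subset ht)⟩
  have hexp : ∀ (r t : ℝ), HasDerivAt (fun t => Real.exp (r * t)) (Real.exp (r * t) * r) t :=
    fun r t => by simpa using ((hasDerivAt_id t).const_mul r).exp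
  have hcont : ∀ r : ℝ, ContinuousOn (fun t => Real.exp (r * t) * N t) (Icc 0 T) := fun r =>
    (by fun_prop : Continuous fun t => Real.exp (r * t)).continuousOn.mul
      fun t ht => (hN t ht).continuousWithinAt
  have hder : ∀ r, ∀ t ∈ interior (Icc 0 T), HasDerivAt (fun t => Real.exp (r * t) * N t)
      (Real.exp (r * t) * (r * N t + N' t)) t := fun r t ht =>
    ((hexp r t).mul (hint t ht).1).congr_deriv (by ring)
  -- A zero of N ≥ 0 propagates to later times because exp(−Kt) N decreases, and to earlier times
  -- because exp(Kt) N increases.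
  have hanti : AntitoneOn (fun t => Real.exp (-K * t) * N t) (Icc 0 T) := by
    refine antitoneOn_of_deriv_nonpos (convex_Icc 0 T) (hcont _)
      (fun t ht => (hder _ t ht).differentiableAt.differentiableWithinAt) fun t ht => ?_
    rw [(hder _ t ht).deriv]
    have := (abs_le.1 (hint t ht).2).2
    exact mul_nonpos_of_nonneg_of_nonpos (Real.exp_pos _).le (by linarith)
  have hmono : MonotoneOn (fun t => Real.exp (K * t) * N t) (Icc 0 T) := by
    refine monotoneOn_of_deriv_nonneg (convex_Icc 0 T) (hcont _)
      (fun t ht => (hder _ t ht).differentiableAt.differentiableWithinAt) fun t ht => ?_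
    rw [(hder _ t ht).deriv]
    have := (abs_le.1 (hint t ht).2).1
    exact mul_nonneg (Real.exp_pos _).le (by linarith)
  intro t ht
  rcases le_total t₀ t with h | h
  · have := hanti ht₀ ht h
    simp only [hz, mul_zero] at this
    exact le_antisymm (nonpos_of_mul_nonpos_right this (Real.exp_pos _)) (h0 t)
  · have := hmono ht ht₀ h
    simp only [hz, mul_zero] at this
    exact le_antisymm (nonpos_of_mul_nonpos_right this (Real.exp_pos _)) (h0 t)

/-- Integrating an estimate of vanishing order. -/
theorem abs_le_of_abs_deriv_le {T M t₀ : ℝ} {k : ℕ} {f f' : ℝ → ℝ}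
    (hf : ∀ t ∈ Icc 0 T, HasDerivWithinAt f (f' t) (Icc 0 T) t) (ht₀ : t₀ ∈ Icc 0 T)
    (hz : f t₀ = 0) (hM : 0 ≤ M) (hb : ∀ t ∈ Icc 0 T, |f' t| ≤ M * |t - t₀| ^ k) :
    ∀ t ∈ Icc 0 T, |f t| ≤ M * |t - t₀| ^ (k + 1) := by
  intro t ht
  have hsub : uIcc t₀ t ⊆ Icc 0 T := uIcc_subset_Icc ht₀ ht
  have := (convex_uIcc t₀ t).norm_image_sub_le_of_norm_hasDerivWithin_le (f := f) (f' := f')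
    (C := M * |t - t₀| ^ k) (fun s hs => (hf s (hsub hs)).mono hsub) (fun s hs => ?_)
    left_mem_uIcc right_mem_uIcc
  · rw [hz, sub_zero, Real.norm_eq_abs, Real.norm_eq_abs] at this
    calc _ ≤ _ := this
      _ = _ := by ring
  · refine (hb s (hsub hs)).trans (mul_le_mul_of_nonneg_left ?_ hM)
    exact pow_le_pow_left₀ (abs_nonneg _) (abs_sub_left_of_mem_uIcc hs) k

end ScalarEstimates

/-! ### Order of vanishing of fields, and unique continuation for the Jacobi equation. -/

section FieldEstimates

variable {n : ℕ} {Q : Type*} [TopologicalSpace Q] [ChartedSpace (EuclideanSpace ℝ (Fin n)) Q]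
  [IsManifold (𝓡 n) ∞ Q] [RiemannianBundle (fun x : Q => TangentSpace (𝓡 n) x)]
  [IsContMDiffRiemannianBundle (𝓡 n) ∞ (EuclideanSpace ℝ (Fin n))
    (fun x : Q => TangentSpace (𝓡 n) x)]

local notation "𝔼" => EuclideanSpace ℝ (Fin n)

variable {T t : ℝ} {γ : ℝ → Q} {x : Q} {X Z : ∀ t, TangentSpace (𝓡 n) (γ t)} {V : Q → ℝ}

theorem metricAt_self (p : Q) (v : TangentSpace (𝓡 n) p) : metricAt p v v = ‖v‖ ^ 2 :=
  real_inner_self_eq_norm_sq v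

theorem abs_metricAt_le (p : Q) (v w : TangentSpace (𝓡 n) p) : |metricAt p v w| ≤ ‖v‖ * ‖w‖ :=
  abs_real_inner_le_norm v w

theorem metricAt_comm (p : Q) (v w : TangentSpace (𝓡 n) p) : metricAt p v w = metricAt p w v :=
  real_inner_comm w v

/-- The inner product of the `i`-th and `j`-th covariant derivatives. -/
def jetInner (T : ℝ) (γ : ℝ → Q) (X Z : ∀ t, TangentSpace (𝓡 n) (γ t)) (i j : ℕ) (t : ℝ) : ℝ :=
  metricAt (γ t) ((covDeriv T γ)^[i] X t) ((covDeriv T γ)^[j] Z t)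

theorem hasDerivWithinAt_jetInner (hT : 0 < T) (hγ : ContMDiffOn 𝓘(ℝ, ℝ) (𝓡 n) ∞ γ (Icc 0 T))
    (hX : IsSmoothField T γ X) (hZ : IsSmoothField T γ Z) (i j : ℕ) (ht : t ∈ Icc 0 T) :
    HasDerivWithinAt (jetInner T γ X Z i j)
      (jetInner T γ X Z (i + 1) j t + jetInner T γ X Z i (j + 1) t) (Icc 0 T) t := by
  have := hasDerivWithinAt_metricAt hγ (hX.covDeriv_iterate hT hγ i)
    (hZ.covDeriv_iterate hT hγ j) ht
  simp only [jetInner, Function.iterate_succ_apply']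
  exact this

theorem contDiffOn_jetInner (hT : 0 < T) (hγ : ContMDiffOn 𝓘(ℝ, ℝ) (𝓡 n) ∞ γ (Icc 0 T))
    (hX : IsSmoothField T γ X) (hZ : IsSmoothField T γ Z) (i j : ℕ) :
    ContDiffOn ℝ ∞ (jetInner T γ X Z i j) (Icc 0 T) :=
  contDiffOn_metricAt hγ (hX.covDeriv_iterate hT hγ i) (hZ.covDeriv_iterate hT hγ j)

/-- The norm of a smooth field is bounded. -/
theorem IsSmoothField.exists_norm_le (hX : IsSmoothField T γ X)
    (hγ : ContMDiffOn 𝓘(ℝ, ℝ) (𝓡 n) ∞ γ (Icc 0 T)) : ∃ M ≥ 0, ∀ t ∈ Icc 0 T, ‖X t‖ ≤ M := by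
  obtain ⟨M, hM⟩ := isCompact_Icc.exists_bound_of_continuousOn
    (contDiffOn_metricAt hγ hX hX).continuousOn
  refine ⟨Real.sqrt (max M 0), Real.sqrt_nonneg _, fun t ht => ?_⟩
  refine Real.le_sqrt_of_sq_le ?_
  rw [← metricAt_self]
  exact (le_abs_self _).trans ((hM t ht).trans (le_max_left _ _))

/-- A field vanishing together with its covariant derivative at `t₀` is `O(|t - t₀|²)`. -/
theorem IsSmoothField.exists_norm_le_sq (hX : IsSmoothField T γ X) (hT : 0 < T)
    (hγ : ContMDiffOn 𝓘(ℝ, ℝ) (𝓡 n) ∞ γ (Icc 0 T)) {t₀ : ℝ} (ht₀ : t₀ ∈ Icc 0 T)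
    (h0 : X t₀ = 0) (h1 : ObstacleAvoidance.covDeriv T γ X t₀ = 0) :
    ∃ M ≥ 0, ∀ t ∈ Icc 0 T, ‖X t‖ ≤ M * |t - t₀| ^ 2 ∧
      ‖ObstacleAvoidance.covDeriv T γ X t‖ ≤ M * |t - t₀| := by
  have hd := fun i j => fun t (ht : t ∈ Icc 0 T) => hasDerivWithinAt_jetInner hT hγ hX hX i j ht
  have hz0 : ∀ j, jetInner T γ X X 0 j t₀ = 0 := fun j => by
    simp only [jetInner, Function.iterate_zero, id_eq, h0]; exact inner_zero_left _
  have hz1 : ∀ j, jetInner T γ X X 1 j t₀ = 0 := fun j => by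
    simp only [jetInner, Function.iterate_one, h1]; exact inner_zero_left _
  have hb : ∃ M ≥ 0, ∀ t ∈ Icc 0 T, |jetInner T γ X X 2 2 t| ≤ M ∧ |jetInner T γ X X 1 3 t| ≤ M ∧
      |jetInner T γ X X 0 4 t| ≤ M := by
    have hc := fun i j => isCompact_Icc.exists_bound_of_continuousOn
      (contDiffOn_jetInner hT hγ hX hX i j).continuousOn
    obtain ⟨a, ha⟩ := hc 2 2
    obtain ⟨b, hb⟩ := hc 1 3
    obtain ⟨c, hc⟩ := hc 0 4
    refine ⟨max 0 (max a (max b c)), le_max_left _ _, fun t ht => ⟨?_, ?_, ?_⟩⟩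
    · exact (ha t ht).trans (by simp)
    · exact (hb t ht).trans (by simp)
    · exact (hc t ht).trans (by simp)
  obtain ⟨M, hM, hb⟩ := hb
  -- Norms need not be differentiable at zeros, so the smooth functions ⟨DⁱX, DʲX⟩ are estimated
  -- instead. Each integration raises the order of vanishing at t₀ by one: order 1 for (1,2) and
  -- (0,3), order 2 for (1,1) and (0,2), order 3 for (0,1), order 4 for (0,0). Square roots of the
  -- bounds for (0,0) and (1,1) give the result.
  have a12 := abs_le_of_abs_deriv_le (M := 2 * M) (k := 0) (hd 1 2) ht₀ (hz1 2) (by positivity)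
    fun t ht => (abs_add_le _ _).trans (by simp only [pow_zero]; linarith [(hb t ht).1, (hb t ht).2.1])
  have e : ∀ i j t, jetInner T γ X X i j t = jetInner T γ X X j i t := fun i j t =>
    metricAt_comm _ _ _
  have a11 := abs_le_of_abs_deriv_le (M := 4 * M) (hd 1 1) ht₀ (hz1 1) (by positivity)
    fun t ht => (abs_add_le _ _).trans (by rw [e 2 1]; linarith [a12 t ht])
  have a03 := abs_le_of_abs_deriv_le (M := 2 * M) (k := 0) (hd 0 3) ht₀ (hz0 3) (by positivity)
    fun t ht => (abs_add_le _ _).trans (by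
      simp only [pow_zero, zero_add]; linarith [(hb t ht).2.2, (hb t ht).2.1])
  have a02 := abs_le_of_abs_deriv_le (M := 4 * M) (hd 0 2) ht₀ (hz0 2) (by positivity)
    fun t ht => (abs_add_le _ _).trans (by rw [zero_add]; linarith [a12 t ht, a03 t ht])
  have a01 := abs_le_of_abs_deriv_le (M := 8 * M) (hd 0 1) ht₀ (hz0 1) (by positivity)
    fun t ht => (abs_add_le _ _).trans (by rw [zero_add]; linarith [a11 t ht, a02 t ht])
  have a00 := abs_le_of_abs_deriv_le (M := 16 * M) (hd 0 0) ht₀ (hz0 0) (by positivity)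
    fun t ht => (abs_add_le _ _).trans (by rw [zero_add, e 1 0]; linarith [a01 t ht])
  refine ⟨Real.sqrt (16 * M), Real.sqrt_nonneg _, fun t ht => ⟨?_, ?_⟩⟩
  · refine abs_le_of_sq_le_sq' ?_ (by positivity) |>.2
    rw [mul_pow, Real.sq_sqrt (by positivity), ← metricAt_self, ← pow_mul]
    exact (le_abs_self _).trans (a00 t ht)
  · refine abs_le_of_sq_le_sq' ?_ (by positivity) |>.2
    rw [mul_pow, Real.sq_sqrt (by positivity), ← metricAt_self]
    refine (le_abs_self _).trans ((a11 t ht).trans ?_)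
    exact mul_le_mul_of_nonneg_right (by linarith) (by positivity)

/-- A field solving the Jacobi equation vanishes if its third order jet vanishes at one point. -/
theorem IsSmoothField.eq_zero_of_jacobi (hX : IsSmoothField T γ X)
    (hV : ContMDiff (𝓡 n) 𝓘(ℝ, ℝ) ∞ V) (hT : 0 < T)
    (hγ : ContMDiffOn 𝓘(ℝ, ℝ) (𝓡 n) ∞ γ (Icc 0 T))
    (hJ : ∀ t ∈ Icc 0 T, (ObstacleAvoidance.covDeriv T γ)^[4] X t
      + jacobiAt V T γ t (X t) (ObstacleAvoidance.covDeriv T γ X t)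
        ((ObstacleAvoidance.covDeriv T γ)^[2] X t) = 0) {t₀ : ℝ} (ht₀ : t₀ ∈ Icc 0 T)
    (h0 : ∀ i < 4, (ObstacleAvoidance.covDeriv T γ)^[i] X t₀ = 0) : ∀ t ∈ Icc 0 T, X t = 0 := by
  obtain ⟨K, hK, hb⟩ := exists_norm_jacobiAt_le (T := T) hV hT hγ
  let x : ℕ → ℝ → ℝ := fun i t => ‖(ObstacleAvoidance.covDeriv T γ)^[i] X t‖
  have hx : ∀ i t, 0 ≤ x i t := fun i t => norm_nonneg _
  -- N is the squared norm of the 3-jet. Its derivative pairs consecutive covariant derivatives, and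
  -- the equation bounds the fourth one by K times the sum of the first three norms, so |N'| ≤ 8(1 +
  -- K) N, a constant that is generous.
  let N : ℝ → ℝ := fun t => ∑ i ∈ Finset.range 4, jetInner T γ X X i i t
  have hNx : ∀ t, N t = ∑ i ∈ Finset.range 4, x i t ^ 2 := fun t =>
    Finset.sum_congr rfl fun i _ => metricAt_self _ _
  have hx4 : ∀ t ∈ Icc 0 T, x 4 t ≤ K * (x 0 t + x 1 t + x 2 t) := by
    intro t ht
    have := hb t ht (X t) (ObstacleAvoidance.covDeriv T γ X t)
      ((ObstacleAvoidance.covDeriv T γ)^[2] X t)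
    rw [← norm_neg, ← eq_neg_of_add_eq_zero_left (hJ t ht)] at this
    exact this
  have hzero := eq_zero_of_abs_deriv_le (N := N) (K := 8 * (1 + K)) (t₀ := t₀)
    (fun t ht => HasDerivWithinAt.fun_sum fun i _ => hasDerivWithinAt_jetInner hT hγ hX hX i i ht)
    (fun t => by rw [hNx]; positivity) (fun t ht => ?_) ht₀ ?_
  · intro t ht
    have h := hzero t ht
    rw [hNx, Finset.sum_eq_zero_iff_of_nonneg (fun i _ => by positivity)] at h
    exact norm_eq_zero.1 (pow_eq_zero_iff (two_ne_zero) |>.1 (h 0 (by simp)))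
  · have hin : ∀ i j, |jetInner T γ X X i j t| ≤ x i t * x j t := fun i j => abs_metricAt_le _ _ _
    rw [hNx]
    simp only [Finset.sum_range_succ, Finset.sum_range_zero, zero_add]
    have h4 := hx4 t ht
    have t3 : x 3 t * x 4 t ≤ x 3 t * (K * (x 0 t + x 1 t + x 2 t)) :=
      mul_le_mul_of_nonneg_left h4 (hx 3 t)
    have hs : |jetInner T γ X X (0 + 1) 0 t + jetInner T γ X X 0 (0 + 1) t
        + (jetInner T γ X X (1 + 1) 1 t + jetInner T γ X X 1 (1 + 1) t)
        + (jetInner T γ X X (2 + 1) 2 t + jetInner T γ X X 2 (2 + 1) t)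
        + (jetInner T γ X X (3 + 1) 3 t + jetInner T γ X X 3 (3 + 1) t)|
        ≤ 2 * (x 0 t * x 1 t + x 1 t * x 2 t + x 2 t * x 3 t + x 3 t * x 4 t) := by
      have a1 := abs_le.1 (hin 1 0)
      have a2 := abs_le.1 (hin 0 1)
      have a3 := abs_le.1 (hin 2 1)
      have a4 := abs_le.1 (hin 1 2)
      have a5 := abs_le.1 (hin 3 2)
      have a6 := abs_le.1 (hin 2 3)
      have a7 := abs_le.1 (hin 4 3)
      have a8 := abs_le.1 (hin 3 4)
      norm_num only at *
      rw [abs_le]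
      constructor <;> linarith
    simp only [zero_add] at hs ⊢
    refine hs.trans ?_
    have q : ∀ a b : ℝ, 2 * (a * b) ≤ a ^ 2 + b ^ 2 := fun a b => by nlinarith [sq_nonneg (a - b)]
    have r : x 3 t * (K * (x 0 t + x 1 t + x 2 t)) ≤ K * (2 * x 3 t ^ 2 + x 0 t ^ 2 + x 1 t ^ 2
        + x 2 t ^ 2) := by
      rw [mul_left_comm]
      refine mul_le_mul_of_nonneg_left ?_ hK
      linarith [q (x 3 t) (x 0 t), q (x 3 t) (x 1 t), q (x 3 t) (x 2 t), sq_nonneg (x 3 t),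
        sq_nonneg (x 0 t), sq_nonneg (x 1 t), sq_nonneg (x 2 t)]
    have p0 := mul_nonneg hK (sq_nonneg (x 0 t))
    have p1 := mul_nonneg hK (sq_nonneg (x 1 t))
    have p2 := mul_nonneg hK (sq_nonneg (x 2 t))
    have p3 := mul_nonneg hK (sq_nonneg (x 3 t))
    linarith [q (x 0 t) (x 1 t), q (x 1 t) (x 2 t), q (x 2 t) (x 3 t), sq_nonneg (x 3 t),
        sq_nonneg (x 0 t), sq_nonneg (x 1 t), sq_nonneg (x 2 t)]
  · rw [hNx]
    refine Finset.sum_eq_zero fun i hi => ?_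
    simp only [x, h0 i (Finset.mem_range.1 hi), norm_zero]
    norm_num

end FieldEstimates

/-! ### Curves as lines in a parameter space mapped into a chart. -/

section ChartLift

variable {n : ℕ} {Q : Type*} [TopologicalSpace Q] [ChartedSpace (EuclideanSpace ℝ (Fin n)) Q]
  [IsManifold (𝓡 n) ∞ Q] [RiemannianBundle (fun x : Q => TangentSpace (𝓡 n) x)]
  {P : Type*} [NormedAddCommGroup P] [NormedSpace ℝ P]

local notation "𝔼" => EuclideanSpace ℝ (Fin n)

/-- A smooth map `c` into the chart at `x` which represents the curve `q` on the line
`t ↦ p₀ + t • e`, for `t` in the open set `J`. -/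
structure IsChartLift (T : ℝ) (q : ℝ → Q) (x : Q) (c : P → 𝔼) (O : Set P) (p₀ e : P)
    (J : Set ℝ) : Prop where
  into : IsSmoothInto c O (extChartAt (𝓡 n) x).target
  isOpen : IsOpen J
  subset : J ⊆ Ioo 0 T
  mem : ∀ t ∈ J, p₀ + t • e ∈ O
  source : ∀ t ∈ J, q t ∈ (extChartAt (𝓡 n) x).source
  eq : ∀ t ∈ J, c (p₀ + t • e) = extChartAt (𝓡 n) x (q t)

variable {T : ℝ} {q : ℝ → Q} {x : Q} {c : P → EuclideanSpace ℝ (Fin n)} {O : Set P} {p₀ e : P} {J : Set ℝ}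
  {X Z : ∀ t, TangentSpace (𝓡 n) (q t)} {V : Q → ℝ} {t : ℝ}

namespace IsChartLift

theorem mem_Icc (h : IsChartLift T q x c O p₀ e J) (ht : t ∈ J) : t ∈ Icc 0 T :=
  Ioo_subset_Icc_self (h.subset ht)

theorem Icc_mem_nhds (h : IsChartLift T q x c O p₀ e J) (ht : t ∈ J) : Icc 0 T ∈ 𝓝 t :=
  _root_.Icc_mem_nhds (h.subset ht).1 (h.subset ht).2

theorem fderiv_line (h : IsChartLift T q x c O p₀ e J) {F : Type*} [NormedAddCommGroup F]
    [NormedSpace ℝ F] {W : P → F} {f : ℝ → F} (hW : ContDiffOn ℝ ∞ W O)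
    (hWf : ∀ t ∈ J, W (p₀ + t • e) = f t) (ht : t ∈ J) :
    HasDerivAt f (fderiv ℝ W (p₀ + t • e) e) t := by
  have h1 := (ContDiffOn.differentiableAt_of_isOpen hW h.into.isOpen (h.mem t ht)).hasFDerivAt
  have h2 : HasDerivAt (fun t : ℝ => p₀ + t • e) e t := by
    simpa using ((hasDerivAt_id t).smul_const e).const_add p₀
  refine (h1.comp_hasDerivAt t h2).congr_of_eventuallyEq ?_
  filter_upwards [h.isOpen.mem_nhds ht] with s hs
  exact (hWf s hs).symm

theorem fderiv_curve (h : IsChartLift T q x c O p₀ e J)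
    (hq : ContMDiffOn 𝓘(ℝ, ℝ) (𝓡 n) ∞ q (Icc 0 T)) (ht : t ∈ J) :
    fderiv ℝ c (p₀ + t • e) e = coord x q (velocity T q) t :=
  (h.fderiv_line h.into.smooth h.eq ht).unique
    ((hasDerivWithinAt_chart (mdifferentiableWithinAt_of_contMDiffOn hq (h.mem_Icc ht))
      (h.mem_Icc ht) (h.source t ht)).hasDerivAt (h.Icc_mem_nhds ht))

variable [IsContMDiffRiemannianBundle (𝓡 n) ∞ (EuclideanSpace ℝ (Fin n))
    (fun x : Q => TangentSpace (𝓡 n) x)]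

/-- The derivative of W in the direction of the line depends only on the values of W on the line.
Since J lies in the open interval, the derivatives within [0, T] are there ordinary derivatives. -/
theorem vcov_line (h : IsChartLift T q x c O p₀ e J)
    (hq : ContMDiffOn 𝓘(ℝ, ℝ) (𝓡 n) ∞ q (Icc 0 T)) (hX : IsSmoothField T q X) {W : P → 𝔼}
    (hW : ContDiffOn ℝ ∞ W O) (hWX : ∀ t ∈ J, W (p₀ + t • e) = coord x q X t) (ht : t ∈ J) :
    vcov (christoffelL x) c e W (p₀ + t • e) = coord x q (covDeriv T q X) t := by
  have h1 := (h.fderiv_line hW hWX ht).unique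
    ((hX.hasDerivWithinAt_coord hq (h.mem_Icc ht) (h.source t ht)).hasDerivAt (h.Icc_mem_nhds ht))
  rw [vcov_apply, h1, h.fderiv_curve hq ht, h.eq t ht, hWX t ht]
  abel

theorem vcov_iterate_line (h : IsChartLift T q x c O p₀ e J) (hT : 0 < T)
    (hq : ContMDiffOn 𝓘(ℝ, ℝ) (𝓡 n) ∞ q (Icc 0 T)) (hX : IsSmoothField T q X) {W : P → 𝔼}
    (hW : ContDiffOn ℝ ∞ W O) (hWX : ∀ t ∈ J, W (p₀ + t • e) = coord x q X t) (k : ℕ) :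
    ∀ t ∈ J, (vcov (christoffelL x) c e)^[k] W (p₀ + t • e)
      = coord x q ((covDeriv T q)^[k] X) t := by
  induction k with
  | zero => exact hWX
  | succ k ih =>
    intro t ht
    rw [Function.iterate_succ_apply', Function.iterate_succ_apply']
    exact h.vcov_line hq (hX.covDeriv_iterate hT hq k)
      ((isLeviCivitaOn_chart x).contDiffOn_vcov_iterate h.into hW e k) ih ht

theorem jacobiL_line (h : IsChartLift T q x c O p₀ e J) (hV : ContMDiff (𝓡 n) 𝓘(ℝ, ℝ) ∞ V)
    (hT : 0 < T)
    (hq : ContMDiffOn 𝓘(ℝ, ℝ) (𝓡 n) ∞ q (Icc 0 T)) (hX : IsSmoothField T q X) {W : P → 𝔼}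
    (hW : ContDiffOn ℝ ∞ W O) (hWX : ∀ t ∈ J, W (p₀ + t • e) = coord x q X t) (ht : t ∈ J) :
    jacobiL (christoffelL x) (chartGrad V x) c e W (p₀ + t • e)
      = coord x q (fun t => (covDeriv T q)^[4] X t + jacobiAt V T q t (X t) (covDeriv T q X t)
        ((covDeriv T q)^[2] X t)) t := by
  have hY : ContDiffOn ℝ ∞ (fun p => fderiv ℝ c p e) O :=
    IsLeviCivitaOn.contDiffOn_partial h.into e
  have hv := isSmoothField_velocity hT hq
  have k := fun i => h.vcov_iterate_line hT hq hX hW hWX i t ht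
  have l := fun i => h.vcov_iterate_line hT hq hv hY (fun t ht => h.fderiv_curve hq ht) i t ht
  have k1 := k 1
  have l1 := l 1
  rw [Function.iterate_one, Function.iterate_one] at k1 l1
  rw [coord_add ((covDeriv T q)^[4] X), coord_jacobiAt hV (h.source t ht), jacobiOp_apply,
    ← add_assoc, jacobiL, k 4, k 2, l 2, k1, l1, h.fderiv_curve hq ht, hWX t ht, h.eq t ht]

theorem eulerL_line (h : IsChartLift T q x c O p₀ e J) (hV : ContMDiff (𝓡 n) 𝓘(ℝ, ℝ) ∞ V)
    (hT : 0 < T) (hq : IsModifiedCubic (n := n) V T q) (ht : t ∈ J) :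
    eulerL (christoffelL x) (chartGrad V x) c e (p₀ + t • e) = 0 := by
  have hY : ContDiffOn ℝ ∞ (fun p => fderiv ℝ c p e) O :=
    IsLeviCivitaOn.contDiffOn_partial h.into e
  have hv := isSmoothField_velocity hT hq.1
  have l := fun i => h.vcov_iterate_line hT hq.1 hv hY (fun t ht => h.fderiv_curve hq.1 ht) i t ht
  have l1 := l 1
  rw [Function.iterate_one, Function.iterate_one] at l1
  rw [eulerL, l 3, l1, h.fderiv_curve hq.1 ht, h.eq t ht, ← coord_curv (h.source t ht),
    ← coord_grad hV (h.source t ht), ← coord_add, ← coord_add]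
  exact (congrArg (rep x (q t)) (hq.2 t (h.mem_Icc ht))).trans (map_zero (rep x (q t)))

theorem lagrangian_line (h : IsChartLift T q x c O p₀ e J) (hT : 0 < T)
    (hq : ContMDiffOn 𝓘(ℝ, ℝ) (𝓡 n) ∞ q (Icc 0 T)) (ht : t ∈ J) :
    lagrangian (chartMetric x) (christoffelL x) (V ∘ (extChartAt (𝓡 n) x).symm) c e (p₀ + t • e)
      = (1 / 2) * ‖covDeriv (n := n) T q (velocity T q) t‖ ^ 2 + V (q t) := by
  have hY : ContDiffOn ℝ ∞ (fun p => fderiv ℝ c p e) O :=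
    IsLeviCivitaOn.contDiffOn_partial h.into e
  have hv := isSmoothField_velocity hT hq
  have l := h.vcov_line hq hv hY (fun t ht => h.fderiv_curve hq ht) ht
  rw [lagrangian, l, h.eq t ht, Function.comp_apply, (extChartAt (𝓡 n) x).left_inv (h.source t ht),
    ← metricAt_self, ← chartMetric_rep (h.source t ht)]
  rfl

/-- The second variation along a modified cubic polynomial. -/
theorem second_variation (h : IsChartLift T q x c O p₀ e J) (hV : ContMDiff (𝓡 n) 𝓘(ℝ, ℝ) ∞ V)
    (hT : 0 < T) (hq : IsModifiedCubic (n := n) V T q)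
    (hZ : IsSmoothField T q Z) {r s : P}
    (hr : ∀ t ∈ J, fderiv ℝ c (p₀ + t • e) r = coord x q Z t)
    (hs : ∀ t ∈ J, fderiv ℝ c (p₀ + t • e) s = coord x q X t) (ht : t ∈ J) :
    HasDerivAt (fun t => fderiv ℝ (boundaryL (chartMetric x) (christoffelL x) c e s)
        (p₀ + t • e) r)
      (fderiv ℝ (fun p => fderiv ℝ (lagrangian (chartMetric x) (christoffelL x)
        (V ∘ (extChartAt (𝓡 n) x).symm) c e) p s) (p₀ + t • e) r
        - metricAt (q t) ((covDeriv T q)^[4] Z t + jacobiAt V T q t (Z t) (covDeriv T q Z t)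
          ((covDeriv T q)^[2] Z t)) (X t)) t := by
  have hl := isLeviCivitaOn_chart (n := n) x
  have hr' : ContDiffOn ℝ ∞ (fun p => fderiv ℝ c p r) O :=
    IsLeviCivitaOn.contDiffOn_partial h.into r
  have e1 := hl.fderiv_fderiv_lagrangian h.into (contDiffOn_potential hV x)
    (contDiffOn_chartGrad hV x) (chartMetric_chartGrad V x) e s r (h.mem t ht)
  -- The Euler-Lagrange expression vanishes along q, which removes the term with the covariant
  -- derivative of the variation field. The second variation thus depends only on the first order
  -- part of the variation.
  rw [h.jacobiL_line hV hT hq.1 hZ hr' hr ht, h.eulerL_line hV hT hq ht, hs t ht, h.eq t ht, map_zero,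
    zero_apply, add_zero] at e1
  have e2 := chartMetric_rep (h.source t ht) ((covDeriv T q)^[4] Z t + jacobiAt V T q t (Z t)
    (covDeriv T q Z t) ((covDeriv T q)^[2] Z t)) (X t)
  have hB : ContDiffOn ℝ ∞ (fun p => fderiv ℝ (boundaryL (chartMetric x) (christoffelL x) c e s)
    p r) O := contDiffOn_fderiv_apply h.into.isOpen le_rfl (hl.contDiffOn_boundaryL h.into e s) r
  refine (h.fderiv_line hB (fun _ _ => rfl) ht).congr_deriv ?_
  rw [e1, ← e2]
  exact (add_sub_cancel_left _ _).symm

end IsChartLift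

end ChartLift

/-! ### The index form: locality, quadratic expansion and integration by parts. -/

section IndexForm

variable {n : ℕ} {Q : Type*} [TopologicalSpace Q] [ChartedSpace (EuclideanSpace ℝ (Fin n)) Q]
  [IsManifold (𝓡 n) ∞ Q] [RiemannianBundle (fun x : Q => TangentSpace (𝓡 n) x)]
  [IsContMDiffRiemannianBundle (𝓡 n) ∞ (EuclideanSpace ℝ (Fin n))
    (fun x : Q => TangentSpace (𝓡 n) x)]

local notation "𝔼" => EuclideanSpace ℝ (Fin n)

variable {T t : ℝ} {q : ℝ → Q} {X X' Y Z : ∀ t, TangentSpace (𝓡 n) (q t)} {V : Q → ℝ}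

theorem covDeriv_congr (h : ∀ᶠ s in 𝓝[Icc 0 T] t, X s = X' s) (ht : t ∈ Icc 0 T) :
    covDeriv T q X t = covDeriv T q X' t := by
  refine coord_injective ?_
  have e : coord (q t) q X =ᶠ[𝓝[Icc 0 T] t] coord (q t) q X' := by
    filter_upwards [h] with s hs
    exact congrArg (rep (q t) (q s)) hs
  have h1 := coord_covDeriv_self (T := T) X t
  have h2 := coord_covDeriv_self (T := T) X' t
  rw [e.derivWithin_eq_of_mem ht, e.eq_of_nhdsWithin ht] at h1
  exact h1.trans h2.symm

theorem covDeriv_zero (t : ℝ) : covDeriv T q (fun t => (0 : TangentSpace (𝓡 n) (q t))) t = 0 := by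
  refine coord_injective ?_
  have h1 := coord_covDeriv_self (T := T) (fun t => (0 : TangentSpace (𝓡 n) (q t))) t
  have e : coord (q t) q (fun t => (0 : TangentSpace (𝓡 n) (q t))) = fun _ => 0 :=
    funext fun s => map_zero (rep (q t) (q s))
  rw [e] at h1
  simp only [derivWithin_fun_const, Pi.zero_apply, map_zero, add_zero] at h1
  exact h1.trans (map_zero (rep (q t) (q t))).symm

/-- Covariant differentiation is local and the complement of the closed set S is open, so
derivatives vanish wherever the field does off S. -/
theorem covDeriv_iterate_eq_zero {S : Set ℝ} (hS : IsClosed S)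
    (h : ∀ t ∈ Icc 0 T, t ∉ S → X t = 0) (k : ℕ) :
    ∀ t ∈ Icc 0 T, t ∉ S → (covDeriv T q)^[k] X t = 0 := by
  induction k with
  | zero => exact h
  | succ k ih =>
    intro t ht htS
    rw [Function.iterate_succ_apply', ← covDeriv_zero t]
    refine covDeriv_congr ?_ ht
    filter_upwards [self_mem_nhdsWithin, mem_nhdsWithin_of_mem_nhds (hS.isOpen_compl.mem_nhds htS)]
      with s hs hsS using ih s hs hsS

theorem covDeriv_iterate_add (hT : 0 < T) (hq : ContMDiffOn 𝓘(ℝ, ℝ) (𝓡 n) ∞ q (Icc 0 T))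
    (hX : IsSmoothField T q X) (hZ : IsSmoothField T q Z) (k : ℕ) : ∀ t ∈ Icc 0 T,
      (covDeriv T q)^[k] (fun t => X t + Z t) t = (covDeriv T q)^[k] X t + (covDeriv T q)^[k] Z t := by
  induction k with
  | zero => exact fun t _ => rfl
  | succ k ih =>
    intro t ht
    simp only [Function.iterate_succ_apply']
    rw [covDeriv_congr (Filter.eventually_of_mem self_mem_nhdsWithin ih) ht]
    exact covDeriv_add hT hq (hX.covDeriv_iterate hT hq k) (hZ.covDeriv_iterate hT hq k) ht

theorem covDeriv_iterate_const_smul (hT : 0 < T) (hq : ContMDiffOn 𝓘(ℝ, ℝ) (𝓡 n) ∞ q (Icc 0 T))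
    (hX : IsSmoothField T q X) (u : ℝ) (k : ℕ) : ∀ t ∈ Icc 0 T,
      (covDeriv T q)^[k] (fun t => u • X t) t = u • (covDeriv T q)^[k] X t := by
  induction k with
  | zero => exact fun t _ => rfl
  | succ k ih =>
    intro t ht
    simp only [Function.iterate_succ_apply']
    rw [covDeriv_congr (Filter.eventually_of_mem self_mem_nhdsWithin ih) ht]
    have := covDeriv_smul (φ := fun _ => u) (φ' := fun _ => 0) hT hq (hX.covDeriv_iterate hT hq k)
      contDiffOn_const (hasDerivWithinAt_const _ _ _) ht
    rw [zero_smul, zero_add] at this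
    exact this

theorem covDeriv_two_smul (hT : 0 < T) (hq : ContMDiffOn 𝓘(ℝ, ℝ) (𝓡 n) ∞ q (Icc 0 T))
    (hX : IsSmoothField T q X) {φ φ' φ'' : ℝ → ℝ} (hφ : ContDiff ℝ ∞ φ) (hφ' : ContDiff ℝ ∞ φ')
    (h1 : ∀ t, HasDerivAt φ (φ' t) t) (h2 : ∀ t, HasDerivAt φ' (φ'' t) t) (ht : t ∈ Icc 0 T) :
    (covDeriv T q)^[2] (fun t => φ t • X t) t
      = φ'' t • X t + (2 : ℝ) • (φ' t • covDeriv T q X t) + φ t • (covDeriv T q)^[2] X t := by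
  have hD := hX.covDeriv hT hq
  have e1 : ∀ t ∈ Icc 0 T, covDeriv T q (fun t => φ t • X t) t
      = φ' t • X t + φ t • covDeriv T q X t := fun t ht =>
    covDeriv_smul hT hq hX hφ.contDiffOn (h1 t).hasDerivWithinAt ht
  simp only [Function.iterate_succ_apply', Function.iterate_zero, id_eq]
  rw [covDeriv_congr (Filter.eventually_of_mem self_mem_nhdsWithin e1) ht,
    covDeriv_add hT hq (hX.smul hφ'.contDiffOn hq) (hD.smul hφ.contDiffOn hq) ht,
    covDeriv_smul hT hq hX hφ'.contDiffOn (h2 t).hasDerivWithinAt ht,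
    covDeriv_smul hT hq hD hφ.contDiffOn (h1 t).hasDerivWithinAt ht]
  module

/-- The Jacobi operator `D⁴X/dt⁴ + F(X, q') + ∇_X grad V`. -/
def jacobiField (V : Q → ℝ) (T : ℝ) (q : ℝ → Q) (X : ∀ t, TangentSpace (𝓡 n) (q t)) (t : ℝ) :
    TangentSpace (𝓡 n) (q t) :=
  (covDeriv T q)^[4] X t + jacobiAt V T q t (X t) (covDeriv T q X t) ((covDeriv T q)^[2] X t)

/-- The integrand of the index form. -/
def indexIntegrand (V : Q → ℝ) (T : ℝ) (q : ℝ → Q) (X Z : ∀ t, TangentSpace (𝓡 n) (q t)) (t : ℝ) :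
    ℝ :=
  jetInner T q X Z 2 2 t
    + metricAt (q t) (Z t) (jacobiAt V T q t (X t) (covDeriv T q X t) ((covDeriv T q)^[2] X t))

theorem indexForm_eq (V : Q → ℝ) (T : ℝ) (q : ℝ → Q) (X Z : ∀ t, TangentSpace (𝓡 n) (q t)) :
    indexForm V T q X Z = ∫ t in (0 : ℝ)..T, indexIntegrand V T q X Z t := rfl

theorem metricAt_add_left (p : Q) (u v w : TangentSpace (𝓡 n) p) :
    metricAt p (u + v) w = metricAt p u w + metricAt p v w := inner_add_left u v w

theorem metricAt_add_right (p : Q) (u v w : TangentSpace (𝓡 n) p) :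
    metricAt p u (v + w) = metricAt p u v + metricAt p u w := inner_add_right u v w

theorem metricAt_smul_left (p : Q) (r : ℝ) (u v : TangentSpace (𝓡 n) p) :
    metricAt p (r • u) v = r * metricAt p u v := real_inner_smul_left u v r

theorem metricAt_smul_right (p : Q) (r : ℝ) (u v : TangentSpace (𝓡 n) p) :
    metricAt p u (r • v) = r * metricAt p u v := real_inner_smul_right u v r

theorem metricAt_zero_left (p : Q) (u : TangentSpace (𝓡 n) p) : metricAt p 0 u = 0 :=
  inner_zero_left u

theorem metricAt_zero_right (p : Q) (u : TangentSpace (𝓡 n) p) : metricAt p u 0 = 0 :=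
  inner_zero_right u

theorem continuousOn_indexIntegrand (hV : ContMDiff (𝓡 n) 𝓘(ℝ, ℝ) ∞ V) (hT : 0 < T)
    (hq : ContMDiffOn 𝓘(ℝ, ℝ) (𝓡 n) ∞ q (Icc 0 T)) (hX : IsSmoothField T q X)
    (hZ : IsSmoothField T q Z) : ContinuousOn (indexIntegrand V T q X Z) (Icc 0 T) :=
  (contDiffOn_jetInner hT hq hX hZ 2 2).continuousOn.add
    (contDiffOn_metricAt hq hZ (isSmoothField_jacobiAt hV hT hq hX (hX.covDeriv hT hq)
      (hX.covDeriv_iterate hT hq 2))).continuousOn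

theorem indexIntegrand_add_smul (hV : ContMDiff (𝓡 n) 𝓘(ℝ, ℝ) ∞ V) (hT : 0 < T)
    (hq : ContMDiffOn 𝓘(ℝ, ℝ) (𝓡 n) ∞ q (Icc 0 T)) (hX : IsSmoothField T q X)
    (hZ : IsSmoothField T q Z) (u : ℝ) (ht : t ∈ Icc 0 T) :
    indexIntegrand V T q (fun t => X t + u • Z t) (fun t => X t + u • Z t) t
      = indexIntegrand V T q X X t + u * (indexIntegrand V T q X Z t + indexIntegrand V T q Z X t)
        + u ^ 2 * indexIntegrand V T q Z Z t := by
  have hZ' := hZ.smul (φ := fun _ => u) contDiffOn_const hq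
  have e : ∀ k, (covDeriv T q)^[k] (fun t => X t + u • Z t) t
      = (covDeriv T q)^[k] X t + u • (covDeriv T q)^[k] Z t := fun k => by
    rw [covDeriv_iterate_add hT hq hX hZ' k t ht, covDeriv_iterate_const_smul hT hq hZ u k t ht]
  have e1 := e 1
  simp only [Function.iterate_one] at e1
  simp only [indexIntegrand, jetInner, e, e1, jacobiAt_add hV, jacobiAt_smul hV, metricAt_add_left,
    metricAt_add_right, metricAt_smul_left, metricAt_smul_right]
  ring

/-- Both mixed terms are kept, because the symmetry of the index form is a separate and deeper fact.
-/
theorem indexForm_add_smul (hV : ContMDiff (𝓡 n) 𝓘(ℝ, ℝ) ∞ V) (hT : 0 < T)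
    (hq : ContMDiffOn 𝓘(ℝ, ℝ) (𝓡 n) ∞ q (Icc 0 T)) (hX : IsSmoothField T q X)
    (hZ : IsSmoothField T q Z) (u : ℝ) :
    indexForm V T q (fun t => X t + u • Z t) (fun t => X t + u • Z t)
      = indexForm V T q X X + u * (indexForm V T q X Z + indexForm V T q Z X)
        + u ^ 2 * indexForm V T q Z Z := by
  have hi := fun {X Z : ∀ t, TangentSpace (𝓡 n) (q t)} (hX : IsSmoothField T q X)
    (hZ : IsSmoothField T q Z) => ContinuousOn.intervalIntegrable_of_Icc (μ := MeasureTheory.volume)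
      hT.le (continuousOn_indexIntegrand hV hT hq hX hZ)
  simp only [indexForm_eq]
  rw [← intervalIntegral.integral_add (hi hX hZ) (hi hZ hX), ← intervalIntegral.integral_const_mul,
    ← intervalIntegral.integral_const_mul,
    ← intervalIntegral.integral_add (hi hX hX) (((hi hX hZ).add (hi hZ hX)).const_mul u),
    ← intervalIntegral.integral_add ((hi hX hX).add (((hi hX hZ).add (hi hZ hX)).const_mul u))
      ((hi hZ hZ).const_mul (u ^ 2))]
  refine intervalIntegral.integral_congr fun t ht => ?_
  rw [uIcc_of_le hT.le] at ht
  exact indexIntegrand_add_smul hV hT hq hX hZ u ht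

/-- Integration by parts in the index form. -/
theorem hasDerivWithinAt_index_boundary (hT : 0 < T)
    (hq : ContMDiffOn 𝓘(ℝ, ℝ) (𝓡 n) ∞ q (Icc 0 T)) (hX : IsSmoothField T q X)
    (hZ : IsSmoothField T q Z) (ht : t ∈ Icc 0 T) :
    HasDerivWithinAt (fun t => jetInner T q X Z 2 1 t - jetInner T q X Z 3 0 t)
      (indexIntegrand V T q X Z t - metricAt (q t) (jacobiField V T q X t) (Z t)) (Icc 0 T) t := by
  refine ((hasDerivWithinAt_jetInner hT hq hX hZ 2 1 ht).sub
    (hasDerivWithinAt_jetInner hT hq hX hZ 3 0 ht)).congr_deriv ?_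
  rw [indexIntegrand, jacobiField, metricAt_add_left, metricAt_comm (q t) (Z t)]
  have e : jetInner T q X Z 4 0 t = metricAt (q t) ((covDeriv T q)^[4] X t) (Z t) := rfl
  rw [← e]
  ring

theorem integral_eq_sub_of_hasDerivWithinAt {f f' : ℝ → ℝ} {a b : ℝ}
    (hf : ∀ t ∈ Icc 0 T, HasDerivWithinAt f (f' t) (Icc 0 T) t) (hf' : ContinuousOn f' (Icc 0 T))
    (ha : 0 ≤ a) (hab : a ≤ b) (hb : b ≤ T) : ∫ t in a..b, f' t = f b - f a := by
  have hsub : Icc a b ⊆ Icc 0 T := Icc_subset_Icc ha hb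
  refine intervalIntegral.integral_eq_sub_of_hasDerivAt_of_le hab
    (fun t ht => ((hf t (hsub ht)).continuousWithinAt).mono hsub) (fun t ht => ?_)
    ((hf'.mono hsub).intervalIntegrable_of_Icc hab)
  exact (hf t (hsub (Ioo_subset_Icc_self ht))).hasDerivAt
    (Icc_mem_nhds (ha.trans_lt ht.1) (ht.2.trans_le hb))

/-- For a Jacobi field the interior term of the integration by parts is zero and only boundary
values remain. This evaluates the index form against the truncation of X to [a, b] without any
computation with F. -/
theorem integral_indexIntegrand (hV : ContMDiff (𝓡 n) 𝓘(ℝ, ℝ) ∞ V) (hT : 0 < T)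
    (hq : ContMDiffOn 𝓘(ℝ, ℝ) (𝓡 n) ∞ q (Icc 0 T)) (hX : IsSmoothField T q X)
    (hZ : IsSmoothField T q Z) (hJ : ∀ t ∈ Icc 0 T, jacobiField V T q X t = 0) {a b : ℝ}
    (ha : 0 ≤ a) (hab : a ≤ b) (hb : b ≤ T) :
    ∫ t in a..b, indexIntegrand V T q X Z t
      = (jetInner T q X Z 2 1 b - jetInner T q X Z 3 0 b)
        - (jetInner T q X Z 2 1 a - jetInner T q X Z 3 0 a) := by
  refine integral_eq_sub_of_hasDerivWithinAt (T := T)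
    (f := fun t => jetInner T q X Z 2 1 t - jetInner T q X Z 3 0 t) (fun t ht => ?_)
    (continuousOn_indexIntegrand hV hT hq hX hZ) ha hab hb
  have h := hasDerivWithinAt_index_boundary (V := V) hT hq hX hZ ht
  rwa [hJ t ht, metricAt_zero_left, sub_zero] at h

end IndexForm

/-! ### Vanishing of the boundary terms where the variation is trivial. -/

section Boundary

variable {E P : Type*} [NormedAddCommGroup E] [NormedSpace ℝ E]
  [NormedAddCommGroup P] [NormedSpace ℝ P]
  {g : E → E →L[ℝ] E →L[ℝ] ℝ} {Γ : E → E →L[ℝ] E →L[ℝ] E} {U : Set E} {c : P → E}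
  {O : Set P}

theorem vcov_eq_zero (hO : IsOpen O) {W : P → E} (hW : ∀ p ∈ O, W p = 0) (e : P) :
    ∀ p ∈ O, vcov Γ c e W p = 0 := by
  intro p hp
  rw [vcov_congr (W' := fun _ => 0) hO (fun p hp => hW p hp) e hp, vcov_apply]
  simp

theorem boundaryL_eq_zero (hO : IsOpen O) {t s : P} (hs : ∀ p ∈ O, fderiv ℝ c p s = 0) :
    ∀ p ∈ O, boundaryL g Γ c t s p = 0 := by
  intro p hp
  rw [boundaryL, vcov_eq_zero hO hs t p hp, hs p hp, map_zero, map_zero, sub_zero]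

theorem IsSmoothInto.mono (hc : IsSmoothInto c O U) {O' : Set P} (hO' : IsOpen O') (h : O' ⊆ O) :
    IsSmoothInto c O' U := ⟨hO', hc.smooth.mono h, hc.mapsTo.mono_left h⟩

namespace IsLeviCivitaOn

/-- In the commutator of D_r and D_t the curvature term contains ∂_r c = 0, so being parallel in the
direction r is inherited by D_t W. -/
theorem vcov_vcov_eq_zero (h : IsLeviCivitaOn g Γ U) (hc : IsSmoothInto c O U) {r t : P}
    (hr : ∀ p ∈ O, fderiv ℝ c p r = 0) {W : P → E} (hW : ContDiffOn ℝ ∞ W O)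
    (hWr : ∀ p ∈ O, vcov Γ c r W p = 0) : ∀ p ∈ O, vcov Γ c r (vcov Γ c t W) p = 0 := by
  intro p hp
  rw [vcov_vcov hc.isOpen h.isOpen h.smooth hc.smooth hc.mapsTo hW r t hp,
    vcov_eq_zero hc.isOpen hWr t p hp, hr p hp, map_zero, zero_apply, zero_apply, add_zero]

/-- When c does not vary in the direction r, all the fields that enter the boundary term are
parallel in that direction, so their inner products are constant in it. -/
theorem fderiv_boundaryL_eq_zero (h : IsLeviCivitaOn g Γ U) (hc : IsSmoothInto c O U) {r t s : P}
    (hr : ∀ p ∈ O, fderiv ℝ c p r = 0) : ∀ p ∈ O, fderiv ℝ (boundaryL g Γ c t s) p r = 0 := by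
  have hp := fun e => contDiffOn_partial hc e
  have h0 : ∀ e, ∀ p ∈ O, vcov Γ c r (fun p => fderiv ℝ c p e) p = 0 := fun e p hp => by
    rw [h.vcov_partial hc r e hp, vcov_eq_zero hc.isOpen hr e p hp]
  have h1 := fun e => h.vcov_vcov_eq_zero hc (t := t) hr (hp e) (h0 e)
  have h2 := h.vcov_vcov_eq_zero hc (t := t) hr (h.contDiffOn_vcov hc (hp t) t) (h1 t)
  intro p hpO
  have hd := fun {f : P → ℝ} (hf : ContDiffOn ℝ ∞ f O) =>
    ContDiffOn.differentiableAt_of_isOpen hf hc.isOpen hpO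
  have e1 := h.contDiffOn_metric hc (h.contDiffOn_vcov hc (hp t) t) (h.contDiffOn_vcov hc (hp s) t)
  have e2 := h.contDiffOn_metric hc (h.contDiffOn_vcov_iterate hc (hp t) t 2) (hp s)
  have e3 := h.fderiv_metric' hc (h.contDiffOn_vcov hc (hp t) t) (h.contDiffOn_vcov hc (hp s) t) r hpO
  have e4 := h.fderiv_metric' hc (h.contDiffOn_vcov_iterate hc (hp t) t 2) (hp s) r hpO
  have e5 : vcov Γ c r ((vcov Γ c t)^[2] (fun p => fderiv ℝ c p t)) p = 0 := h2 p hpO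
  rw [h1 t p hpO, h1 s p hpO] at e3
  rw [e5, h0 s p hpO] at e4
  have e6 := fderiv_fun_sub (hd e1) (hd e2)
  rw [show boundaryL g Γ c t s = fun p => g (c p) (vcov Γ c t (fun p => fderiv ℝ c p t) p)
      (vcov Γ c t (fun p => fderiv ℝ c p s) p)
    - g (c p) ((vcov Γ c t)^[2] (fun p => fderiv ℝ c p t) p) (fderiv ℝ c p s) from rfl, e6,
    sub_apply, e3, e4]
  simp

end IsLeviCivitaOn

end Boundary

/-! ### Symmetry of the index form from commuting partial derivatives. -/

section Symmetry

variable {n : ℕ} {Q : Type*} [TopologicalSpace Q] [ChartedSpace (EuclideanSpace ℝ (Fin n)) Q]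
  [IsManifold (𝓡 n) ∞ Q] [RiemannianBundle (fun x : Q => TangentSpace (𝓡 n) x)]
  [IsContMDiffRiemannianBundle (𝓡 n) ∞ (EuclideanSpace ℝ (Fin n))
    (fun x : Q => TangentSpace (𝓡 n) x)]

local notation "𝔼" => EuclideanSpace ℝ (Fin n)

variable {T t : ℝ} {q : ℝ → Q} {x : Q} {X X' Y Z : ∀ t, TangentSpace (𝓡 n) (q t)} {V : Q → ℝ}
  {J : Set ℝ}

/-- The two-parameter variation `φ(q t) + r Z t + s Y t` in the chart `φ` at `x`, as a function of
`(t, r, s)`. -/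
def chartVariation (x : Q) (q : ℝ → Q) (Z Y : ∀ t, TangentSpace (𝓡 n) (q t)) (p : ℝ × ℝ × ℝ) : 𝔼 :=
  extChartAt (𝓡 n) x (q p.1) + p.2.1 • coord x q Z p.1 + p.2.2 • coord x q Y p.1

theorem isChartLift_chartVariation (hq : ContMDiffOn 𝓘(ℝ, ℝ) (𝓡 n) ∞ q (Icc 0 T))
    (hZ : IsSmoothField T q Z) (hY : IsSmoothField T q Y) (hJ : IsOpen J) (hJT : J ⊆ Ioo 0 T)
    (hx : ∀ t ∈ J, q t ∈ (extChartAt (𝓡 n) x).source) :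
    IsChartLift T q x (chartVariation x q Z Y)
      (Prod.fst ⁻¹' J ∩ chartVariation x q Z Y ⁻¹' (extChartAt (𝓡 n) x).target) 0 (1, 0, 0) J := by
  have hs : ContDiffOn ℝ ∞ (chartVariation x q Z Y) (Prod.fst ⁻¹' J) := by
    intro p hp
    have hI := Icc_mem_nhds (hJT hp).1 (hJT hp).2
    have hpI : p.1 ∈ Icc 0 T := Ioo_subset_Icc_self (hJT hp)
    have h1 := fun {f : ℝ → 𝔼} (hf : ContDiffWithinAt ℝ ∞ f (Icc 0 T) p.1) =>
      (hf.contDiffAt hI).comp p contDiffAt_fst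
    have e1 : ContDiffAt ℝ ∞ (fun p : ℝ × ℝ × ℝ => p.2.1) p := contDiffAt_fst.comp p contDiffAt_snd
    have e2 : ContDiffAt ℝ ∞ (fun p : ℝ × ℝ × ℝ => p.2.2) p := contDiffAt_snd.comp p contDiffAt_snd
    exact (((h1 (contDiffWithinAt_chart hq hpI (hx _ hp))).add
      (e1.smul (h1 (hZ.contDiffWithinAt hpI (hx _ hp))))).add
      (e2.smul (h1 (hY.contDiffWithinAt hpI (hx _ hp))))).contDiffWithinAt
  have hO : IsOpen (Prod.fst ⁻¹' J ∩ chartVariation x q Z Y ⁻¹' (extChartAt (𝓡 n) x).target) :=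
    hs.continuousOn.isOpen_inter_preimage (hJ.preimage continuous_fst) (isOpen_extChartAt_target x)
  have e0 : ∀ t : ℝ, (0 : ℝ × ℝ × ℝ) + t • (1, 0, 0) = (t, 0, 0) := fun t => by simp
  have e1 : ∀ t : ℝ, chartVariation x q Z Y (t, 0, 0) = extChartAt (𝓡 n) x (q t) := fun t => by
    simp [chartVariation]
  refine ⟨⟨hO, hs.mono inter_subset_left, fun p hp => hp.2⟩, hJ, hJT, fun t ht => ?_, hx,
    fun t ht => by rw [e0, e1]⟩
  rw [e0]
  refine ⟨ht, ?_⟩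
  rw [mem_preimage, e1]
  exact (extChartAt (𝓡 n) x).map_source (hx t ht)

theorem fderiv_chartVariation_fst {p : ℝ × ℝ × ℝ}
    (hd : DifferentiableAt ℝ (chartVariation x q Z Y) p) :
    fderiv ℝ (chartVariation x q Z Y) p (0, 1, 0) = coord x q Z p.1 := by
  rw [← hd.lineDeriv_eq_fderiv]
  refine HasLineDerivAt.lineDeriv (?_ : HasDerivAt _ _ _)
  have h : HasDerivAt (fun s : ℝ => extChartAt (𝓡 n) x (q p.1) + (p.2.1 + s) • coord x q Z p.1
      + p.2.2 • coord x q Y p.1) ((1 : ℝ) • coord x q Z p.1) 0 :=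
    ((((hasDerivAt_id 0).const_add p.2.1).smul_const _).const_add _).add_const _
  rw [one_smul] at h
  refine h.congr_of_eventuallyEq (.of_forall fun s => ?_)
  simp [chartVariation]

theorem fderiv_chartVariation_snd {p : ℝ × ℝ × ℝ}
    (hd : DifferentiableAt ℝ (chartVariation x q Z Y) p) :
    fderiv ℝ (chartVariation x q Z Y) p (0, 0, 1) = coord x q Y p.1 := by
  rw [← hd.lineDeriv_eq_fderiv]
  refine HasLineDerivAt.lineDeriv (?_ : HasDerivAt _ _ _)
  have h : HasDerivAt (fun s : ℝ => extChartAt (𝓡 n) x (q p.1) + p.2.1 • coord x q Z p.1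
      + (p.2.2 + s) • coord x q Y p.1) ((1 : ℝ) • coord x q Y p.1) 0 :=
    (((hasDerivAt_id 0).const_add p.2.2).smul_const _).const_add _
  rw [one_smul] at h
  refine h.congr_of_eventuallyEq (.of_forall fun s => ?_)
  simp [chartVariation]

/-- Symmetry of the Jacobi operator up to a derivative with localized primitive. -/
theorem exists_hasDerivAt_jacobi_sub (hV : ContMDiff (𝓡 n) 𝓘(ℝ, ℝ) ∞ V) (hT : 0 < T)
    (hq : IsModifiedCubic (n := n) V T q)
    (hZ : IsSmoothField T q Z) (hY : IsSmoothField T q Y) (hJ : IsOpen J) (hJT : J ⊆ Ioo 0 T)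
    (hx : ∀ t ∈ J, q t ∈ (extChartAt (𝓡 n) x).source) {S : Set ℝ} (hS : IsClosed S)
    (hZS : ∀ t ∈ Icc 0 T, t ∉ S → Z t = 0) :
    ∃ β : ℝ → ℝ, (∀ t ∈ J, HasDerivAt β (metricAt (q t) (jacobiField V T q Z t) (Y t)
      - metricAt (q t) (jacobiField V T q Y t) (Z t)) t) ∧ ∀ t ∈ J, t ∉ S → β t = 0 := by
  have h := isChartLift_chartVariation (x := x) hq.1 hZ hY hJ hJT hx
  set c := chartVariation x q Z Y with hc
  set O := Prod.fst ⁻¹' J ∩ chartVariation x q Z Y ⁻¹' (extChartAt (𝓡 n) x).target with hO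
  have hl := isLeviCivitaOn_chart (n := n) x
  have hd : ∀ p ∈ O, DifferentiableAt ℝ c p := fun p hp =>
    ContDiffOn.differentiableAt_of_isOpen h.into.smooth h.into.isOpen hp
  have e0 : ∀ t : ℝ, (0 : ℝ × ℝ × ℝ) + t • (1, 0, 0) = (t, 0, 0) := fun t => by simp
  have hr : ∀ t ∈ J, fderiv ℝ c (0 + t • (1, 0, 0)) (0, 1, 0) = coord x q Z t := fun t ht => by
    rw [fderiv_chartVariation_fst (hd _ (h.mem t ht)), e0]
  have hs : ∀ t ∈ J, fderiv ℝ c (0 + t • (1, 0, 0)) (0, 0, 1) = coord x q Y t := fun t ht => by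
    rw [fderiv_chartVariation_snd (hd _ (h.mem t ht)), e0]
  refine ⟨fun t => fderiv ℝ (boundaryL (chartMetric x) (christoffelL x) c (1, 0, 0) (0, 1, 0))
        (0 + t • (1, 0, 0)) (0, 0, 1) - fderiv ℝ (boundaryL (chartMetric x) (christoffelL x) c
        (1, 0, 0) (0, 0, 1)) (0 + t • (1, 0, 0)) (0, 1, 0), fun t ht => ?_, fun t ht htS => ?_⟩
  · have h1 := h.second_variation hV hT hq hZ hr hs ht
    have h2 := h.second_variation hV hT hq hY hs hr ht
    refine (h2.sub h1).congr_deriv ?_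
    -- The second variation is taken in the order (r, s) and in the order (s, r). The mixed
    -- derivatives of the Lagrangian agree, so the difference of the two Jacobi pairings is the
    -- derivative of a difference of boundary terms.
    rw [fderiv_fderiv_comm h.into.isOpen
      (hl.contDiffOn_lagrangian h.into (contDiffOn_potential hV x) (1, 0, 0)) (0, 0, 1) (0, 1, 0)
      (h.mem t ht)]
    rw [jacobiField, jacobiField]
    ring
  -- Over times outside S the variation does not depend on r. The boundary term of the direction r
  -- vanishes identically there, and that of the direction s is constant in r.
  · have hO' : IsOpen (O ∩ Prod.fst ⁻¹' Sᶜ) :=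
      h.into.isOpen.inter (hS.isOpen_compl.preimage continuous_fst)
    have hc' := h.into.mono hO' inter_subset_left
    have hr' : ∀ p ∈ O ∩ Prod.fst ⁻¹' Sᶜ, fderiv ℝ c p (0, 1, 0) = 0 := fun p hp => by
      rw [fderiv_chartVariation_fst (hd p hp.1)]
      exact (congrArg (rep x (q p.1)) (hZS p.1 (Ioo_subset_Icc_self (hJT hp.1.1)) hp.2)).trans
        (map_zero (rep x (q p.1)))
    have hp : (0 : ℝ × ℝ × ℝ) + t • (1, 0, 0) ∈ O ∩ Prod.fst ⁻¹' Sᶜ :=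
      ⟨h.mem t ht, by rw [e0]; exact htS⟩
    beta_reduce
    rw [hl.fderiv_boundaryL_eq_zero hc' hr' _ hp, fderiv_congr_of_isOpen (W' := fun _ => 0) hO'
      (fun p hp => boundaryL_eq_zero hO' hr' p hp) hp]
    simp

/-- The index form is symmetric, one of the fields being supported in a chart. -/
theorem indexForm_comm (hV : ContMDiff (𝓡 n) 𝓘(ℝ, ℝ) ∞ V) (hT : 0 < T)
    (hq : IsModifiedCubic (n := n) V T q)
    (hZ : IsSmoothField T q Z) (hY : IsSmoothField T q Y) (hJ : IsOpen J) (hJT : J ⊆ Ioo 0 T)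
    (hx : ∀ t ∈ J, q t ∈ (extChartAt (𝓡 n) x).source) {S : Set ℝ} (hS : IsClosed S) (hSJ : S ⊆ J)
    (hZS : ∀ t ∈ Icc 0 T, t ∉ S → Z t = 0) : indexForm V T q Z Y = indexForm V T q Y Z := by
  obtain ⟨β, hβ, hβ0⟩ := exists_hasDerivAt_jacobi_sub (x := x) hV hT hq hZ hY hJ hJT hx hS hZS
  have hz := covDeriv_iterate_eq_zero (X := Z) (T := T) hS hZS
  have hZY : ∀ i j, ∀ t ∈ Icc 0 T, t ∉ S → jetInner T q Z Y i j t = 0 := fun i j t ht htS => by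
    rw [jetInner, hz i t ht htS, metricAt_zero_left]
  have hYZ : ∀ i j, ∀ t ∈ Icc 0 T, t ∉ S → jetInner T q Y Z i j t = 0 := fun i j t ht htS => by
    rw [jetInner, hz j t ht htS, metricAt_zero_right]
  have hjac : ∀ t ∈ Icc 0 T, t ∉ S → jacobiField V T q Z t = 0 := fun t ht htS => by
    have e1 : covDeriv T q Z t = 0 := hz 1 t ht htS
    have := jacobiAt_smul (T := T) (γ := q) hV (t := t) 0 0 0 0
    rw [jacobiField, hz 4 t ht htS, hz 2 t ht htS, e1, hZS t ht htS]
    simpa using this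
  classical
  -- The primitive β is meaningful only while q stays in the chart. As it vanishes on J outside S,
  -- its extension by zero is differentiable on all of [0, T].
  set β' : ℝ → ℝ := fun t => if t ∈ S then β t else 0 with hβ'
  have hd : ∀ t ∈ Icc 0 T, HasDerivWithinAt β' (metricAt (q t) (jacobiField V T q Z t) (Y t)
      - metricAt (q t) (jacobiField V T q Y t) (Z t)) (Icc 0 T) t := by
    intro t ht
    by_cases htS : t ∈ S
    · refine ((hβ t (hSJ htS)).congr_of_eventuallyEq ?_).hasDerivWithinAt
      filter_upwards [hJ.mem_nhds (hSJ htS)] with s hs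
      by_cases hsS : s ∈ S
      · simp [hβ', hsS]
      · simp [hβ', hsS, hβ0 s hs hsS]
    · rw [hjac t ht htS, hZS t ht htS, metricAt_zero_left, metricAt_zero_right, sub_zero]
      refine ((hasDerivAt_const t (0 : ℝ)).congr_of_eventuallyEq ?_).hasDerivWithinAt
      filter_upwards [hS.isOpen_compl.mem_nhds htS] with s hs
      simp [hβ', show s ∉ S from hs]
  have hi := fun {X Z : ∀ t, TangentSpace (𝓡 n) (q t)} (hX : IsSmoothField T q X)
    (hZ : IsSmoothField T q Z) => continuousOn_indexIntegrand hV hT hq.1 hX hZ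
  have h0 : ∀ t, t ∉ J → t ∉ S := fun t ht h => ht (hSJ h)
  have hn0 : (0 : ℝ) ∉ S := h0 0 fun h => lt_irrefl _ (hJT h).1
  have hnT : T ∉ S := h0 T fun h => lt_irrefl _ (hJT h).2
  have hl : (0 : ℝ) ∈ Icc 0 T := left_mem_Icc.2 hT.le
  have hr : T ∈ Icc 0 T := right_mem_Icc.2 hT.le
  -- The primitive of the difference of the two integrands consists of the boundary terms of both
  -- integrations by parts together with β'. All of them vanish at 0 and T, which lie outside S.
  have key := integral_eq_sub_of_hasDerivWithinAt (T := T)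
    (f := fun t => (jetInner T q Z Y 2 1 t - jetInner T q Z Y 3 0 t)
      - (jetInner T q Y Z 2 1 t - jetInner T q Y Z 3 0 t) + β' t)
    (f' := fun t => indexIntegrand V T q Z Y t - indexIntegrand V T q Y Z t) (fun t ht =>
      (((hasDerivWithinAt_index_boundary (V := V) hT hq.1 hZ hY ht).sub
        (hasDerivWithinAt_index_boundary (V := V) hT hq.1 hY hZ ht)).add (hd t ht)).congr_deriv
          (by ring)) ((hi hZ hY).sub (hi hY hZ)) le_rfl hT.le le_rfl
  rw [intervalIntegral.integral_sub ((hi hZ hY).intervalIntegrable_of_Icc hT.le)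
    ((hi hY hZ).intervalIntegrable_of_Icc hT.le), ← indexForm_eq, ← indexForm_eq] at key
  simp only [hZY _ _ _ hl hn0, hZY _ _ _ hr hnT, hYZ _ _ _ hl hn0, hYZ _ _ _ hr hnT, hβ', hn0,
    hnT, if_false] at key
  linarith

end Symmetry

/-! ### Cutoff functions with weighted derivative bounds. -/

section Cutoff

theorem deriv_eq_zero_off_Icc {h : ℝ → ℝ} {u v : ℝ} (hl : ∀ x ≤ 0, h x = u) (hr : ∀ x, 1 ≤ x → h x = v)
    {x : ℝ} (hx : x ∉ Icc 0 1) : deriv h x = 0 := by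
  rw [mem_Icc, not_and_or, not_le, not_le] at hx
  rcases hx with hx | hx
  · have e : h =ᶠ[𝓝 x] fun _ => u := by
      filter_upwards [Iio_mem_nhds hx] with y hy using hl y (le_of_lt hy)
    rw [e.deriv_eq, deriv_const]
  · have e : h =ᶠ[𝓝 x] fun _ => v := by
      filter_upwards [Ioi_mem_nhds hx] with y hy using hr y (le_of_lt hy)
    rw [e.deriv_eq, deriv_const]

/-- A smooth step function with bounds on its first two derivatives. -/
theorem exists_smoothStep : ∃ (h h' h'' : ℝ → ℝ) (C : ℝ), ContDiff ℝ ∞ h ∧ ContDiff ℝ ∞ h' ∧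
    (∀ x, HasDerivAt h (h' x) x) ∧ (∀ x, HasDerivAt h' (h'' x) x) ∧ (∀ x ≤ 0, h x = 0) ∧
    (∀ x, 1 ≤ x → h x = 1) ∧ (∀ x, |h x| ≤ 1) ∧ 0 ≤ C ∧
    (∀ x, |h' x| * |x + 1| ≤ C) ∧ ∀ x, |h'' x| * |x + 1| ^ 2 ≤ C := by
  have hs : ContDiff ℝ ∞ Real.smoothTransition := Real.smoothTransition.contDiff
  have hs' : ContDiff ℝ ∞ (deriv Real.smoothTransition) := (contDiff_infty_iff_deriv.1 hs).2
  have hs'' : ContDiff ℝ ∞ (deriv (deriv Real.smoothTransition)) := (contDiff_infty_iff_deriv.1 hs').2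
  have z1 : ∀ x ∉ Icc (0 : ℝ) 1, deriv Real.smoothTransition x = 0 := fun x hx =>
    deriv_eq_zero_off_Icc (fun x => Real.smoothTransition.zero_of_nonpos)
      (fun x => Real.smoothTransition.one_of_one_le) hx
  have z2 : ∀ x ∉ Icc (0 : ℝ) 1, deriv (deriv Real.smoothTransition) x = 0 := fun x hx => by
    have e : deriv Real.smoothTransition =ᶠ[𝓝 x] fun _ => 0 := by
      filter_upwards [isClosed_Icc.isOpen_compl.mem_nhds hx] with y hy using z1 y hy
    rw [e.deriv_eq, deriv_const]
  have bd : ∀ f : ℝ → ℝ, ContDiff ℝ ∞ f → (∀ x ∉ Icc (0 : ℝ) 1, f x = 0) → ∀ m : ℕ,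
      ∃ C, ∀ x, |f x| * |x + 1| ^ m ≤ C := by
    intro f hf hz m
    have hc : Continuous fun x => f x * (x + 1) ^ m := by
      have := hf.continuous
      fun_prop
    obtain ⟨C, hC⟩ := hc.bounded_above_of_compact_support
      (HasCompactSupport.intro (K := Icc 0 1) isCompact_Icc (fun x hx => by simp [hz x hx]))
    exact ⟨C, fun x => by simpa using hC x⟩
  obtain ⟨C1, h1⟩ := bd _ hs' z1 1
  obtain ⟨C2, h2⟩ := bd _ hs'' z2 2
  have hC1 : 0 ≤ C1 := le_trans (by positivity) (h1 0)
  have hC2 : 0 ≤ C2 := le_trans (by positivity) (h2 0)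
  refine ⟨Real.smoothTransition, deriv Real.smoothTransition, deriv (deriv Real.smoothTransition),
    C1 + C2, hs, hs', fun x => (hs.differentiable (by simp) x).hasDerivAt,
    fun x => (hs'.differentiable (by simp) x).hasDerivAt,
    fun x => Real.smoothTransition.zero_of_nonpos, fun x => Real.smoothTransition.one_of_one_le,
    fun x => ?_, by positivity, fun x => ?_, fun x => ?_⟩
  · rw [abs_of_nonneg (Real.smoothTransition.nonneg x)]
    exact Real.smoothTransition.le_one x
  · have := h1 x
    rw [pow_one] at this
    linarith
  · have := h2 x
    linarith

/-- Smooth cutoff functions exhausting the interval `(a, b)`; their derivatives are controlled by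
powers of `(t - a) (b - t)`. -/
theorem exists_cutoff {a b : ℝ} (hab : a < b) : ∃ (φ φ' φ'' : ℕ → ℝ → ℝ) (C : ℝ), 0 ≤ C ∧
    (∀ k, ContDiff ℝ ∞ (φ k) ∧ ContDiff ℝ ∞ (φ' k) ∧ (∀ t, HasDerivAt (φ k) (φ' k t) t) ∧
      (∀ t, HasDerivAt (φ' k) (φ'' k t) t) ∧ (∀ t, |φ k t| ≤ 1) ∧
      (∀ t ∈ Icc a b, |φ' k t| * ((t - a) * (b - t)) ≤ C) ∧
      (∀ t ∈ Icc a b, |φ'' k t| * ((t - a) * (b - t)) ^ 2 ≤ C) ∧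
      ∃ α β, a < α ∧ β < b ∧ ∀ t ∉ Icc α β, φ k t = 0) ∧
    ∀ t ∈ Ioo a b, ∀ᶠ k in Filter.atTop, ∀ᶠ s in 𝓝 t, φ k s = 1 := by
  obtain ⟨h, h', h'', C, hs, hs', hd, hd', hl, hr, hb, hC, hb', hb''⟩ := exists_smoothStep
  set w : ℝ → ℝ := fun t => (t - a) * (b - t) with hw
  set L := b - a with hL
  have hL0 : 0 < L := sub_pos.2 hab
  have hws : ContDiff ℝ ∞ w := by fun_prop
  have hwd : ∀ t, HasDerivAt w (a + b - 2 * t) t := fun t => by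
    refine (((hasDerivAt_id t).sub_const a).mul ((hasDerivAt_id t).const_sub b)).congr_deriv ?_
    simp only [id]
    ring
  have hwd' : ∀ t : ℝ, HasDerivAt (fun t => a + b - 2 * t) (-2) t := fun t => by
    simpa using ((hasDerivAt_id t).const_mul 2).const_sub (a + b)
  -- Since y + 1 = (k + 1) w, a factor k + 1 produced by differentiating h ∘ y is traded for (y + 1)
  -- / w. This is why the bounds on the step function carry powers of x + 1, and why the resulting
  -- weighted bounds do not depend on k.
  set y : ℕ → ℝ → ℝ := fun k t => (k + 1) * w t - 1 with hy
  have hyd : ∀ k t, HasDerivAt (y k) ((k + 1) * (a + b - 2 * t)) t := fun k t =>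
    ((hwd t).const_mul _).sub_const 1
  have hyd' : ∀ (k : ℕ) (t : ℝ), HasDerivAt (fun t => ((k : ℝ) + 1) * (a + b - 2 * t))
    ((k + 1) * (-2)) t := fun k t => (hwd' t).const_mul _
  have hys : ∀ k, ContDiff ℝ ∞ (y k) := fun k => by fun_prop
  refine ⟨fun k t => h (y k t), fun k t => h' (y k t) * ((k + 1) * (a + b - 2 * t)),
    fun k t => h'' (y k t) * ((k + 1) * (a + b - 2 * t)) * ((k + 1) * (a + b - 2 * t))
      + h' (y k t) * ((k + 1) * (-2)), C * L + C * L ^ 2 + 2 * C * L ^ 2, by positivity,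
    fun k => ⟨hs.comp (hys k), (hs'.comp (hys k)).mul (by fun_prop),
      fun t => (hd _).comp t (hyd k t),
      fun t => ((hd' _).comp t (hyd k t)).mul (hyd' k t), fun t => hb _, fun t ht => ?_,
      fun t ht => ?_, ?_⟩, fun t ht => ?_⟩
  · have hk : (0 : ℝ) < k + 1 := by positivity
    have hw0 : 0 ≤ w t := mul_nonneg (sub_nonneg.2 ht.1) (sub_nonneg.2 ht.2)
    have h1 := hb' (y k t)
    have e : |y k t + 1| = (k + 1) * w t := by
      rw [hy]; simp only [sub_add_cancel]; exact abs_of_nonneg (by positivity)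
    rw [e] at h1
    have hw' : |a + b - 2 * t| ≤ L := abs_le.2 ⟨by linarith [ht.2], by linarith [ht.1]⟩
    have h2 : |h' (y k t) * ((k + 1) * (a + b - 2 * t))| * w t
        = (|h' (y k t)| * ((k + 1) * w t)) * |a + b - 2 * t| := by
      rw [abs_mul, abs_mul, abs_of_pos hk]; ring
    change |h' (y k t) * ((k + 1) * (a + b - 2 * t))| * w t ≤ _
    rw [h2]
    have h3 := mul_le_mul h1 hw' (abs_nonneg _) hC
    have h4 : 0 ≤ C * L ^ 2 := by positivity
    linarith
  · have hk : (0 : ℝ) < k + 1 := by positivity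
    have hw0 : 0 ≤ w t := mul_nonneg (sub_nonneg.2 ht.1) (sub_nonneg.2 ht.2)
    have h1 := hb' (y k t)
    have h1' := hb'' (y k t)
    have e : |y k t + 1| = (k + 1) * w t := by
      rw [hy]; simp only [sub_add_cancel]; exact abs_of_nonneg (by positivity)
    rw [e] at h1 h1'
    have hw' : |a + b - 2 * t| ≤ L := abs_le.2 ⟨by linarith [ht.2], by linarith [ht.1]⟩
    have hwL : w t ≤ L ^ 2 := by
      have := mul_le_mul (show t - a ≤ L by linarith [ht.2]) (show b - t ≤ L by linarith [ht.1])
        (sub_nonneg.2 ht.2) hL0.le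
      rw [hw]; simp only; nlinarith
    change |h'' (y k t) * ((k + 1) * (a + b - 2 * t)) * ((k + 1) * (a + b - 2 * t))
      + h' (y k t) * ((k + 1) * (-2))| * w t ^ 2 ≤ _
    have h2 : |h'' (y k t) * ((k + 1) * (a + b - 2 * t)) * ((k + 1) * (a + b - 2 * t))|
        * w t ^ 2 = (|h'' (y k t)| * ((k + 1) * w t) ^ 2) * |a + b - 2 * t| ^ 2 := by
      rw [abs_mul, abs_mul, abs_mul, abs_of_pos hk]; ring
    have h3 : |h' (y k t) * ((k + 1) * (-2))| * w t ^ 2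
        = (|h' (y k t)| * ((k + 1) * w t)) * (2 * w t) := by
      rw [abs_mul, abs_mul, abs_of_pos hk]; norm_num; ring
    have h4 := mul_le_mul h1' (pow_le_pow_left₀ (abs_nonneg _) hw' 2) (by positivity) hC
    have h5 := mul_le_mul h1 (mul_le_mul_of_nonneg_left hwL zero_le_two) (by positivity) hC
    have h6 := mul_le_mul_of_nonneg_right (abs_add_le
      (h'' (y k t) * ((k + 1) * (a + b - 2 * t)) * ((k + 1) * (a + b - 2 * t)))
      (h' (y k t) * ((k + 1) * (-2)))) (sq_nonneg (w t))
    rw [add_mul |_| |_|, h2, h3] at h6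
    have h7 : 0 ≤ C * L := by positivity
    linarith
  · have hk : (0 : ℝ) < k + 1 := by positivity
    have hδ : 0 < 1 / ((k + 1) * L) := by positivity
    -- Within distance 1/((k+1)L) of an end, and beyond it, w is at most 1/(k+1). Then y ≤ 0 and the
    -- step function vanishes.
    refine ⟨a + 1 / ((k + 1) * L), b - 1 / ((k + 1) * L), by linarith, by linarith,
      fun t ht => hl _ ?_⟩
    have hδL : (k + 1) * (1 / ((k + 1) * L) * L) = 1 := by field_simp
    suffices hw1 : w t ≤ 1 / ((k + 1) * L) * L by
      have := mul_le_mul_of_nonneg_left hw1 hk.le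
      rw [hδL] at this
      change (k + 1) * w t - 1 ≤ 0
      linarith
    by_cases hta : t ≤ a
    · refine le_trans (mul_nonpos_of_nonpos_of_nonneg (sub_nonpos.2 hta) ?_) (by positivity)
      linarith
    by_cases htb : b ≤ t
    · refine le_trans (mul_nonpos_of_nonneg_of_nonpos ?_ (sub_nonpos.2 htb)) (by positivity)
      linarith
    rw [not_le] at hta htb
    rw [mem_Icc, not_and_or, not_le, not_le] at ht
    rcases ht with ht | ht
    · exact mul_le_mul (by linarith) (by linarith) (by linarith) hδ.le
    · rw [mul_comm (1 / ((k + 1) * L))]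
      exact mul_le_mul (by linarith) (by linarith) (by linarith) hL0.le
  · have hw0 : 0 < w t := mul_pos (sub_pos.2 ht.1) (sub_pos.2 ht.2)
    obtain ⟨N, hN⟩ := exists_nat_gt (3 / w t)
    rw [div_lt_iff₀ hw0] at hN
    filter_upwards [Filter.eventually_ge_atTop N] with k hk
    -- The inequality is strict so that it persists near t: the cutoff must equal 1 on a
    -- neighbourhood for all covariant derivatives of the truncated field to agree with those of X.
    have h1 : 1 < y k t := by
      have : (N : ℝ) * w t ≤ (k + 1) * w t :=
        mul_le_mul_of_nonneg_right ((Nat.cast_le.2 hk).trans (by linarith)) hw0.le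
      change 1 < (k + 1) * w t - 1
      linarith
    filter_upwards [(hys k).continuous.continuousAt.eventually (lt_mem_nhds h1)] with s hs1
    exact hr _ hs1.le

end Cutoff

/-! ### Truncation of fields and passage to the limit in the index form. -/

section CutoffField

variable {n : ℕ} {Q : Type*} [TopologicalSpace Q] [ChartedSpace (EuclideanSpace ℝ (Fin n)) Q]
  [IsManifold (𝓡 n) ∞ Q] [RiemannianBundle (fun x : Q => TangentSpace (𝓡 n) x)]
  [IsContMDiffRiemannianBundle (𝓡 n) ∞ (EuclideanSpace ℝ (Fin n))
    (fun x : Q => TangentSpace (𝓡 n) x)]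

local notation "𝔼" => EuclideanSpace ℝ (Fin n)

variable {T t a b : ℝ} {q : ℝ → Q} {x : Q} {X Y Z : ∀ t, TangentSpace (𝓡 n) (q t)} {V : Q → ℝ}

theorem abs_indexIntegrand_le {K M : ℝ} (hK : 0 ≤ K) (hM : 0 ≤ M)
    (h : ∀ a b c : TangentSpace (𝓡 n) (q t), ‖jacobiAt V T q t a b c‖ ≤ K * (‖a‖ + ‖b‖ + ‖c‖))
    (hX : ∀ i < 3, ‖(covDeriv T q)^[i] X t‖ ≤ M) (hZ : ∀ i < 3, ‖(covDeriv T q)^[i] Z t‖ ≤ M) :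
    |indexIntegrand V T q X Z t| ≤ M * M + M * (K * (M + M + M)) := by
  have h0 : ‖X t‖ ≤ M := hX 0 (by norm_num)
  have h1 : ‖covDeriv T q X t‖ ≤ M := hX 1 (by norm_num)
  have h2 := hX 2 (by norm_num)
  have z0 : ‖Z t‖ ≤ M := hZ 0 (by norm_num)
  refine (abs_add_le _ _).trans (add_le_add ((abs_metricAt_le _ _ _).trans ?_)
    ((abs_metricAt_le _ _ _).trans ?_))
  · exact mul_le_mul h2 (hZ 2 (by norm_num)) (norm_nonneg _) hM
  · refine mul_le_mul z0 ((h _ _ _).trans ?_) (norm_nonneg _) hM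
    exact mul_le_mul_of_nonneg_left (add_le_add (add_le_add h0 h1) h2) hK

theorem indexIntegrand_congr {X' Z' : ∀ t, TangentSpace (𝓡 n) (q t)}
    (hX : ∀ i, (covDeriv T q)^[i] X t = (covDeriv T q)^[i] X' t)
    (hZ : ∀ i, (covDeriv T q)^[i] Z t = (covDeriv T q)^[i] Z' t) :
    indexIntegrand V T q X Z t = indexIntegrand V T q X' Z' t := by
  have x0 : X t = X' t := hX 0
  have x1 : covDeriv T q X t = covDeriv T q X' t := hX 1
  have z0 : Z t = Z' t := hZ 0
  rw [indexIntegrand, indexIntegrand, jetInner, jetInner, hX 2, hZ 2, x0, x1, z0]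

theorem covDeriv_iterate_eventuallyEq {X' : ∀ t, TangentSpace (𝓡 n) (q t)}
    (h : ∀ᶠ s in 𝓝[Icc 0 T] t, X s = X' s) (ht : t ∈ Icc 0 T) (i : ℕ) :
    (covDeriv T q)^[i] X t = (covDeriv T q)^[i] X' t := by
  have key : ∀ᶠ s in 𝓝[Icc 0 T] t, (covDeriv T q)^[i] X s = (covDeriv T q)^[i] X' s := by
    induction i with
    | zero => exact h
    | succ i ih =>
      filter_upwards [eventually_eventually_nhdsWithin.2 ih, self_mem_nhdsWithin] with s hs hsT
      rw [Function.iterate_succ_apply', Function.iterate_succ_apply']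
      exact covDeriv_congr hs hsT
  exact key.self_of_nhdsWithin ht

/-- Dominated convergence: the 2-jets are bounded uniformly in k, and at every interior time the
integrand is eventually constant in k. The end point b is discarded as a null set. -/
theorem tendsto_integral_indexIntegrand (hV : ContMDiff (𝓡 n) 𝓘(ℝ, ℝ) ∞ V) (hT : 0 < T)
    (hq : ContMDiffOn 𝓘(ℝ, ℝ) (𝓡 n) ∞ q (Icc 0 T)) (ha : 0 ≤ a) (hab : a ≤ b) (hb : b ≤ T)
    {A B : ℕ → ∀ t, TangentSpace (𝓡 n) (q t)} (hA : ∀ k, IsSmoothField T q (A k))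
    (hB : ∀ k, IsSmoothField T q (B k)) {M : ℝ} (hM : 0 ≤ M)
    (hAM : ∀ k, ∀ t ∈ Icc a b, ∀ i < 3, ‖(covDeriv T q)^[i] (A k) t‖ ≤ M)
    (hBM : ∀ k, ∀ t ∈ Icc a b, ∀ i < 3, ‖(covDeriv T q)^[i] (B k) t‖ ≤ M)
    (hAX : ∀ t ∈ Ioo a b, ∀ᶠ k in Filter.atTop, ∀ i,
      (covDeriv T q)^[i] (A k) t = (covDeriv T q)^[i] X t)
    (hBZ : ∀ t ∈ Ioo a b, ∀ᶠ k in Filter.atTop, ∀ i,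
      (covDeriv T q)^[i] (B k) t = (covDeriv T q)^[i] Z t) :
    Filter.Tendsto (fun k => ∫ t in a..b, indexIntegrand V T q (A k) (B k) t) Filter.atTop
      (𝓝 (∫ t in a..b, indexIntegrand V T q X Z t)) := by
  obtain ⟨K, hK, hJ⟩ := exists_norm_jacobiAt_le hV hT hq
  have hsub : Icc a b ⊆ Icc 0 T := Icc_subset_Icc ha hb
  refine intervalIntegral.tendsto_integral_filter_of_dominated_convergence
    (fun _ => M * M + M * (K * (M + M + M))) (.of_forall fun k => ?_)
    (.of_forall fun k => .of_forall fun t ht => ?_) intervalIntegrable_const ?_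
  · rw [uIoc_of_le hab]
    exact (((continuousOn_indexIntegrand hV hT hq (hA k) (hB k)).mono hsub).mono
      Ioc_subset_Icc_self).aestronglyMeasurable measurableSet_Ioc
  · rw [uIoc_of_le hab] at ht
    have ht' := Ioc_subset_Icc_self ht
    exact abs_indexIntegrand_le hK hM (hJ t (hsub ht')) (hAM k t ht') (hBM k t ht')
  · filter_upwards [(countable_singleton b).ae_notMem MeasureTheory.volume] with t htb ht
    rw [uIoc_of_le hab] at ht
    have ht' : t ∈ Ioo a b := ⟨ht.1, lt_of_le_of_ne ht.2 htb⟩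
    refine tendsto_const_nhds.congr' ?_
    filter_upwards [hAX t ht', hBZ t ht'] with k h1 h2
    exact indexIntegrand_congr (fun i => (h1 i).symm) (fun i => (h2 i).symm)

/-- The index form of fields, one of which is supported in `[a, b]`. -/
theorem indexForm_eq_integral (hV : ContMDiff (𝓡 n) 𝓘(ℝ, ℝ) ∞ V) (hT : 0 < T)
    (hq : ContMDiffOn 𝓘(ℝ, ℝ) (𝓡 n) ∞ q (Icc 0 T)) (ha : 0 ≤ a) (hab : a ≤ b) (hb : b ≤ T)
    (hX : IsSmoothField T q X) (hZ : IsSmoothField T q Z) {S : Set ℝ} (hS : IsClosed S)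
    (hSab : S ⊆ Ioo a b) (hXS : ∀ t ∈ Icc 0 T, t ∉ S → X t = 0) :
    indexForm V T q X Z = ∫ t in a..b, indexIntegrand V T q X Z t := by
  have hz := covDeriv_iterate_eq_zero (X := X) (T := T) hS hXS
  have h0 : ∀ t ∈ Icc 0 T, t ∉ S → indexIntegrand V T q X Z t = 0 := fun t ht htS => by
    have e1 : covDeriv T q X t = 0 := hz 1 t ht htS
    have := jacobiAt_smul (T := T) (γ := q) hV (t := t) 0 0 0 0
    simp only [zero_smul] at this
    rw [indexIntegrand, jetInner, hz 2 t ht htS, e1, hXS t ht htS, this, metricAt_zero_left,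
      metricAt_zero_right, add_zero]
  have hi : ∀ u v, 0 ≤ u → u ≤ v → v ≤ T →
      IntervalIntegrable (indexIntegrand V T q X Z) MeasureTheory.volume u v := fun u v hu huv hv =>
    ((continuousOn_indexIntegrand hV hT hq hX hZ).mono
      (Icc_subset_Icc hu hv)).intervalIntegrable_of_Icc huv
  rw [indexForm_eq, ← intervalIntegral.integral_add_adjacent_intervals (hi 0 a le_rfl ha
    (hab.trans hb)) (hi a T ha (hab.trans hb) le_rfl),
    ← intervalIntegral.integral_add_adjacent_intervals (hi a b ha hab hb)
      (hi b T (ha.trans hab) hb le_rfl)]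
  have e1 : ∫ t in (0 : ℝ)..a, indexIntegrand V T q X Z t = 0 := by
    rw [intervalIntegral.integral_congr (g := fun _ => 0) fun t ht => ?_]
    · simp
    · rw [uIcc_of_le ha] at ht
      exact h0 t ⟨ht.1, ht.2.trans (hab.trans hb)⟩ fun h => absurd (hSab h).1 (not_lt.2 ht.2)
  have e2 : ∫ t in b..T, indexIntegrand V T q X Z t = 0 := by
    rw [intervalIntegral.integral_congr (g := fun _ => 0) fun t ht => ?_]
    · simp
    · rw [uIcc_of_le hb] at ht
      exact h0 t ⟨(ha.trans hab).trans ht.1, ht.2⟩ fun h => absurd (hSab h).2 (not_lt.2 ht.1)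
  rw [e1, e2]
  ring

/-- A field vanishing to first order at `a` and at `b` is bounded by powers of `(t - a) (b - t)`. -/
theorem IsSmoothField.exists_norm_le_weight (hX : IsSmoothField T q X) (hT : 0 < T)
    (hq : ContMDiffOn 𝓘(ℝ, ℝ) (𝓡 n) ∞ q (Icc 0 T)) (ha : 0 ≤ a) (hab : a < b) (hb : b ≤ T)
    (hXa : X a = 0) (hXb : X b = 0) (hDa : ObstacleAvoidance.covDeriv T q X a = 0)
    (hDb : ObstacleAvoidance.covDeriv T q X b = 0) :
    ∃ N ≥ 0, ∀ t ∈ Icc a b, ‖X t‖ ≤ N * ((t - a) * (b - t)) ^ 2 ∧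
      ‖ObstacleAvoidance.covDeriv T q X t‖ ≤ N * ((t - a) * (b - t)) := by
  have hsub : Icc a b ⊆ Icc 0 T := Icc_subset_Icc ha hb
  obtain ⟨Ma, hMa, ha'⟩ := hX.exists_norm_le_sq hT hq ⟨ha, hab.le.trans hb⟩ hXa hDa
  obtain ⟨Mb, hMb, hb'⟩ := hX.exists_norm_le_sq hT hq ⟨ha.trans hab.le, hb⟩ hXb hDb
  have hL : 0 < b - a := sub_pos.2 hab
  refine ⟨(Ma + Mb) * (2 / (b - a)) ^ 2 + (Ma + Mb) * (2 / (b - a)), by positivity,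
    fun t ht => ?_⟩
  obtain ⟨a0, a1⟩ := ha' t (hsub ht)
  obtain ⟨b0, b1⟩ := hb' t (hsub ht)
  generalize ‖X t‖ = x0 at a0 b0 ⊢
  generalize ‖ObstacleAvoidance.covDeriv T q X t‖ = x1 at a1 b1 ⊢
  have hta : 0 ≤ t - a := sub_nonneg.2 ht.1
  have htb : 0 ≤ b - t := sub_nonneg.2 ht.2
  rw [abs_of_nonneg hta] at a0 a1
  rw [abs_sub_comm, abs_of_nonneg htb] at b0 b1
  -- The larger of the two factors is at least (b − a)/2, so the distance to the nearer end is
  -- controlled by the product.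
  have hm : min (t - a) (b - t) ≤ 2 / (b - a) * ((t - a) * (b - t)) := by
    rw [div_mul_eq_mul_div, le_div_iff₀ hL]
    rcases le_total (t - a) (b - t) with h | h
    · rw [min_eq_left h]; nlinarith
    · rw [min_eq_right h]; nlinarith
  have hm0 : 0 ≤ min (t - a) (b - t) := le_min hta htb
  have c0 : x0 ≤ (Ma + Mb) * min (t - a) (b - t) ^ 2 := by
    rcases le_total (t - a) (b - t) with h | h
    · rw [min_eq_left h]; linarith [mul_nonneg hMb (sq_nonneg (t - a))]
    · rw [min_eq_right h]; linarith [mul_nonneg hMa (sq_nonneg (b - t))]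
  have c1 : x1 ≤ (Ma + Mb) * min (t - a) (b - t) := by
    rcases le_total (t - a) (b - t) with h | h
    · rw [min_eq_left h]; linarith [mul_nonneg hMb hta]
    · rw [min_eq_right h]; linarith [mul_nonneg hMa htb]
  have d0 := mul_le_mul_of_nonneg_left (pow_le_pow_left₀ hm0 hm 2) (add_nonneg hMa hMb)
  have d1 := mul_le_mul_of_nonneg_left hm (add_nonneg hMa hMb)
  have w0 := mul_nonneg hta htb
  constructor
  · refine (c0.trans d0).trans ?_
    have : 0 ≤ (Ma + Mb) * (2 / (b - a)) * ((t - a) * (b - t)) ^ 2 := by positivity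
    rw [mul_pow]
    linarith
  · refine (c1.trans d1).trans ?_
    have : 0 ≤ (Ma + Mb) * (2 / (b - a)) ^ 2 * ((t - a) * (b - t)) := by positivity
    linarith

/-- The numbers r, r', r'' stand for the values of a cutoff and its first two derivatives at t.
Their possible growth like w⁻¹ and w⁻², with w = (t − a)(b − t), is compensated by DX = O(w) and X =
O(w²), so M does not depend on the cutoff. -/
theorem IsSmoothField.exists_norm_smul_le (hX : IsSmoothField T q X) (hT : 0 < T)
    (hq : ContMDiffOn 𝓘(ℝ, ℝ) (𝓡 n) ∞ q (Icc 0 T)) (ha : 0 ≤ a) (hab : a < b) (hb : b ≤ T)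
    (hXa : X a = 0) (hXb : X b = 0) (hDa : ObstacleAvoidance.covDeriv T q X a = 0)
    (hDb : ObstacleAvoidance.covDeriv T q X b = 0) {C : ℝ} (hC : 0 ≤ C) :
    ∃ M ≥ 0, ∀ t ∈ Icc a b, ∀ r r' r'' : ℝ, |r| ≤ 1 → |r'| * ((t - a) * (b - t)) ≤ C →
      |r''| * ((t - a) * (b - t)) ^ 2 ≤ C → ‖r • X t‖ ≤ M ∧
      ‖r' • X t + r • ObstacleAvoidance.covDeriv T q X t‖ ≤ M ∧
      ‖r'' • X t + (2 : ℝ) • (r' • ObstacleAvoidance.covDeriv T q X t)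
        + r • (ObstacleAvoidance.covDeriv T q)^[2] X t‖ ≤ M := by
  have hsub : Icc a b ⊆ Icc 0 T := Icc_subset_Icc ha hb
  obtain ⟨M0, hM0, h0⟩ := hX.exists_norm_le hq
  obtain ⟨M1, hM1, h1⟩ := (hX.covDeriv hT hq).exists_norm_le hq
  obtain ⟨M2, hM2, h2⟩ := (hX.covDeriv_iterate hT hq 2).exists_norm_le hq
  have hL : 0 < b - a := sub_pos.2 hab
  obtain ⟨N, hN, hw⟩ := hX.exists_norm_le_weight hT hq ha hab hb hXa hXb hDa hDb
  refine ⟨M0 + (C * N * ((b - a) * (b - a)) + M1) + (C * N + 2 * (C * N) + M2), by positivity,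
    fun t ht r r' r'' bd c1 c2 => ?_⟩
  obtain ⟨w1, w2⟩ := hw t ht
  have k0 := h0 t (hsub ht)
  have k1 := h1 t (hsub ht)
  have k2 := h2 t (hsub ht)
  have e1 := norm_add_le (r' • X t) (r • ObstacleAvoidance.covDeriv T q X t)
  have e2 := norm_add₃_le (a := r'' • X t) (b := (2 : ℝ) • (r' • ObstacleAvoidance.covDeriv T q X t))
    (c := r • (ObstacleAvoidance.covDeriv T q)^[2] X t)
  rw [norm_smul, norm_smul, Real.norm_eq_abs, Real.norm_eq_abs] at e1
  rw [norm_smul, norm_smul, norm_smul, norm_smul, Real.norm_eq_abs, Real.norm_eq_abs,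
    Real.norm_eq_abs, Real.norm_eq_abs, abs_of_pos (zero_lt_two (α := ℝ))] at e2
  have x0 := norm_nonneg (X t)
  have x1 := norm_nonneg (ObstacleAvoidance.covDeriv T q X t)
  have x2 := norm_nonneg ((ObstacleAvoidance.covDeriv T q)^[2] X t)
  rw [norm_smul, Real.norm_eq_abs]
  generalize ‖X t‖ = y0 at *
  generalize ‖ObstacleAvoidance.covDeriv T q X t‖ = y1 at *
  generalize ‖(ObstacleAvoidance.covDeriv T q)^[2] X t‖ = y2 at *
  have hw0 : 0 ≤ (t - a) * (b - t) := mul_nonneg (sub_nonneg.2 ht.1) (sub_nonneg.2 ht.2)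
  have n0 : |r| * y0 ≤ M0 := by linarith [mul_le_mul bd k0 x0 zero_le_one]
  have n1 : |r| * y1 ≤ M1 := by linarith [mul_le_mul bd k1 x1 zero_le_one]
  have n2 : |r| * y2 ≤ M2 := by linarith [mul_le_mul bd k2 x2 zero_le_one]
  have m1 : |r'| * y1 ≤ C * N := by
    linarith [mul_le_mul_of_nonneg_left w2 (abs_nonneg r'), mul_le_mul_of_nonneg_right c1 hN]
  have m2 : |r''| * y0 ≤ C * N := by
    linarith [mul_le_mul_of_nonneg_left w1 (abs_nonneg r''), mul_le_mul_of_nonneg_right c2 hN]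
  have m3 : |r'| * y0 ≤ C * N * ((b - a) * (b - a)) := by
    have hwL : (t - a) * (b - t) ≤ (b - a) * (b - a) :=
      mul_le_mul (by linarith [ht.2]) (by linarith [ht.1]) (sub_nonneg.2 ht.2) hL.le
    linarith [mul_le_mul_of_nonneg_left w1 (abs_nonneg r'),
      mul_le_mul_of_nonneg_right (mul_le_mul c1 hwL hw0 hC) hN]
  have p1 : 0 ≤ C * N * ((b - a) * (b - a)) := by positivity
  have p2 : 0 ≤ C * N := by positivity
  refine ⟨by linarith, e1.trans (by linarith), e2.trans (by linarith)⟩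

/-- A field vanishing to first order at `a` and at `b` is approximated by fields with compact support
in `(a, b)`, with uniformly bounded second derivatives. -/
theorem IsSmoothField.exists_cutoff (hX : IsSmoothField T q X) (hT : 0 < T)
    (hq : ContMDiffOn 𝓘(ℝ, ℝ) (𝓡 n) ∞ q (Icc 0 T)) (ha : 0 ≤ a) (hab : a < b) (hb : b ≤ T)
    (hXa : X a = 0) (hXb : X b = 0) (hDa : ObstacleAvoidance.covDeriv T q X a = 0)
    (hDb : ObstacleAvoidance.covDeriv T q X b = 0) :
    ∃ (A : ℕ → ∀ t, TangentSpace (𝓡 n) (q t)) (M : ℝ), 0 ≤ M ∧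
      (∀ k, IsSmoothField T q (A k) ∧ (∃ α β, a < α ∧ β < b ∧ ∀ t ∉ Icc α β, A k t = 0) ∧
        ∀ t ∈ Icc a b, ∀ i < 3, ‖(ObstacleAvoidance.covDeriv T q)^[i] (A k) t‖ ≤ M) ∧
      ∀ t ∈ Ioo a b, ∀ᶠ k in Filter.atTop, ∀ i, (ObstacleAvoidance.covDeriv T q)^[i] (A k) t
        = (ObstacleAvoidance.covDeriv T q)^[i] X t := by
  obtain ⟨φ, φ', φ'', C, hC, hφ, hφ1⟩ := ObstacleAvoidance.exists_cutoff hab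
  have hsub : Icc a b ⊆ Icc 0 T := Icc_subset_Icc ha hb
  obtain ⟨M, hM, hb⟩ := hX.exists_norm_smul_le hT hq ha hab hb hXa hXb hDa hDb hC
  refine ⟨fun k t => φ k t • X t, M, hM, fun k => ?_, fun t ht => ?_⟩
  · obtain ⟨s0, s1, d0, d1, bd, c1, c2, α, β, hα, hβ, hz⟩ := hφ k
    refine ⟨hX.smul s0.contDiffOn hq, ⟨α, β, hα, hβ, fun t ht => by
      beta_reduce; rw [hz t ht, zero_smul]⟩,
      fun t ht i hi => ?_⟩
    obtain ⟨b0, b1, b2⟩ := hb t ht (φ k t) (φ' k t) (φ'' k t) (bd t) (c1 t ht) (c2 t ht)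
    interval_cases i
    · exact b0
    · have e := covDeriv_smul hT hq hX s0.contDiffOn (d0 t).hasDerivWithinAt (hsub ht)
      rw [Function.iterate_one, e]
      exact b1
    · rw [covDeriv_two_smul hT hq hX s0 s1 d0 d1 (hsub ht)]
      exact b2
  · filter_upwards [hφ1 t ht] with k hk i
    refine covDeriv_iterate_eventuallyEq (X' := X) (mem_nhdsWithin_of_mem_nhds ?_) (hsub
      (Ioo_subset_Icc_self ht)) i
    filter_upwards [hk] with s hs
    rw [hs, one_smul]

end CutoffField

/-! ### A compactly supported field on which the index form is negative. -/

section NegativeDirection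

variable {n : ℕ} {Q : Type*} [TopologicalSpace Q] [ChartedSpace (EuclideanSpace ℝ (Fin n)) Q]
  [IsManifold (𝓡 n) ∞ Q] [RiemannianBundle (fun x : Q => TangentSpace (𝓡 n) x)]

local notation "𝔼" => EuclideanSpace ℝ (Fin n)

variable {T t a b : ℝ} {q : ℝ → Q} {x : Q} {X Y Z : ∀ t, TangentSpace (𝓡 n) (q t)} {V : Q → ℝ}

/-- The vector field along `q` with coordinates `f` in the chart at `x`. -/
def ofCoord (x : Q) (q : ℝ → Q) (f : ℝ → 𝔼) (t : ℝ) : TangentSpace (𝓡 n) (q t) :=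
  unrep x (q t) (f t)

theorem coord_ofCoord {f : ℝ → 𝔼} (hx : q t ∈ (extChartAt (𝓡 n) x).source) :
    coord x q (ofCoord x q f) t = f t := rep_unrep hx (f t)

theorem ofCoord_eq_zero {f : ℝ → 𝔼} (h : f t = 0) : ofCoord x q f t = 0 := by
  rw [ofCoord, h]
  exact map_zero (unrep x (q t))

theorem isSmoothField_ofCoord (hq : ContMDiffOn 𝓘(ℝ, ℝ) (𝓡 n) ∞ q (Icc 0 T)) {f : ℝ → 𝔼}
    (hf : ContDiff ℝ ∞ f) {J S : Set ℝ} (hJ : IsOpen J) (hS : IsClosed S) (hSJ : S ⊆ J)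
    (hx : ∀ t ∈ J, q t ∈ (extChartAt (𝓡 n) x).source) (hfS : ∀ t ∉ S, f t = 0) :
    IsSmoothField T q (ofCoord x q f) := by
  intro t ht
  by_cases htJ : t ∈ J
  · refine (contMDiffWithinAt_field_iff (hx t htJ)).2 ⟨hq t ht, ?_⟩
    refine (hf.contDiffAt.congr_of_eventuallyEq ?_).contDiffWithinAt
    filter_upwards [hJ.mem_nhds htJ] with s hs using coord_ofCoord (hx s hs)
  · refine (contMDiffWithinAt_field_iff (mem_extChartAt_source (q t))).2 ⟨hq t ht, ?_⟩
    refine ((contDiffAt_const (c := (0 : 𝔼))).congr_of_eventuallyEq ?_).contDiffWithinAt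
    filter_upwards [hS.isOpen_compl.mem_nhds fun h => htJ (hSJ h)] with s hs
    exact (congrArg (rep (q t) (q s)) (ofCoord_eq_zero (hfS s hs))).trans (map_zero (rep (q t) (q s)))

variable [IsContMDiffRiemannianBundle (𝓡 n) ∞ (EuclideanSpace ℝ (Fin n))
    (fun x : Q => TangentSpace (𝓡 n) x)]

/-- A field with given first jet, supported in a small neighbourhood. -/
theorem exists_field_with_jet (hq : ContMDiffOn 𝓘(ℝ, ℝ) (𝓡 n) ∞ q (Icc 0 T)) {t₀ : ℝ}
    (ht₀ : t₀ ∈ Ioo 0 T) {U : Set ℝ} (hU : U ∈ 𝓝 t₀) (u v : TangentSpace (𝓡 n) (q t₀)) :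
    ∃ (Z : ∀ t, TangentSpace (𝓡 n) (q t)) (r : ℝ), IsSmoothField T q Z ∧
      Metric.ball t₀ (2 * r) ⊆ Ioo 0 T ∩ U ∧
      (∀ t ∈ Metric.ball t₀ (2 * r), q t ∈ (extChartAt (𝓡 n) (q t₀)).source) ∧ 0 < r ∧
      (∀ t ∉ Metric.closedBall t₀ r, Z t = 0) ∧ Z t₀ = u ∧ covDeriv T q Z t₀ = v := by
  have hI : Icc 0 T ∈ 𝓝 t₀ := Icc_mem_nhds ht₀.1 ht₀.2
  have hI' : t₀ ∈ Icc 0 T := Ioo_subset_Icc_self ht₀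
  have hs := (eventually_mem_source ((hq t₀ hI').continuousWithinAt)
    (mem_extChartAt_source (I := 𝓡 n) (q t₀)))
  rw [nhdsWithin_eq_nhds.2 hI] at hs
  obtain ⟨ε, hε, hball⟩ := Metric.mem_nhds_iff.1
    (Filter.inter_mem (Filter.inter_mem (Ioo_mem_nhds ht₀.1 ht₀.2) hU) hs)
  let ρ : ContDiffBump t₀ := ⟨ε / 4, ε / 2, by positivity, by linarith⟩
  have h2 : 2 * (ε / 2) = ε := by ring
  set w : 𝔼 := velocity T q t₀
  set u' : 𝔼 := u
  set v' : 𝔼 := v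
  -- Near t₀ the coordinates of the field are affine in t. The Christoffel term is subtracted from
  -- the slope so that the covariant derivative at t₀, and not the coordinate derivative, equals v.
  set v₁ : 𝔼 := v' - christoffelL (q t₀) (extChartAt (𝓡 n) (q t₀) (q t₀)) w u' with hv₁
  set f : ℝ → 𝔼 := fun t => ρ t • (u' + (t - t₀) • v₁) with hf
  have hx : ∀ t ∈ Metric.ball t₀ ε, q t ∈ (extChartAt (𝓡 n) (q t₀)).source := fun t ht => (hball ht).2
  have hfS : ∀ t ∉ Metric.closedBall t₀ (ε / 2), f t = 0 := fun t ht => by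
    have : ρ t = 0 := ρ.zero_of_le_dist (not_le.1 ht).le
    rw [hf]
    simp only [this, zero_smul]
  have hsub : Metric.closedBall t₀ (ε / 2) ⊆ Metric.ball t₀ ε :=
    Metric.closedBall_subset_ball (by linarith)
  have hfs : ContDiff ℝ ∞ f := ρ.contDiff.smul (contDiff_const.add
    ((contDiff_id.sub contDiff_const).smul contDiff_const))
  have hZ := isSmoothField_ofCoord hq hfs Metric.isOpen_ball Metric.isClosed_closedBall hsub hx hfS
  have e : coord (q t₀) q (ofCoord (q t₀) q f) =ᶠ[𝓝 t₀] fun t => u' + (t - t₀) • v₁ := by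
    filter_upwards [Metric.ball_mem_nhds t₀ hε, Metric.closedBall_mem_nhds t₀
      (show 0 < ε / 4 by positivity)] with t ht ht'
    rw [coord_ofCoord (hx t ht), hf]
    simp only [ρ.one_of_mem_closedBall ht', one_smul]
  have e0 : coord (q t₀) q (ofCoord (q t₀) q f) t₀ = u' := by
    rw [e.eq_of_nhds, sub_self, zero_smul, add_zero]
  have e1 : derivWithin (coord (q t₀) q (ofCoord (q t₀) q f)) (Icc 0 T) t₀ = v₁ := by
    rw [derivWithin_of_mem_nhds hI, e.deriv_eq]
    have : HasDerivAt (fun t : ℝ => u' + (t - t₀) • v₁) ((1 : ℝ) • v₁) t₀ :=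
      (((hasDerivAt_id t₀).sub_const t₀).smul_const v₁).const_add u'
    rw [this.deriv, one_smul]
  refine ⟨ofCoord (q t₀) q f, ε / 2, hZ, ?_, ?_, by positivity, fun t ht =>
    ofCoord_eq_zero (hfS t ht), ?_, ?_⟩
  · rw [h2]; exact fun t ht => (hball ht).1
  · rw [h2]; exact hx
  · exact (coord_self (ofCoord (q t₀) q f) t₀).symm.trans e0
  · have h := coord_covDeriv_self (T := T) (ofCoord (q t₀) q f) t₀
    rw [e1, e0, coord_self, coord_self, hv₁] at h
    exact h.trans (sub_add_cancel v' _)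

set_option maxHeartbeats 1600000 in
/-- The index form is negative on some field with compact support in `(0, T)`. -/
theorem exists_indexForm_neg (hV : ContMDiff (𝓡 n) 𝓘(ℝ, ℝ) ∞ V)
    (hq : IsModifiedCubic (n := n) V T q) (hX : IsSmoothField T q X)
    (hJ : ∀ t ∈ Icc 0 T, jacobiField V T q X t = 0) (hne : ∃ t ∈ Icc 0 T, X t ≠ 0)
    (ha : 0 ≤ a) (hab : a < b) (hb : b < T) (hXa : X a = 0) (hXb : X b = 0)
    (hDa : covDeriv T q X a = 0) (hDb : covDeriv T q X b = 0) :
    ∃ (W : ∀ t, TangentSpace (𝓡 n) (q t)) (α β : ℝ), IsSmoothField T q W ∧ 0 < α ∧ β < T ∧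
      (∀ t ∉ Icc α β, W t = 0) ∧ indexForm V T q W W < 0 := by
  have hb0 : 0 < b := ha.trans_lt hab
  have hT : 0 < T := hb0.trans hb
  have haT : a ∈ Icc 0 T := ⟨ha, (hab.trans hb).le⟩
  have hbT : b ∈ Icc 0 T := ⟨hb0.le, hb.le⟩
  have hsub : Icc a b ⊆ Icc 0 T := Icc_subset_Icc ha hb.le
  obtain ⟨A, M, hM, hA, hAX⟩ := hX.exists_cutoff hT hq.1 ha hab hb.le hXa hXb hDa hDb
  -- The 1-jet of Z at b turns the boundary term ⟨D²X, DZ⟩ − ⟨D³X, Z⟩ into a sum of squares. The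
  -- support avoids a, so no contribution comes from the left end, and it lies in (0, T) because b <
  -- T.
  obtain ⟨Z, r, hZ, hball, hx, hr, hZ0, hZb, hDZb⟩ := exists_field_with_jet hq.1 ⟨hb0, hb⟩
    (Ioi_mem_nhds hab) (-(covDeriv T q)^[3] X b) ((covDeriv T q)^[2] X b)
  have hSJ : Metric.closedBall b r ⊆ Metric.ball b (2 * r) :=
    Metric.closedBall_subset_ball (by linarith)
  have hZS : ∀ t ∈ Icc 0 T, t ∉ Metric.closedBall b r → Z t = 0 := fun t _ ht => hZ0 t ht
  have haS : a ∉ Metric.closedBall b r := fun h => lt_irrefl a (hball (hSJ h)).2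
  have hcomm : ∀ k, indexForm V T q Z (A k) = indexForm V T q (A k) Z := fun k =>
    indexForm_comm hV hT hq hZ (hA k).1 Metric.isOpen_ball (fun t ht => (hball ht).1) hx
      Metric.isClosed_closedBall hSJ hZS
  obtain ⟨M0, hM0, h0⟩ := hZ.exists_norm_le hq.1
  obtain ⟨M1, hM1, h1⟩ := (hZ.covDeriv hT hq.1).exists_norm_le hq.1
  obtain ⟨M2, hM2, h2⟩ := (hZ.covDeriv_iterate hT hq.1 2).exists_norm_le hq.1
  have hZM : ∀ t ∈ Icc a b, ∀ i < 3, ‖(covDeriv T q)^[i] Z t‖ ≤ M + (M0 + M1 + M2) := by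
    intro t ht i hi
    have k0 := h0 t (hsub ht)
    have k1 := h1 t (hsub ht)
    have k2 := h2 t (hsub ht)
    interval_cases i
    · exact k0.trans (by linarith)
    · exact k1.trans (by linarith)
    · exact k2.trans (by linarith)
  have hAM : ∀ k, ∀ t ∈ Icc a b, ∀ i < 3, ‖(covDeriv T q)^[i] (A k) t‖ ≤ M + (M0 + M1 + M2) :=
    fun k t ht i hi => ((hA k).2.2 t ht i hi).trans (by linarith)
  have hMM : 0 ≤ M + (M0 + M1 + M2) := by linarith
  have hint : ∀ k, ∀ {B : ∀ t, TangentSpace (𝓡 n) (q t)}, IsSmoothField T q B →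
      indexForm V T q (A k) B = ∫ t in a..b, indexIntegrand V T q (A k) B t := by
    intro k B hB
    obtain ⟨α, β, hα, hβ, hz⟩ := (hA k).2.1
    exact indexForm_eq_integral hV hT hq.1 ha hab.le hb.le (hA k).1 hB (isClosed_Icc (a := α) (b := β))
      (Icc_subset_Ioo hα hβ) fun t _ ht => hz t ht
  have l1 := tendsto_integral_indexIntegrand hV hT hq.1 ha hab.le hb.le (fun k => (hA k).1)
    (fun k => (hA k).1) hMM hAM hAM hAX hAX
  have l2 := tendsto_integral_indexIntegrand (Z := Z) hV hT hq.1 ha hab.le hb.le (fun k => (hA k).1)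
    (B := fun _ => Z) (fun _ => hZ) hMM hAM (fun _ => hZM) hAX
    (fun t _ => .of_forall fun _ _ => rfl)
  simp only [← hint _ (hA _).1] at l1
  simp only [← hint _ hZ] at l2
  rw [integral_indexIntegrand hV hT hq.1 hX hX hJ ha hab.le hb.le] at l1
  rw [integral_indexIntegrand hV hT hq.1 hX hZ hJ ha hab.le hb.le] at l2
  have z := covDeriv_iterate_eq_zero (X := Z) Metric.isClosed_closedBall hZS
  have v1 : jetInner T q X X 2 1 b - jetInner T q X X 3 0 b
      - (jetInner T q X X 2 1 a - jetInner T q X X 3 0 a) = 0 := by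
    simp only [jetInner, Function.iterate_one, Function.iterate_zero, id, hXa, hXb, hDa, hDb,
      metricAt_zero_right, sub_zero]
  have v2 : jetInner T q X Z 2 1 b - jetInner T q X Z 3 0 b
      - (jetInner T q X Z 2 1 a - jetInner T q X Z 3 0 a)
      = ‖(covDeriv T q)^[2] X b‖ ^ 2 + ‖(covDeriv T q)^[3] X b‖ ^ 2 := by
    rw [jetInner, jetInner, jetInner, jetInner, z 1 a haT haS, z 0 a haT haS, metricAt_zero_right,
      metricAt_zero_right, Function.iterate_one, Function.iterate_zero, id, hZb, hDZb,
      ← metricAt_self, ← metricAt_self, ← neg_one_smul ℝ ((covDeriv T q)^[3] X b),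
      metricAt_smul_right]
    ring
  -- Otherwise the whole 3-jet of X vanishes at b, and uniqueness for the Jacobi equation makes X
  -- zero on [0, T].
  have hpos : 0 < ‖(covDeriv T q)^[2] X b‖ ^ 2 + ‖(covDeriv T q)^[3] X b‖ ^ 2 := by
    by_contra hcon
    obtain ⟨s, hs, hsX⟩ := hne
    refine hsX (hX.eq_zero_of_jacobi hV hT hq.1 hJ hbT (fun i hi => ?_) s hs)
    have n2 : (covDeriv T q)^[2] X b = 0 := by
      rw [← norm_eq_zero, ← sq_eq_zero_iff]
      nlinarith [sq_nonneg ‖(covDeriv T q)^[2] X b‖, sq_nonneg ‖(covDeriv T q)^[3] X b‖]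
    have n3 : (covDeriv T q)^[3] X b = 0 := by
      rw [← norm_eq_zero, ← sq_eq_zero_iff]
      nlinarith [sq_nonneg ‖(covDeriv T q)^[2] X b‖, sq_nonneg ‖(covDeriv T q)^[3] X b‖]
    interval_cases i
    · exact hXb
    · exact hDb
    · exact n2
    · exact n3
  rw [v1] at l1
  rw [v2] at l2
  set B := ‖(covDeriv T q)^[2] X b‖ ^ 2 + ‖(covDeriv T q)^[3] X b‖ ^ 2
  set c := indexForm V T q Z Z
  -- The limit of the index form of A k + u Z is 2uB + u²c. For this u one has |u c| ≤ B, so the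
  -- quadratic term is at most −uB and the sum is at most uB < 0.
  set u : ℝ := -(B / (|c| + 1)) with hu
  have hc1 : 0 < |c| + 1 := by positivity
  have hlim : Filter.Tendsto (fun k => indexForm V T q (A k) (A k)
      + u * (indexForm V T q (A k) Z + indexForm V T q Z (A k)) + u ^ 2 * c) Filter.atTop
      (𝓝 (0 + u * (B + B) + u ^ 2 * c)) := by
    simp only [hcomm]
    exact (l1.add ((l2.add l2).const_mul u)).add_const _
  have hneg : 0 + u * (B + B) + u ^ 2 * c < 0 := by
    have e1 : u * (|c| + 1) = -B := by rw [hu]; field_simp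
    have hu0 : u < 0 := by rw [hu]; exact neg_neg_of_pos (div_pos hpos hc1)
    nlinarith [le_abs_self c, sq_nonneg u, mul_le_mul_of_nonneg_left (le_abs_self c) (sq_nonneg u),
      mul_neg_of_neg_of_pos hu0 hpos]
  -- A strict inequality in the limit already holds for some k, which gives a smooth field with
  -- compact support in place of the broken limit field.
  obtain ⟨k, hk⟩ := (hlim.eventually (gt_mem_nhds hneg)).exists
  obtain ⟨α, β, hα, hβ, hz⟩ := (hA k).2.1
  have hbr : b - r ∈ Metric.closedBall b r := by
    rw [Real.closedBall_eq_Icc]; exact ⟨le_rfl, by linarith⟩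
  have hbr' : b + r ∈ Metric.closedBall b r := by
    rw [Real.closedBall_eq_Icc]; exact ⟨by linarith, le_rfl⟩
  refine ⟨fun t => A k t + u • Z t, min α (b - r), max β (b + r), (hA k).1.add
    (hZ.smul (φ := fun _ => u) contDiffOn_const hq.1) hq.1, lt_min (ha.trans_lt hα)
    (hball (hSJ hbr)).1.1, max_lt (hβ.trans hb) (hball (hSJ hbr')).1.2, fun t ht => ?_, ?_⟩
  · have e1 : A k t = 0 := hz t fun h => ht ⟨(min_le_left _ _).trans h.1, h.2.trans (le_max_left _ _)⟩
    have e2 : Z t = 0 := hZ0 t fun h => by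
      rw [Real.closedBall_eq_Icc] at h
      exact ht ⟨(min_le_right _ _).trans h.1, h.2.trans (le_max_right _ _)⟩
    beta_reduce
    rw [e1, e2, smul_zero, add_zero]
  · rw [indexForm_add_smul hV hT hq.1 (hA k).1 hZ]
    exact hk

end NegativeDirection

/-! ### Construction of variations with prescribed variation field. -/

section Variation

variable {n : ℕ} {Q : Type*} [TopologicalSpace Q] [ChartedSpace (EuclideanSpace ℝ (Fin n)) Q]
  [IsManifold (𝓡 n) ∞ Q] [RiemannianBundle (fun x : Q => TangentSpace (𝓡 n) x)]

local notation "𝔼" => EuclideanSpace ℝ (Fin n)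

variable {T t a b α β δ : ℝ} {q : ℝ → Q} {x : Q} {W W₀ X Y Z : ∀ t, TangentSpace (𝓡 n) (q t)}
  {f : ℝ → ℝ → Q}

/-- `f` is a smooth variation of `q` with variational field `W`, for `|s| < δ`, fixed outside
`[α, β]`. -/
structure IsVariation (T : ℝ) (q : ℝ → Q) (α β : ℝ) (W : ∀ t, TangentSpace (𝓡 n) (q t))
    (f : ℝ → ℝ → Q) (δ : ℝ) : Prop where
  pos : 0 < δ
  smooth : ContMDiffOn 𝓘(ℝ, ℝ × ℝ) (𝓡 n) ∞ (fun p : ℝ × ℝ => f p.1 p.2) (Ioo (-δ) δ ×ˢ Ioo 0 T)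
  off : ∀ s, ∀ t ∉ Icc α β, f s t = q t
  zero : ∀ t, f 0 t = q t
  deriv : ∀ x, ∀ t ∈ Ioo 0 T, q t ∈ (extChartAt (𝓡 n) x).source →
    HasDerivAt (fun s => extChartAt (𝓡 n) x (f s t)) (coord x q W t) 0

theorem isOpen_strip (δ T : ℝ) : IsOpen (Ioo (-δ) δ ×ˢ Ioo 0 T) := isOpen_Ioo.prod isOpen_Ioo

theorem isVariation_refl (hq : ContMDiffOn 𝓘(ℝ, ℝ) (𝓡 n) ∞ q (Icc 0 T)) :
    IsVariation (n := n) T q α β (fun _ => 0) (fun _ t => q t) 1 where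
  pos := one_pos
  smooth := hq.comp (f := (Prod.snd : ℝ × ℝ → ℝ)) contDiff_snd.contMDiff.contMDiffOn
    fun p hp => Ioo_subset_Icc_self hp.2
  off := fun _ _ _ => rfl
  zero := fun _ => rfl
  deriv := fun x t _ _ => (hasDerivAt_const (0 : ℝ) (extChartAt (𝓡 n) x (q t))).congr_deriv
    (map_zero (rep (n := n) x (q t))).symm

/-- The derivative of a family of points in two charts. -/
theorem hasDerivAt_chart_change {c : ℝ → Q} {p x x' : Q} (hc : ContinuousAt c 0) (hp : c 0 = p)
    (hx : p ∈ (extChartAt (𝓡 n) x).source) (hx' : p ∈ (extChartAt (𝓡 n) x').source) {v : 𝔼}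
    (h : HasDerivAt (fun s => extChartAt (𝓡 n) x (c s)) (rep x p v) 0) :
    HasDerivAt (fun s => extChartAt (𝓡 n) x' (c s)) (rep x' p v) 0 := by
  subst hp
  have h1 := (ContDiffOn.differentiableAt_of_isOpen (contDiffOn_transition x x')
    (isOpen_transitionSource x x') (mem_transitionSource hx hx')).hasFDerivAt
  have h2 := (h1.comp_hasDerivAt (0 : ℝ) h).congr_deriv (fderiv_transition_rep hx hx' v)
  refine h2.congr_of_eventuallyEq ?_
  filter_upwards [hc.eventually ((isOpen_extChartAt_source x).mem_nhds hx)] with s hs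
  exact (transition_apply hs).symm

namespace IsVariation

theorem mem_source_deriv (h : IsVariation T q α β W f δ) (ht : t ∈ Ioo 0 T)
    (hx : q t ∈ (extChartAt (𝓡 n) x).source) {f' : ℝ → ℝ → Q}
    (hc : ContinuousAt (fun s => f' s t) 0) (h0 : f' 0 t = q t)
    {Z : ∀ t, TangentSpace (𝓡 n) (q t)}
    (hf' : ∀ᶠ s in 𝓝 0, extChartAt (𝓡 n) x (f' s t)
      = extChartAt (𝓡 n) x (f s t) + s • coord x q Z t) {x' : Q}
    (hx' : q t ∈ (extChartAt (𝓡 n) x').source) :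
    HasDerivAt (fun s => extChartAt (𝓡 n) x' (f' s t)) (coord x' q (fun t => W t + Z t) t) 0 := by
  have h1 : HasDerivAt (fun s => extChartAt (𝓡 n) x (f' s t)) (coord x q (fun t => W t + Z t) t) 0 := by
    have h2 := (h.deriv x t ht hx).add ((hasDerivAt_id (0 : ℝ)).smul_const (coord x q Z t))
    rw [one_smul, ← coord_add] at h2
    exact h2.congr_of_eventuallyEq hf'
  exact hasDerivAt_chart_change hc h0 hx hx' h1

/-- A variation can be modified in a chart. -/
theorem exists_add (h : IsVariation T q α β W₀ f δ) (hZ : IsSmoothField T q Z)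
    (hZαβ : ∀ t ∉ Icc α β, Z t = 0) {J S K : Set ℝ} (hJ : IsOpen J)
    (hJT : J ⊆ Ioo 0 T) (hx : ∀ t ∈ J, q t ∈ (extChartAt (𝓡 n) x).source) (hS : IsClosed S)
    (hSK : S ⊆ interior K) (hK : IsCompact K) (hKJ : K ⊆ J) (hZS : ∀ t ∉ S, Z t = 0) :
    ∃ f' δ', IsVariation T q α β (fun t => W₀ t + Z t) f' δ' := by
  classical
  set φ := extChartAt (𝓡 n) x with hφ
  set z : ℝ → 𝔼 := coord x q Z with hz
  have hz0 : ∀ t, Z t = 0 → z t = 0 := fun t ht => by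
    rw [hz, coord, ht]; exact map_zero (rep x (q t))
  set D := Ioo (-δ) δ ×ˢ Ioo 0 T with hD
  have hDo : IsOpen D := isOpen_strip δ T
  set D₁ : Set (ℝ × ℝ) := D ∩ ((fun p : ℝ × ℝ => f p.1 p.2) ⁻¹' φ.source) with hD₁
  have hD₁o : IsOpen D₁ := h.smooth.continuousOn.isOpen_inter_preimage hDo (isOpen_extChartAt_source x)
  set D₂ : Set (ℝ × ℝ) := D₁ ∩ Prod.snd ⁻¹' J with hD₂
  have hD₂o : IsOpen D₂ := hD₁o.inter (hJ.preimage continuous_snd)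
  set c : ℝ × ℝ → 𝔼 := fun p => φ (f p.1 p.2) + p.1 • z p.2 with hc
  have hcs : ContDiffOn ℝ ∞ c D₂ := by
    intro p hp
    have e1 : ContDiffAt ℝ ∞ (fun p : ℝ × ℝ => φ (f p.1 p.2)) p := by
      have k1 : ContMDiffAt (𝓡 n) 𝓘(ℝ, 𝔼) ∞ φ (f p.1 p.2) :=
        contMDiffAt_extChartAt' (by simpa [hφ] using hp.1.2)
      have k2 := h.smooth.contMDiffAt (hDo.mem_nhds hp.1.1)
      exact contMDiffAt_iff_contDiffAt.1 (ContMDiffAt.comp p k1 k2)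
    have e2 : ContDiffAt ℝ ∞ (fun p : ℝ × ℝ => z p.2) p :=
      ((hZ.contDiffWithinAt (Ioo_subset_Icc_self hp.1.1.2) (hx _ hp.2)).contDiffAt
        (Icc_mem_nhds hp.1.1.2.1 hp.1.1.2.2)).comp p contDiffAt_snd
    exact (e1.add (contDiffAt_fst.smul e2)).contDiffWithinAt
  set G : Set (ℝ × ℝ) := D₂ ∩ c ⁻¹' φ.target with hG
  have hGo : IsOpen G := hcs.continuousOn.isOpen_inter_preimage hD₂o (isOpen_extChartAt_target x)
  have hG0 : ({0} : Set ℝ) ×ˢ K ⊆ G := by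
    rintro ⟨s, t⟩ ⟨hs, ht⟩
    rw [mem_singleton_iff] at hs
    subst hs
    have htx := hx t (hKJ ht)
    refine ⟨⟨⟨⟨⟨neg_lt_zero.2 h.pos, h.pos⟩, hJT (hKJ ht)⟩, ?_⟩, hKJ ht⟩, ?_⟩
    · simpa only [mem_preimage, h.zero t] using htx
    · simpa only [hc, mem_preimage, h.zero t, zero_smul, add_zero] using φ.map_source htx
  -- Compactness of K provides one range of s for which the displaced points stay in the chart for
  -- all t in K.
  obtain ⟨u, v, hu, hv, h0u, hKv, huv⟩ := generalized_tube_lemma isCompact_singleton hK hGo hG0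
  obtain ⟨ε, hε, hεu⟩ := Metric.isOpen_iff.1 hu 0 (h0u rfl)
  -- On K outside S the field vanishes and both branches agree. As K is a neighbourhood of S, the
  -- first formula holds near every point of S, which gives smoothness across its boundary.
  set f' : ℝ → ℝ → Q := fun s t => if t ∈ S then φ.symm (c (s, t)) else f s t with hf'
  have hin : ∀ s ∈ Ioo (-(min ε δ)) (min ε δ), ∀ t ∈ K, (s, t) ∈ G := fun s hs t ht =>
    huv ⟨hεu (by
      rw [Metric.mem_ball, dist_zero_right, Real.norm_eq_abs]
      exact (abs_lt.2 hs).trans_le (min_le_left _ _)), hKv ht⟩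
  have hpos : 0 < min ε δ := lt_min hε h.pos
  have hfK : ∀ s ∈ Ioo (-(min ε δ)) (min ε δ), ∀ t ∈ K, f' s t = φ.symm (c (s, t)) := by
    intro s hs t ht
    by_cases htS : t ∈ S
    · simp [hf', htS]
    · simp only [hf', htS, if_false, hc, hz0 t (hZS t htS), smul_zero, add_zero]
      exact (φ.left_inv (hin s hs t ht).1.1.2).symm
  have hoff : ∀ s, ∀ t, t ∉ Icc α β → f' s t = q t := by
    intro s t ht
    by_cases htS : t ∈ S
    · simp only [hf', htS, if_true, hc, hz0 t (hZαβ t ht), smul_zero, add_zero, h.off s t ht]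
      exact φ.left_inv (hx t (hKJ (interior_subset (hSK htS))))
    · simp [hf', htS, h.off s t ht]
  have hzero : ∀ t, f' 0 t = q t := by
    intro t
    by_cases htS : t ∈ S
    · simp only [hf', htS, if_true, hc, zero_smul, add_zero, h.zero]
      exact φ.left_inv (hx t (hKJ (interior_subset (hSK htS))))
    · simp [hf', htS, h.zero]
  have hsm : ContMDiffOn 𝓘(ℝ, ℝ × ℝ) (𝓡 n) ∞ (fun p : ℝ × ℝ => f' p.1 p.2)
      (Ioo (-(min ε δ)) (min ε δ) ×ˢ Ioo 0 T) := by
    rintro ⟨s, t⟩ ⟨hs, ht⟩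
    refine ContMDiffAt.contMDiffWithinAt ?_
    by_cases htS : t ∈ S
    · have htK := hin s hs t (interior_subset (hSK htS))
      have k1 : ContMDiffAt 𝓘(ℝ, 𝔼) (𝓡 n) ∞ φ.symm (c (s, t)) :=
        (contMDiffOn_extChartAt_symm x).contMDiffAt ((isOpen_extChartAt_target x).mem_nhds htK.2)
      have k2 : ContMDiffAt 𝓘(ℝ, ℝ × ℝ) 𝓘(ℝ, 𝔼) ∞ c (s, t) :=
        contMDiffAt_iff_contDiffAt.2 (hcs.contDiffAt (hD₂o.mem_nhds htK.1))
      refine (ContMDiffAt.comp (s, t) k1 k2).congr_of_eventuallyEq ?_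
      filter_upwards [prod_mem_nhds (isOpen_Ioo.mem_nhds hs) (isOpen_interior.mem_nhds (hSK htS))]
        with p hp using hfK p.1 hp.1 p.2 (interior_subset hp.2)
    · have hp : (s, t) ∈ D := ⟨⟨(neg_le_neg (min_le_right _ _)).trans_lt hs.1,
        hs.2.trans_le (min_le_right _ _)⟩, ht⟩
      refine (h.smooth.contMDiffAt (hDo.mem_nhds hp)).congr_of_eventuallyEq ?_
      filter_upwards [prod_mem_nhds Filter.univ_mem (hS.isOpen_compl.mem_nhds htS)] with p hp
      simp [hf', show p.2 ∉ S from hp.2]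
  refine ⟨f', min ε δ, hpos, hsm, hoff, hzero, fun x' t ht hx' => ?_⟩
  have hcont : ContinuousAt (fun s => f' s t) 0 := by
    have hp : ((0 : ℝ), t) ∈ Ioo (-(min ε δ)) (min ε δ) ×ˢ Ioo 0 T := ⟨⟨neg_lt_zero.2 hpos, hpos⟩, ht⟩
    have h1 := hsm.continuousOn.continuousAt ((isOpen_strip _ T).mem_nhds hp)
    exact h1.comp (f := fun s : ℝ => (s, t)) (by fun_prop)
  by_cases htS : t ∈ S
  · have htK := interior_subset (hSK htS)
    refine h.mem_source_deriv ht (hx t (hKJ htK)) hcont (hzero t) ?_ hx'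
    filter_upwards [Ioo_mem_nhds (neg_lt_zero.2 hpos) hpos] with s hs
    rw [hfK s hs t htK]
    exact φ.right_inv (hin s hs t htK).2
  · refine h.mem_source_deriv ht hx' hcont (hzero t) (.of_forall fun s => ?_) hx'
    simp only [hf', htS, if_false]
    rw [coord, hZS t htS]
    erw [map_zero (rep x' (q t))]
    rw [smul_zero, add_zero]

end IsVariation

/-- Every field with compact support in `(0, T)` is the variational field of a variation. -/
theorem exists_isVariation (hq : ContMDiffOn 𝓘(ℝ, ℝ) (𝓡 n) ∞ q (Icc 0 T)) (hα : 0 < α) (hβ : β < T)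
    (hW : IsSmoothField T q W) (hWαβ : ∀ t ∉ Icc α β, W t = 0) :
    ∃ f δ, IsVariation T q α β W f δ := by
  -- There is no global way of adding a field to a curve without geodesics, so the field is added
  -- one chart at a time. The property says that a cutoff of the field, equal to the field on S, can
  -- be added to an arbitrary variation already constructed; this form is stable under unions.
  let p : Set ℝ → Prop := fun S => ∃ ρ : ℝ → ℝ, ContDiff ℝ ∞ ρ ∧ (∀ t ∈ S, ρ t = 1) ∧
    ∀ (W W₀ : ∀ t, TangentSpace (𝓡 n) (q t)), IsSmoothField T q W → (∀ t ∉ Icc α β, W t = 0) →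
      (∃ f δ, IsVariation T q α β W₀ f δ) →
      ∃ f δ, IsVariation T q α β (fun t => W₀ t + ρ t • W t) f δ
  have key : p (Icc α β) := by
    refine isCompact_Icc.induction_on (p := p) ?_ ?_ ?_ ?_
    · refine ⟨fun _ => 0, contDiff_const, by simp, fun W W₀ _ _ h => ?_⟩
      simpa using h
    · rintro S S' h ⟨ρ, hρ, h1, H⟩
      exact ⟨ρ, hρ, fun t ht => h1 t (h ht), H⟩
    · rintro S S' ⟨ρ, hρ, h1, H⟩ ⟨ρ', hρ', h1', H'⟩
      -- First ρ W is added, then ρ' times the remainder (1 − ρ) W. The total factor 1 − (1 − ρ)(1 −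
      -- ρ') equals 1 wherever ρ or ρ' does.
      refine ⟨fun t => ρ t + ρ' t * (1 - ρ t), hρ.add (hρ'.mul (contDiff_const.sub hρ)),
        fun t ht => ?_, fun W W₀ hW hWz h0 => ?_⟩
      · rcases ht with ht | ht
        · simp [h1 t ht]
        · simp [h1' t ht]
      · have h2 := H' (fun t => (1 - ρ t) • W t) _
          (hW.smul (φ := fun t => 1 - ρ t) (contDiff_const.sub hρ).contDiffOn hq)
          (fun t ht => by rw [hWz t ht, smul_zero]) (H W W₀ hW hWz h0)
        have e : (fun t => W₀ t + ρ t • W t + ρ' t • (1 - ρ t) • W t)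
            = fun t => W₀ t + (ρ t + ρ' t * (1 - ρ t)) • W t := by
          funext t
          rw [add_smul, mul_smul, add_assoc]
        rwa [e] at h2
    · intro t₀ ht₀
      have ht : t₀ ∈ Ioo 0 T := ⟨hα.trans_le ht₀.1, ht₀.2.trans_lt hβ⟩
      have hI : Icc 0 T ∈ 𝓝 t₀ := Icc_mem_nhds ht.1 ht.2
      have hs := (eventually_mem_source ((hq t₀ (Ioo_subset_Icc_self ht)).continuousWithinAt)
        (mem_extChartAt_source (I := 𝓡 n) (q t₀)))
      rw [nhdsWithin_eq_nhds.2 hI] at hs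
      obtain ⟨ε, hε, hball⟩ := Metric.mem_nhds_iff.1
        (Filter.inter_mem (Ioo_mem_nhds ht.1 ht.2) hs)
      let ρ : ContDiffBump t₀ := ⟨ε / 4, ε / 2, by positivity, by linarith⟩
      refine ⟨Metric.ball t₀ (ε / 4), mem_nhdsWithin_of_mem_nhds (Metric.ball_mem_nhds _ (by positivity)),
        ρ, ρ.contDiff, fun t ht => ρ.one_of_mem_closedBall (Metric.ball_subset_closedBall ht),
        fun W W₀ hW hWz ⟨f, δ, h⟩ => ?_⟩
      refine h.exists_add (x := q t₀) (hW.smul ρ.contDiff.contDiffOn hq)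
        (fun t ht => by rw [hWz t ht, smul_zero]) Metric.isOpen_ball
        (fun t ht => (hball ht).1) (fun t ht => (hball ht).2) (S := Metric.closedBall t₀ (ε / 2))
        (K := Metric.closedBall t₀ (3 * ε / 4)) Metric.isClosed_closedBall ?_
        (isCompact_closedBall _ _) (Metric.closedBall_subset_ball (by linarith)) fun t ht => ?_
      · exact (Metric.closedBall_subset_ball (by linarith)).trans Metric.ball_subset_interior_closedBall
      · have : ρ t = 0 := ρ.zero_of_le_dist (not_le.1 ht).le
        rw [this, zero_smul]
  obtain ⟨ρ, -, h1, H⟩ := key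
  have h2 := H W (fun _ => 0) hW hWαβ ⟨_, _, isVariation_refl hq⟩
  have e : (fun t => (0 : TangentSpace (𝓡 n) (q t)) + ρ t • W t) = W := by
    funext t
    by_cases ht : t ∈ Icc α β
    · rw [h1 t ht, one_smul, zero_add]
    · rw [hWαβ t ht, smul_zero, zero_add]
  rwa [e] at h2

end Variation

/-! ### Chart independence of the boundary term. -/

section BoundaryInvariance

variable {E E' P : Type*} [NormedAddCommGroup E] [NormedSpace ℝ E]
  [NormedAddCommGroup E'] [NormedSpace ℝ E'] [NormedAddCommGroup P] [NormedSpace ℝ P]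
  {g : E → E →L[ℝ] E →L[ℝ] ℝ} {Γ : E → E →L[ℝ] E →L[ℝ] E} {U : Set E} {c : P → E}
  {g' : E' → E' →L[ℝ] E' →L[ℝ] ℝ} {Γ' : E' → E' →L[ℝ] E' →L[ℝ] E'} {U' : Set E'} {ψ : E → E'}
  {O : Set P}

theorem vcov_congr_curve (hO : IsOpen O) {c c' W W' : P → E} (hc : EqOn c c' O) (hW : EqOn W W' O)
    (e : P) : EqOn (vcov Γ c e W) (vcov Γ c' e W') O := by
  intro p hp
  rw [vcov_apply, vcov_apply, fderiv_congr_of_isOpen hO hc hp, fderiv_congr_of_isOpen hO hW hp,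
    hc hp, hW hp]

theorem boundaryL_congr (hO : IsOpen O) {c c' : P → E} (hc : EqOn c c' O) (t s : P) :
    EqOn (boundaryL g Γ c t s) (boundaryL g Γ c' t s) O := by
  intro p hp
  have hd : ∀ e, EqOn (fun p => fderiv ℝ c p e) (fun p => fderiv ℝ c' p e) O := fun e p hp => by
    simp only [fderiv_congr_of_isOpen hO hc hp]
  have h2 := vcov_congr_curve (Γ := Γ) hO hc (vcov_congr_curve (Γ := Γ) hO hc (hd t) t) t hp
  have h2' : (vcov Γ c t)^[2] (fun p => fderiv ℝ c p t) p
    = (vcov Γ c' t)^[2] (fun p => fderiv ℝ c' p t) p := h2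
  rw [boundaryL, boundaryL, hc hp, h2', vcov_congr_curve hO hc (hd t) t hp,
    vcov_congr_curve hO hc (hd s) t hp, fderiv_congr_of_isOpen hO hc hp]

/-- The boundary term is built from the metric and covariant derivatives alone, and an isometry
carries both to their counterparts. -/
theorem IsIsometryOn.boundaryL_comp (hψ : IsIsometryOn g U g' U' ψ) (h : IsLeviCivitaOn g Γ U)
    (h' : IsLeviCivitaOn g' Γ' U') (hc : IsSmoothInto c O U) (t s : P) :
    EqOn (boundaryL g Γ c t s) (boundaryL g' Γ' (fun p => ψ (c p)) t s) O := by
  have hd := fun {W : P → E} (hW : ContDiffOn ℝ ∞ W O) {p : P} (hp : p ∈ O) =>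
    ContDiffOn.differentiableAt_of_isOpen hW hc.isOpen hp
  have h1 : ∀ e, EqOn (fun p => fderiv ℝ (fun p => ψ (c p)) p e)
      (fun p => fderiv ℝ ψ (c p) (fderiv ℝ c p e)) O := fun e p hp => by
    have hψd := ContDiffOn.differentiableAt_of_isOpen hψ.smooth h.isOpen (hc.mapsTo hp)
    have e2 : fderiv ℝ (fun p => ψ (c p)) p = (fderiv ℝ ψ (c p)).comp (fderiv ℝ c p) :=
      fderiv_comp p hψd (hd hc.smooth hp)
    simp only [e2, comp_apply]
  have hv : ∀ {W : P → E} {W' : P → E'}, ContDiffOn ℝ ∞ W O →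
      EqOn W' (fun p => fderiv ℝ ψ (c p) (W p)) O →
      EqOn (vcov Γ' (fun p => ψ (c p)) t W') (fun p => fderiv ℝ ψ (c p) (vcov Γ c t W p)) O :=
    fun hW hW' p hp => by
      rw [vcov_congr hc.isOpen hW' t hp]
      exact (hψ.fderiv_vcov h h' (hc.mapsTo hp) (hd hc.smooth hp) (hd hW hp)).symm
  have hp := fun e => IsLeviCivitaOn.contDiffOn_partial hc e
  have k1 := hv (hp t) (h1 t)
  have k2 : EqOn ((vcov Γ' (fun p => ψ (c p)) t)^[2] (fun p => fderiv ℝ (fun p => ψ (c p)) p t))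
    (fun p => fderiv ℝ ψ (c p) ((vcov Γ c t)^[2] (fun p => fderiv ℝ c p t) p)) O :=
    hv (h.contDiffOn_vcov hc (hp t) t) k1
  have k3 := hv (hp s) (h1 s)
  intro p hpO
  rw [boundaryL, boundaryL, k1 hpO, k2 hpO, k3 hpO,
    show fderiv ℝ (fun p => ψ (c p)) p s = fderiv ℝ ψ (c p) (fderiv ℝ c p s) from h1 s hpO, ← hψ.metric _ (hc.mapsTo hpO),
    ← hψ.metric _ (hc.mapsTo hpO)]

end BoundaryInvariance

/-! ### Differentiation under the integral and the second derivative test. -/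

section ParametricIntegral

theorem intervalIntegral_hasDerivAt_of_contDiffOn {δ T a b : ℝ} {L : ℝ × ℝ → ℝ}
    (hL : ContDiffOn ℝ ∞ L (Ioo (-δ) δ ×ˢ Ioo 0 T)) (hab : a ≤ b) (hsub : Icc a b ⊆ Ioo 0 T) {s : ℝ}
    (hs : s ∈ Ioo (-δ) δ) :
    HasDerivAt (fun s => ∫ t in a..b, L (s, t)) (∫ t in a..b, fderiv ℝ L (s, t) (1, 0)) s := by
  have hDo : IsOpen (Ioo (-δ) δ ×ˢ Ioo 0 T) := isOpen_Ioo.prod isOpen_Ioo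
  obtain ⟨ε, hε, hball⟩ := Metric.nhds_basis_closedBall.mem_iff.1 (isOpen_Ioo.mem_nhds hs)
  have hL' := contDiffOn_fderiv_apply (n := ∞) hDo le_rfl hL ((1 : ℝ), (0 : ℝ))
  have hcs : ∀ {F : ℝ × ℝ → ℝ}, ContDiffOn ℝ ∞ F (Ioo (-δ) δ ×ˢ Ioo 0 T) → ∀ s ∈ Ioo (-δ) δ,
      ContinuousOn (fun t => F (s, t)) (Icc a b) := fun hF s hs =>
    hF.continuousOn.comp (by fun_prop) fun t ht => ⟨hs, hsub ht⟩
  obtain ⟨C, hC⟩ := ((isCompact_closedBall s ε).prod (isCompact_Icc (a := a) (b := b))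
    ).exists_bound_of_continuousOn (hL'.continuousOn.mono (prod_mono hball hsub))
  have hm : ∀ {F : ℝ × ℝ → ℝ}, ContDiffOn ℝ ∞ F (Ioo (-δ) δ ×ˢ Ioo 0 T) → ∀ s ∈ Ioo (-δ) δ,
      MeasureTheory.AEStronglyMeasurable (fun t => F (s, t))
        (MeasureTheory.volume.restrict (uIoc a b)) := fun hF s hs => by
    rw [uIoc_of_le hab]
    exact ((hcs hF s hs).mono Ioc_subset_Icc_self).aestronglyMeasurable measurableSet_Ioc
  refine (intervalIntegral.hasDerivAt_integral_of_dominated_loc_of_deriv_le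
    (F := fun s t => L (s, t)) (F' := fun s t => fderiv ℝ L (s, t) (1, 0)) (bound := fun _ => C)
    (Metric.closedBall_mem_nhds s hε)
    (Filter.eventually_of_mem (isOpen_Ioo.mem_nhds hs) fun s hs => hm hL s hs)
    ((hcs hL s hs).intervalIntegrable_of_Icc hab) (hm hL' s hs)
    (.of_forall fun t ht s' hs' => ?_) intervalIntegrable_const
    (.of_forall fun t ht s' hs' => ?_)).2
  · rw [uIoc_of_le hab] at ht
    exact hC (s', t) ⟨hs', Ioc_subset_Icc_self ht⟩
  · rw [uIoc_of_le hab] at ht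
    have hp : (s', t) ∈ Ioo (-δ) δ ×ˢ Ioo 0 T := ⟨hball hs', hsub (Ioc_subset_Icc_self ht)⟩
    have h1 := (ContDiffOn.differentiableAt_of_isOpen hL hDo hp).hasFDerivAt
    exact h1.comp_hasDerivAt s' ((hasDerivAt_id s').prodMk (hasDerivAt_const s' t))

/-- Second derivative test for parametric integrals. -/
theorem integral_second_deriv_nonneg {δ T a b : ℝ} {L : ℝ × ℝ → ℝ} (hδ : 0 < δ)
    (hL : ContDiffOn ℝ ∞ L (Ioo (-δ) δ ×ˢ Ioo 0 T)) (hab : a ≤ b) (hsub : Icc a b ⊆ Ioo 0 T)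
    (hmin : IsLocalMin (fun s => ∫ t in a..b, L (s, t)) 0) :
    0 ≤ ∫ t in a..b, fderiv ℝ (fun p => fderiv ℝ L p (1, 0)) (0, t) (1, 0) := by
  have hDo : IsOpen (Ioo (-δ) δ ×ˢ Ioo 0 T) := isOpen_Ioo.prod isOpen_Ioo
  have hL' := contDiffOn_fderiv_apply (n := ∞) hDo le_rfl hL ((1 : ℝ), (0 : ℝ))
  have h0 : (0 : ℝ) ∈ Ioo (-δ) δ := ⟨neg_lt_zero.2 hδ, hδ⟩
  set g : ℝ → ℝ := fun s => ∫ t in a..b, L (s, t) with hg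
  have h1 : deriv g =ᶠ[𝓝 0] fun s => ∫ t in a..b, fderiv ℝ L (s, t) (1, 0) := by
    filter_upwards [isOpen_Ioo.mem_nhds h0] with s hs
    exact (intervalIntegral_hasDerivAt_of_contDiffOn hL hab hsub hs).deriv
  have h2 : deriv (deriv g) 0 = ∫ t in a..b, fderiv ℝ (fun p => fderiv ℝ L p (1, 0)) (0, t) (1, 0) :=
    h1.deriv_eq.trans (intervalIntegral_hasDerivAt_of_contDiffOn hL' hab hsub h0).deriv
  rw [← h2]
  -- A negative second derivative would make 0 a local maximum as well. Being also a local minimum,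
  -- it would force the function to be locally constant, with second derivative zero.
  by_contra! hneg
  have hmax := isLocalMax_of_deriv_deriv_neg hneg hmin.deriv_eq_zero
    (intervalIntegral_hasDerivAt_of_contDiffOn hL hab hsub h0).continuousAt
  have hc : g =ᶠ[𝓝 0] fun _ => g 0 := by
    filter_upwards [hmin, hmax] with s hs hs' using le_antisymm hs' hs
  have hc' : deriv g =ᶠ[𝓝 0] fun _ => 0 := by
    filter_upwards [eventually_eventually_nhds.2 hc] with s hs
    rw [Filter.EventuallyEq.deriv_eq hs, deriv_const]
  rw [hc'.deriv_eq, deriv_const] at hneg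
  exact lt_irrefl _ hneg

end ParametricIntegral

/-! ### The second variation of the action. -/

section VariationDensity

variable {n : ℕ} {Q : Type*} [TopologicalSpace Q] [ChartedSpace (EuclideanSpace ℝ (Fin n)) Q]
  [IsManifold (𝓡 n) ∞ Q] [RiemannianBundle (fun x : Q => TangentSpace (𝓡 n) x)]

local notation "𝔼" => EuclideanSpace ℝ (Fin n)

variable {T t s a b α β δ : ℝ} {q γ γ' : ℝ → Q} {x : Q} {W X Y Z : ∀ t, TangentSpace (𝓡 n) (q t)}
  {f : ℝ → ℝ → Q} {V : Q → ℝ}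

/-- The integrand of the action. -/
def actionDensity (V : Q → ℝ) (T : ℝ) (q : ℝ → Q) (t : ℝ) : ℝ :=
  (1 / 2) * ‖covDeriv (n := n) T q (velocity T q) t‖ ^ 2 + V (q t)

theorem action_eq (V : Q → ℝ) (T : ℝ) (q : ℝ → Q) :
    action (n := n) V T q = ∫ t in (0 : ℝ)..T, actionDensity (n := n) V T q t := rfl

namespace IsVariation

/-- The representation of a variation in the chart at `x`. -/
theorem isSmoothInto_chart (h : IsVariation T q α β W f δ) (x : Q) :
    IsSmoothInto (fun p : ℝ × ℝ => extChartAt (𝓡 n) x (f p.1 p.2))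
      (Ioo (-δ) δ ×ˢ Ioo 0 T ∩ (fun p : ℝ × ℝ => f p.1 p.2) ⁻¹' (extChartAt (𝓡 n) x).source)
      (extChartAt (𝓡 n) x).target where
  isOpen := h.smooth.continuousOn.isOpen_inter_preimage (isOpen_strip δ T)
    (isOpen_extChartAt_source x)
  smooth := fun p hp => by
    have k1 : ContMDiffAt (𝓡 n) 𝓘(ℝ, 𝔼) ∞ (extChartAt (𝓡 n) x) (f p.1 p.2) :=
      contMDiffAt_extChartAt' (by simpa using hp.2)
    have k2 := h.smooth.contMDiffAt ((isOpen_strip δ T).mem_nhds hp.1)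
    exact (contMDiffAt_iff_contDiffAt.1 (ContMDiffAt.comp p k1 k2)).contDiffWithinAt
  mapsTo := fun _ hp => (extChartAt (𝓡 n) x).map_source hp.2

theorem isChartLift (h : IsVariation T q α β W f δ) (x : Q) (s : ℝ) :
    IsChartLift T (f s) x (fun p : ℝ × ℝ => extChartAt (𝓡 n) x (f p.1 p.2))
      (Ioo (-δ) δ ×ˢ Ioo 0 T ∩ (fun p : ℝ × ℝ => f p.1 p.2) ⁻¹' (extChartAt (𝓡 n) x).source)
      (s, 0) (0, 1) ((fun t => (s, t)) ⁻¹' (Ioo (-δ) δ ×ˢ Ioo 0 T ∩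
        (fun p : ℝ × ℝ => f p.1 p.2) ⁻¹' (extChartAt (𝓡 n) x).source)) where
  into := h.isSmoothInto_chart x
  isOpen := (h.isSmoothInto_chart x).isOpen.preimage (by fun_prop)
  subset := fun t ht => ht.1.2
  mem := fun t ht => by simpa using ht
  source := fun t ht => ht.2
  eq := fun t ht => by simp

theorem contMDiffOn_curve (h : IsVariation T q α β W f δ)
    (hq : ContMDiffOn 𝓘(ℝ, ℝ) (𝓡 n) ∞ q (Icc 0 T)) (hα : 0 < α) (hβ : β < T)
    (hs : s ∈ Ioo (-δ) δ) : ContMDiffOn 𝓘(ℝ, ℝ) (𝓡 n) ∞ (f s) (Icc 0 T) := by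
  intro t ht
  by_cases htαβ : t ∈ Icc α β
  · have ht' : t ∈ Ioo 0 T := ⟨hα.trans_le htαβ.1, htαβ.2.trans_lt hβ⟩
    have k1 := h.smooth.contMDiffAt (x := (s, t)) ((isOpen_strip δ T).mem_nhds ⟨hs, ht'⟩)
    have k2 : ContMDiffAt 𝓘(ℝ, ℝ) 𝓘(ℝ, ℝ × ℝ) ∞ (fun t : ℝ => (s, t)) t :=
      (contDiffAt_const.prodMk contDiffAt_id).contMDiffAt
    exact (ContMDiffAt.comp t k1 k2).contMDiffWithinAt
  · refine (hq t ht).congr_of_eventuallyEq (mem_nhdsWithin_of_mem_nhds ?_) (h.off s t htαβ)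
    filter_upwards [isClosed_Icc.isOpen_compl.mem_nhds htαβ] with u hu using h.off s u hu

end IsVariation

variable [IsContMDiffRiemannianBundle (𝓡 n) ∞ (EuclideanSpace ℝ (Fin n))
    (fun x : Q => TangentSpace (𝓡 n) x)]

/-- The integrand of the action is local. -/
theorem actionDensity_congr (hT : 0 < T) (hγ : ContMDiffOn 𝓘(ℝ, ℝ) (𝓡 n) ∞ γ (Icc 0 T))
    (hγ' : ContMDiffOn 𝓘(ℝ, ℝ) (𝓡 n) ∞ γ' (Icc 0 T)) {J : Set ℝ} (hJ : IsOpen J) (hJT : J ⊆ Ioo 0 T)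
    (h : ∀ t ∈ J, γ t = γ' t) (ht : t ∈ J) :
    actionDensity (n := n) V T γ t = actionDensity (n := n) V T γ' t := by
  set x := γ t
  set O : Set ℝ := J ∩ γ ⁻¹' (extChartAt (𝓡 n) x).source with hO
  have hJI : J ⊆ Icc 0 T := hJT.trans Ioo_subset_Icc_self
  have hOo : IsOpen O := (hγ.continuousOn.mono hJI).isOpen_inter_preimage hJ
    (isOpen_extChartAt_source x)
  have hl : IsChartLift T γ x (fun t => extChartAt (𝓡 n) x (γ t)) O (0 : ℝ) 1 O := by
    refine ⟨⟨hOo, fun u hu => ?_, fun u hu => (extChartAt (𝓡 n) x).map_source hu.2⟩, hOo,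
      fun u hu => hJT hu.1, fun u hu => by simpa using hu, fun u hu => hu.2, fun u hu => by simp⟩
    exact ((contDiffWithinAt_chart hγ (hJI hu.1) hu.2).contDiffAt
      (Icc_mem_nhds (hJT hu.1).1 (hJT hu.1).2)).contDiffWithinAt
  have hl' : IsChartLift T γ' x (fun t => extChartAt (𝓡 n) x (γ t)) O (0 : ℝ) 1 O :=
    ⟨hl.into, hl.isOpen, hl.subset, hl.mem, fun u hu => by rw [← h u hu.1]; exact hu.2,
      fun u hu => by rw [← h u hu.1]; exact hl.eq u hu⟩
  have htO : t ∈ O := ⟨ht, mem_extChartAt_source x⟩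
  exact (hl.lagrangian_line (V := V) hT hγ htO).symm.trans (hl'.lagrangian_line hT hγ' htO)

theorem continuousOn_actionDensity (hV : ContMDiff (𝓡 n) 𝓘(ℝ, ℝ) ∞ V) (hT : 0 < T)
    (hγ : ContMDiffOn 𝓘(ℝ, ℝ) (𝓡 n) ∞ γ (Icc 0 T)) :
    ContinuousOn (actionDensity (n := n) V T γ) (Icc 0 T) := by
  have hD := (isSmoothField_velocity hT hγ).covDeriv hT hγ
  have h1 := (contDiffOn_metricAt hγ hD hD).continuousOn
  simp only [metricAt_self] at h1
  exact (h1.const_mul _).add (hV.continuous.comp_continuousOn hγ.continuousOn)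

namespace IsVariation

theorem actionDensity_eq (h : IsVariation T q α β W f δ) (hT : 0 < T)
    (hq : ContMDiffOn 𝓘(ℝ, ℝ) (𝓡 n) ∞ q (Icc 0 T)) (hα : 0 < α) (hβ : β < T) (x : Q) :
    EqOn (fun p : ℝ × ℝ => actionDensity (n := n) V T (f p.1) p.2)
      (lagrangian (chartMetric x) (christoffelL x) (V ∘ (extChartAt (𝓡 n) x).symm)
        (fun p : ℝ × ℝ => extChartAt (𝓡 n) x (f p.1 p.2)) (0, 1))
      (Ioo (-δ) δ ×ˢ Ioo 0 T ∩ (fun p : ℝ × ℝ => f p.1 p.2) ⁻¹' (extChartAt (𝓡 n) x).source) := by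
  rintro ⟨s, t⟩ hp
  have h1 := (h.isChartLift x s).lagrangian_line (V := V) hT
    (h.contMDiffOn_curve hq hα hβ hp.1.1) (t := t) hp
  have e : ((s, 0) : ℝ × ℝ) + t • (0, 1) = (s, t) := by simp
  rw [e] at h1
  exact h1.symm

theorem contDiffOn_actionDensity (h : IsVariation T q α β W f δ)
    (hV : ContMDiff (𝓡 n) 𝓘(ℝ, ℝ) ∞ V) (hT : 0 < T)
    (hq : ContMDiffOn 𝓘(ℝ, ℝ) (𝓡 n) ∞ q (Icc 0 T)) (hα : 0 < α) (hβ : β < T) :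
    ContDiffOn ℝ ∞ (fun p : ℝ × ℝ => actionDensity (n := n) V T (f p.1) p.2)
      (Ioo (-δ) δ ×ˢ Ioo 0 T) := by
  intro p hp
  set x := f p.1 p.2
  have hc := h.isSmoothInto_chart x
  have hpO : p ∈ Ioo (-δ) δ ×ˢ Ioo 0 T ∩ (fun p : ℝ × ℝ => f p.1 p.2) ⁻¹'
    (extChartAt (𝓡 n) x).source := ⟨hp, mem_extChartAt_source x⟩
  have h1 := ((isLeviCivitaOn_chart (n := n) x).contDiffOn_lagrangian hc (contDiffOn_potential hV x)
    (0, 1)).contDiffAt (hc.isOpen.mem_nhds hpO)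
  exact (h1.congr_of_eventuallyEq ((h.actionDensity_eq hT hq hα hβ x).eventuallyEq_of_mem
    (hc.isOpen.mem_nhds hpO))).contDiffWithinAt

/-- The derivative of the boundary term along the variation, in the chart at `x`. -/
def boundary (_ : IsVariation T q α β W f δ) (x : Q) (t : ℝ) : ℝ :=
  fderiv ℝ (boundaryL (chartMetric x) (christoffelL x)
    (fun p : ℝ × ℝ => extChartAt (𝓡 n) x (f p.1 p.2)) (0, 1) (1, 0)) (0, t) (1, 0)

/-- Allows the boundary terms of the different charts to be joined into one function of t on (0, T),
read at each time in the chart at q t. -/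
theorem boundary_eq (h : IsVariation T q α β W f δ) {x x' : Q} (ht : t ∈ Ioo 0 T)
    (hx : q t ∈ (extChartAt (𝓡 n) x).source) (hx' : q t ∈ (extChartAt (𝓡 n) x').source) :
    h.boundary x t = h.boundary x' t := by
  have hc := h.isSmoothInto_chart x
  have hc' := h.isSmoothInto_chart x'
  set O := (Ioo (-δ) δ ×ˢ Ioo 0 T ∩ (fun p : ℝ × ℝ => f p.1 p.2) ⁻¹' (extChartAt (𝓡 n) x).source) ∩
    (Ioo (-δ) δ ×ˢ Ioo 0 T ∩ (fun p : ℝ × ℝ => f p.1 p.2) ⁻¹' (extChartAt (𝓡 n) x').source)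
  have hO : IsOpen O := hc.isOpen.inter hc'.isOpen
  have hp : ((0 : ℝ), t) ∈ O := by
    have h0 : ((0 : ℝ), t) ∈ Ioo (-δ) δ ×ˢ Ioo 0 T := ⟨⟨neg_lt_zero.2 h.pos, h.pos⟩, ht⟩
    exact ⟨⟨h0, by simpa [h.zero t] using hx⟩, ⟨h0, by simpa [h.zero t] using hx'⟩⟩
  have hcO : IsSmoothInto (fun p : ℝ × ℝ => extChartAt (𝓡 n) x (f p.1 p.2)) O
      (transitionSource x x') :=
    ⟨hO, hc.smooth.mono inter_subset_left, fun p hp => mem_transitionSource hp.1.2 hp.2.2⟩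
  have e1 := (isIsometryOn_transition x x').boundaryL_comp (isLeviCivitaOn_transitionSource x x')
    (isLeviCivitaOn_chart x') hcO (0, 1) (1, 0)
  have e2 : EqOn (fun p : ℝ × ℝ => transition x x' (extChartAt (𝓡 n) x (f p.1 p.2)))
    (fun p : ℝ × ℝ => extChartAt (𝓡 n) x' (f p.1 p.2)) O := fun p hp => transition_apply hp.1.2
  exact congrArg (fun A : ℝ × ℝ →L[ℝ] ℝ => A (1, 0)) (fderiv_congr_of_isOpen hO
    (e1.trans (boundaryL_congr hO e2 (0, 1) (1, 0))) hp)

/-- Off [α, β] the curves of the family do not move with s, so the variation field is zero on a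
whole neighbourhood and the boundary term with it. -/
theorem boundary_eq_zero (h : IsVariation T q α β W f δ) (ht : t ∈ Ioo 0 T) (htαβ : t ∉ Icc α β)
    (hx : q t ∈ (extChartAt (𝓡 n) x).source) : h.boundary x t = 0 := by
  have hc := h.isSmoothInto_chart x
  set O := (Ioo (-δ) δ ×ˢ Ioo 0 T ∩ (fun p : ℝ × ℝ => f p.1 p.2) ⁻¹' (extChartAt (𝓡 n) x).source) ∩
    Prod.snd ⁻¹' (Icc α β)ᶜ
  have hO : IsOpen O := hc.isOpen.inter (isClosed_Icc.isOpen_compl.preimage continuous_snd)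
  have hp : ((0 : ℝ), t) ∈ O :=
    ⟨⟨⟨⟨neg_lt_zero.2 h.pos, h.pos⟩, ht⟩, by simpa [h.zero t] using hx⟩, htαβ⟩
  have hs : ∀ p ∈ O, fderiv ℝ (fun p : ℝ × ℝ => extChartAt (𝓡 n) x (f p.1 p.2)) p (1, 0) = 0 := by
    intro p hp
    have hd := ContDiffOn.differentiableAt_of_isOpen (hc.smooth.mono inter_subset_left) hO hp
    rw [← hd.lineDeriv_eq_fderiv]
    refine HasLineDerivAt.lineDeriv (?_ : HasDerivAt _ _ _)
    refine (hasDerivAt_const (0 : ℝ) (extChartAt (𝓡 n) x (q p.2))).congr_of_eventuallyEq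
      (.of_forall fun u => ?_)
    simp [h.off _ p.2 hp.2]
  have e := fderiv_congr_of_isOpen (W' := fun _ => (0 : ℝ)) hO (fun p hp =>
    boundaryL_eq_zero (g := chartMetric x) (Γ := christoffelL x) (t := (0, 1)) hO hs p hp) hp
  rw [boundary, e]
  simp

/-- The second derivative of the action density. -/
theorem hasDerivAt_boundary (h : IsVariation T q α β W f δ)
    (hV : ContMDiff (𝓡 n) 𝓘(ℝ, ℝ) ∞ V) (hT : 0 < T) (hq : IsModifiedCubic (n := n) V T q)
    (hα : 0 < α) (hβ : β < T) (hW : IsSmoothField T q W) (ht : t ∈ Ioo 0 T) :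
    HasDerivAt (fun t => h.boundary (q t) t)
      (fderiv ℝ (fun p => fderiv ℝ (fun p : ℝ × ℝ => actionDensity (n := n) V T (f p.1) p.2) p (1, 0))
        (0, t) (1, 0) - metricAt (q t) (jacobiField V T q W t) (W t)) t := by
  set x := q t with hxdef
  have hc := h.isSmoothInto_chart x
  have hl := h.isChartLift x 0
  have hf0 : f 0 = q := funext h.zero
  rw [hf0] at hl
  set O := Ioo (-δ) δ ×ˢ Ioo 0 T ∩ (fun p : ℝ × ℝ => f p.1 p.2) ⁻¹' (extChartAt (𝓡 n) x).source
    with hO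
  have h0 : (0 : ℝ) ∈ Ioo (-δ) δ := ⟨neg_lt_zero.2 h.pos, h.pos⟩
  have htJ : t ∈ (fun t => ((0 : ℝ), t)) ⁻¹' O :=
    ⟨⟨h0, ht⟩, by
      change f 0 t ∈ (extChartAt (𝓡 n) x).source
      rw [h.zero t]
      exact mem_extChartAt_source x⟩
  have e0 : ∀ t : ℝ, ((0, 0) : ℝ × ℝ) + t • (0, 1) = (0, t) := fun t => by simp
  have hr : ∀ t ∈ (fun t => ((0 : ℝ), t)) ⁻¹' O,
      fderiv ℝ (fun p : ℝ × ℝ => extChartAt (𝓡 n) x (f p.1 p.2)) ((0, 0) + t • (0, 1)) (1, 0)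
        = coord x q W t := by
    intro t ht
    rw [e0]
    have hd := ContDiffOn.differentiableAt_of_isOpen hc.smooth hc.isOpen ht
    have h1 := hd.hasFDerivAt.comp_hasDerivAt (0 : ℝ) ((hasDerivAt_id (0 : ℝ)).prodMk
      (hasDerivAt_const (0 : ℝ) t))
    exact h1.unique (h.deriv x t ht.1.2 (hl.source t ht))
  have h2 := hl.second_variation hV hT hq hW hr hr htJ
  simp only [e0] at h2
  have e1 : EqOn (fun p => fderiv ℝ (fun p : ℝ × ℝ => actionDensity (n := n) V T (f p.1) p.2) p (1, 0))
      (fun p => fderiv ℝ (lagrangian (chartMetric x) (christoffelL x)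
        (V ∘ (extChartAt (𝓡 n) x).symm) (fun p : ℝ × ℝ => extChartAt (𝓡 n) x (f p.1 p.2)) (0, 1))
        p (1, 0)) O := fun p hp =>
    congrArg (fun A : ℝ × ℝ →L[ℝ] ℝ => A (1, 0))
      (fderiv_congr_of_isOpen hc.isOpen (h.actionDensity_eq hT hq.1 hα hβ x) hp)
  rw [fderiv_congr_of_isOpen hc.isOpen e1 htJ]
  -- The chart in which the boundary term is read moves with t. By chart independence it may be
  -- frozen at the chart of the base time.
  refine HasDerivAt.congr_of_eventuallyEq h2 ?_
  filter_upwards [hl.isOpen.mem_nhds htJ] with u hu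
  exact h.boundary_eq hu.1.2 (mem_extChartAt_source (q u)) (hl.source u hu)

/-- The second variation of the action is given by the index form. -/
theorem integral_second_variation (h : IsVariation T q α β W f δ)
    (hV : ContMDiff (𝓡 n) 𝓘(ℝ, ℝ) ∞ V) (hq : IsModifiedCubic (n := n) V T q)
    (hα : 0 < α) (hβ : β < T) (hW : IsSmoothField T q W) (hWαβ : ∀ t ∉ Icc α β, W t = 0)
    (ha : 0 < a) (haα : a < α) (hab : a ≤ b) (hβb : β < b) (hb : b < T) :
    ∫ t in a..b, fderiv ℝ (fun p => fderiv ℝ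
      (fun p : ℝ × ℝ => actionDensity (n := n) V T (f p.1) p.2) p (1, 0)) (0, t) (1, 0)
      = indexForm V T q W W := by
  have hT : 0 < T := ha.trans_le (hab.trans hb.le)
  have hsub : Icc a b ⊆ Ioo 0 T := fun t ht => ⟨ha.trans_le ht.1, ht.2.trans_lt hb⟩
  have hL := h.contDiffOn_actionDensity hV hT hq.1 hα hβ
  have hL' := contDiffOn_fderiv_apply (n := ∞) (isOpen_strip δ T) le_rfl (contDiffOn_fderiv_apply
    (n := ∞) (isOpen_strip δ T) le_rfl hL ((1 : ℝ), (0 : ℝ))) ((1 : ℝ), (0 : ℝ))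
  have h0 : (0 : ℝ) ∈ Ioo (-δ) δ := ⟨neg_lt_zero.2 h.pos, h.pos⟩
  have hθ : ContinuousOn (fun t => fderiv ℝ (fun p => fderiv ℝ
      (fun p : ℝ × ℝ => actionDensity (n := n) V T (f p.1) p.2) p (1, 0)) (0, t) (1, 0)) (Icc a b) :=
    hL'.continuousOn.comp (f := fun t : ℝ => ((0 : ℝ), t)) (by fun_prop) fun t ht => ⟨h0, hsub ht⟩
  have hι := (continuousOn_indexIntegrand hV hT hq.1 hW hW).mono
    (hsub.trans Ioo_subset_Icc_self)
  rw [indexForm_eq_integral hV hT hq.1 ha.le hab hb.le hW hW (isClosed_Icc (a := α) (b := β))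
    (Icc_subset_Ioo haα hβb) fun t _ ht => hWαβ t ht]
  -- The second derivative of the density and the index integrand each differ from ⟨D⁴W + F(W) + ∇_W
  -- grad V, W⟩ by a derivative. Hence their difference has a global primitive, which vanishes at a
  -- and b because these lie outside [α, β].
  have key : ∀ t ∈ Icc a b, HasDerivAt (fun t => h.boundary (q t) t
      - (jetInner T q W W 2 1 t - jetInner T q W W 3 0 t))
      (fderiv ℝ (fun p => fderiv ℝ
        (fun p : ℝ × ℝ => actionDensity (n := n) V T (f p.1) p.2) p (1, 0)) (0, t) (1, 0)
        - indexIntegrand V T q W W t) t := by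
    intro t ht
    have h1 := h.hasDerivAt_boundary hV hT hq hα hβ hW (hsub ht)
    have h2 := (hasDerivWithinAt_index_boundary (V := V) hT hq.1 hW hW
      (Ioo_subset_Icc_self (hsub ht))).hasDerivAt (Icc_mem_nhds (hsub ht).1 (hsub ht).2)
    exact (h1.sub h2).congr_deriv (by ring)
  have hz : ∀ t ∈ Icc a b, t ∉ Icc α β → h.boundary (q t) t
      - (jetInner T q W W 2 1 t - jetInner T q W W 3 0 t) = 0 := by
    intro t ht htαβ
    have hW0 := covDeriv_iterate_eq_zero (X := W) (T := T) (isClosed_Icc (a := α) (b := β))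
      (fun t _ ht => hWαβ t ht)
    rw [h.boundary_eq_zero (hsub ht) htαβ (mem_extChartAt_source (q t)), jetInner, jetInner,
      hW0 1 t (Ioo_subset_Icc_self (hsub ht)) htαβ, hW0 0 t (Ioo_subset_Icc_self (hsub ht)) htαβ,
      metricAt_zero_right, metricAt_zero_right]
    ring
  have hint := intervalIntegral.integral_eq_sub_of_hasDerivAt (a := a) (b := b) (fun t ht => key t
    (by rwa [uIcc_of_le hab] at ht)) ((hθ.sub hι).intervalIntegrable_of_Icc hab)
  rw [hz a ⟨le_rfl, hab⟩ fun h => absurd h.1 (not_le.2 haα),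
    hz b ⟨hab, le_rfl⟩ fun h => absurd h.2 (not_le.2 hβb),
    intervalIntegral.integral_sub (hθ.intervalIntegrable_of_Icc hab)
      (hι.intervalIntegrable_of_Icc hab)] at hint
  linarith

end IsVariation

end VariationDensity

/-! ### The varied curves lie in Ω and are C¹-close to q; failure of local minimality. -/

section Omega

variable {n : ℕ} {Q : Type*} [TopologicalSpace Q] [ChartedSpace (EuclideanSpace ℝ (Fin n)) Q]
  [IsManifold (𝓡 n) ∞ Q] [RiemannianBundle (fun x : Q => TangentSpace (𝓡 n) x)]

local notation "𝔼" => EuclideanSpace ℝ (Fin n)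

variable {T t s a b α β δ : ℝ} {q γ γ' : ℝ → Q} {x : Q} {W X Y Z : ∀ t, TangentSpace (𝓡 n) (q t)}
  {f : ℝ → ℝ → Q} {V : Q → ℝ} {ξ η : TangentBundle (𝓡 n) Q}

theorem isPiecewiseSmoothC1_of_contMDiffOn {E H M : Type*} [NormedAddCommGroup E] [NormedSpace ℝ E]
    [TopologicalSpace H] {I : ModelWithCorners ℝ E H} [TopologicalSpace M] [ChartedSpace H M]
    {c : ℝ → M} (hT : 0 < T) (hc : ContMDiffOn 𝓘(ℝ, ℝ) I ∞ c (Icc 0 T)) :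
    IsPiecewiseSmoothC1 I T c := by
  refine ⟨hc.of_le (by simp), 1, fun i => if i = 0 then 0 else T, fun i j hij => ?_, by simp, by simp,
    fun i hi => ?_⟩
  · by_cases hi : i = 0
    · by_cases hj : j = 0
      · simp [hi, hj]
      · simpa [hi, hj] using hT.le
    · simp [hi, show j ≠ 0 by omega]
  · obtain rfl : i = 0 := by omega
    simpa using hc

theorem tangent_mk_congr {p p' : Q} (hp : p = p') {v v' : 𝔼} (hv : v = v') :
    (⟨p, v⟩ : TangentBundle (𝓡 n) Q) = ⟨p', v'⟩ := by
  subst hp hv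
  rfl

theorem velocity_congr (h : γ =ᶠ[𝓝 t] γ') :
    (⟨γ t, velocity T γ t⟩ : TangentBundle (𝓡 n) Q) = ⟨γ' t, velocity T γ' t⟩ := by
  refine tangent_mk_congr h.eq_of_nhds ?_
  have h1 := (h.filter_mono (nhdsWithin_le_nhds (s := Icc 0 T))).mfderivWithin_eq
    (I := 𝓘(ℝ, ℝ)) (I' := 𝓡 n) h.eq_of_nhds
  exact congrArg (fun A : ℝ →L[ℝ] 𝔼 => A 1) h1

namespace IsVariation

theorem eventuallyEq_off (h : IsVariation T q α β W f δ) (s : ℝ) (ht : t ∉ Icc α β) :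
    f s =ᶠ[𝓝 t] q := by
  filter_upwards [isClosed_Icc.isOpen_compl.mem_nhds ht] with u hu using h.off s u hu

theorem mem_Omega (h : IsVariation T q α β W f δ) (hT : 0 < T) (hqΩ : q ∈ Omega T ξ η)
    (hq : ContMDiffOn 𝓘(ℝ, ℝ) (𝓡 n) ∞ q (Icc 0 T)) (hα : 0 < α) (hβ : β < T)
    (hs : s ∈ Ioo (-δ) δ) : f s ∈ Omega T ξ η :=
  ⟨isPiecewiseSmoothC1_of_contMDiffOn hT (h.contMDiffOn_curve hq hα hβ hs),
    (velocity_congr (h.eventuallyEq_off s fun h => absurd h.1 (not_le.2 hα))).trans hqΩ.2.1,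
    (velocity_congr (h.eventuallyEq_off s fun h => absurd h.2 (not_le.2 hβ))).trans hqΩ.2.2⟩

theorem velocity_eq (h : IsVariation T q α β W f δ) (hs : s ∈ Ioo (-δ) δ) (ht : t ∈ Ioo 0 T) :
    (⟨f s t, velocity T (f s) t⟩ : TangentBundle (𝓡 n) Q)
      = tangentMapWithin 𝓘(ℝ, ℝ × ℝ) (𝓡 n) (fun p : ℝ × ℝ => f p.1 p.2) (Ioo (-δ) δ ×ˢ Ioo 0 T)
        ((tangentBundleModelSpaceHomeomorph 𝓘(ℝ, ℝ × ℝ)).symm ((s, t), (0, 1))) := by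
  have hD := (isOpen_strip δ T).mem_nhds (show (s, t) ∈ Ioo (-δ) δ ×ˢ Ioo 0 T from ⟨hs, ht⟩)
  have h1 : HasMFDerivAt 𝓘(ℝ, ℝ × ℝ) (𝓡 n) (fun p : ℝ × ℝ => f p.1 p.2) (s, t)
      (mfderiv 𝓘(ℝ, ℝ × ℝ) (𝓡 n) (fun p : ℝ × ℝ => f p.1 p.2) (s, t)) :=
    ((h.smooth.contMDiffAt hD).mdifferentiableAt (by simp)).hasMFDerivAt
  have h2 : HasFDerivAt (fun t : ℝ => (s, t)) (ContinuousLinearMap.inr ℝ ℝ ℝ) t :=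
    hasFDerivAt_prodMk_right s t
  have h3 := HasMFDerivAt.comp t h1 h2.hasMFDerivAt
  have h4 := (h3.hasMFDerivWithinAt (s := Icc 0 T)).mfderivWithin
    ((uniqueDiffOn_Icc (ht.1.trans ht.2)).uniqueMDiffOn t (Ioo_subset_Icc_self ht))
  refine tangent_mk_congr rfl ?_
  have h5 : mfderivWithin 𝓘(ℝ, ℝ × ℝ) (𝓡 n) (fun p : ℝ × ℝ => f p.1 p.2)
      (Ioo (-δ) δ ×ˢ Ioo 0 T) (s, t) = mfderiv 𝓘(ℝ, ℝ × ℝ) (𝓡 n) (fun p : ℝ × ℝ => f p.1 p.2) (s, t) :=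
    mfderivWithin_of_mem_nhds hD
  have h6 := congrArg (fun A : ℝ →L[ℝ] 𝔼 => A 1) h4
  have h7 := congrArg (fun A : ℝ × ℝ →L[ℝ] 𝔼 => A (0, 1)) h5
  exact h6.trans h7.symm

/-- The curves of a variation are `C¹`-close to the initial curve. -/
theorem eventually_mem (h : IsVariation T q α β W f δ) (hα : 0 < α) (hβ : β < T)
    {N : Set (ℝ × TangentBundle (𝓡 n) Q)} (hN : IsOpen N)
    (hqN : ∀ t ∈ Icc 0 T, (t, (⟨q t, velocity T q t⟩ : TangentBundle (𝓡 n) Q)) ∈ N) :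
    ∀ᶠ s in 𝓝 0, ∀ t ∈ Icc 0 T, (t, (⟨f s t, velocity T (f s) t⟩ : TangentBundle (𝓡 n) Q)) ∈ N := by
  set D := Ioo (-δ) δ ×ˢ Ioo 0 T with hD
  set G : ℝ × ℝ → ℝ × TangentBundle (𝓡 n) Q := fun p => (p.2,
    tangentMapWithin 𝓘(ℝ, ℝ × ℝ) (𝓡 n) (fun p : ℝ × ℝ => f p.1 p.2) D
      ((tangentBundleModelSpaceHomeomorph 𝓘(ℝ, ℝ × ℝ)).symm (p, (0, 1)))) with hG
  have hc : ContinuousOn G D := by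
    have h1 := h.smooth.continuousOn_tangentMapWithin (by simp) (isOpen_strip δ T).uniqueMDiffOn
    refine continuous_snd.continuousOn.prodMk (h1.comp (f := fun p : ℝ × ℝ =>
      (tangentBundleModelSpaceHomeomorph 𝓘(ℝ, ℝ × ℝ)).symm (p, ((0, 1) : ℝ × ℝ))) ?_ fun p hp => hp)
    exact ((tangentBundleModelSpaceHomeomorph 𝓘(ℝ, ℝ × ℝ)).symm.continuous.comp
      (continuous_id.prodMk continuous_const)).continuousOn
  have hO : IsOpen (D ∩ G ⁻¹' N) := hc.isOpen_inter_preimage (isOpen_strip δ T) hN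
  have h0 : (0 : ℝ) ∈ Ioo (-δ) δ := ⟨neg_lt_zero.2 h.pos, h.pos⟩
  have hf0 : f 0 = q := funext h.zero
  have hsub : Icc α β ⊆ Ioo 0 T := Icc_subset_Ioo hα hβ
  have hp : ({0} : Set ℝ) ×ˢ Icc α β ⊆ D ∩ G ⁻¹' N := by
    rintro ⟨s, t⟩ ⟨hs, ht⟩
    rw [mem_singleton_iff] at hs
    subst hs
    refine ⟨⟨h0, hsub ht⟩, ?_⟩
    have h1 := hqN t (Ioo_subset_Icc_self (hsub ht))
    rw [mem_preimage, hG]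
    dsimp only
    rw [← h.velocity_eq h0 (hsub ht), hf0]
    exact h1
  -- Closeness has to be uniform in t only over the compact set [α, β], since elsewhere the curves
  -- and their velocities coincide with those of q.
  obtain ⟨u, v, hu, -, h0u, hv, huv⟩ := generalized_tube_lemma isCompact_singleton isCompact_Icc hO hp
  filter_upwards [hu.mem_nhds (h0u rfl)] with s hs t ht
  by_cases htαβ : t ∈ Icc α β
  · have h1 := huv (mk_mem_prod hs (hv htαβ))
    have h2 : G (s, t) ∈ N := h1.2
    rw [hG] at h2
    dsimp only at h2
    rwa [← h.velocity_eq h1.1.1 (hsub htαβ)] at h2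
  · rw [velocity_congr (h.eventuallyEq_off s htαβ)]
    exact hqN t ht

end IsVariation

variable [IsContMDiffRiemannianBundle (𝓡 n) ∞ (EuclideanSpace ℝ (Fin n))
    (fun x : Q => TangentSpace (𝓡 n) x)]

theorem mem_TangentOmega (hT : 0 < T) (hW : IsSmoothField T q W) (hα : 0 < α) (hβ : β < T)
    (hWαβ : ∀ t ∉ Icc α β, W t = 0) : W ∈ TangentOmega (n := n) T q := by
  have h0 : (0 : ℝ) ∉ Icc α β := fun h => absurd h.1 (not_le.2 hα)
  have hT' : T ∉ Icc α β := fun h => absurd h.2 (not_le.2 hβ)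
  have hD := covDeriv_iterate_eq_zero (X := W) (T := T) (isClosed_Icc (a := α) (b := β))
    (fun t _ ht => hWαβ t ht) 1
  exact ⟨isPiecewiseSmoothC1_of_contMDiffOn hT hW, hWαβ 0 h0, hWαβ T hT',
    hD 0 (left_mem_Icc.2 hT.le) h0, hD T (right_mem_Icc.2 hT.le) hT'⟩

/-- The action changes along a variation only through its integral over an interval containing the
support of the variation. -/
theorem IsVariation.action_sub_eq (h : IsVariation T q α β W f δ)
    (hV : ContMDiff (𝓡 n) 𝓘(ℝ, ℝ) ∞ V)
    (hq : ContMDiffOn 𝓘(ℝ, ℝ) (𝓡 n) ∞ q (Icc 0 T)) (ha : 0 < a) (haα : a < α) (hab : a ≤ b)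
    (hβb : β < b) (hb : b < T) (hs : s ∈ Ioo (-δ) δ) :
    action (n := n) V T (f s) - action (n := n) V T q
      = (∫ t in a..b, actionDensity (n := n) V T (f s) t)
        - ∫ t in a..b, actionDensity (n := n) V T q t := by
  have hT : 0 < T := ha.trans_le (hab.trans hb.le)
  have hfs := h.contMDiffOn_curve hq (ha.trans haα) (hβb.trans hb) hs
  have hsplit : ∀ {γ : ℝ → Q}, ContMDiffOn 𝓘(ℝ, ℝ) (𝓡 n) ∞ γ (Icc 0 T) →
      action (n := n) V T γ = (∫ t in (0 : ℝ)..a, actionDensity (n := n) V T γ t)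
        + ((∫ t in a..b, actionDensity (n := n) V T γ t)
        + ∫ t in b..T, actionDensity (n := n) V T γ t) := by
    intro γ hγ
    have hi : ∀ u v, 0 ≤ u → u ≤ v → v ≤ T →
        IntervalIntegrable (actionDensity (n := n) V T γ) MeasureTheory.volume u v :=
      fun u v hu huv hv => ((continuousOn_actionDensity hV hT hγ).mono
        (Icc_subset_Icc hu hv)).intervalIntegrable_of_Icc huv
    rw [action_eq, intervalIntegral.integral_add_adjacent_intervals (hi a b ha.le hab hb.le)
      (hi b T (ha.le.trans hab) hb.le le_rfl),
      intervalIntegral.integral_add_adjacent_intervals (hi 0 a le_rfl ha.le (hab.trans hb.le))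
      (hi a T ha.le (hab.trans hb.le) le_rfl)]
  have hJ : IsOpen (Ioo 0 T ∩ (Icc α β)ᶜ) := isOpen_Ioo.inter isClosed_Icc.isOpen_compl
  have hcongr : ∀ t ∈ Ioo 0 T, t ∉ Icc α β →
      actionDensity (n := n) V T (f s) t = actionDensity (n := n) V T q t := fun t ht ht' =>
    actionDensity_congr hT hfs hq hJ inter_subset_left (fun u hu => h.off s u hu.2) ⟨ht, ht'⟩
  have e1 : ∫ t in (0 : ℝ)..a, actionDensity (n := n) V T (f s) t
      = ∫ t in (0 : ℝ)..a, actionDensity (n := n) V T q t := by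
    refine intervalIntegral.integral_congr_ae (.of_forall fun t ht => ?_)
    rw [uIoc_of_le ha.le] at ht
    exact hcongr t ⟨ht.1, ht.2.trans_lt (hab.trans_lt hb)⟩
      fun h => absurd (haα.trans_le h.1) (not_lt.2 ht.2)
  have e2 : ∫ t in b..T, actionDensity (n := n) V T (f s) t
      = ∫ t in b..T, actionDensity (n := n) V T q t := by
    refine intervalIntegral.integral_congr_ae ?_
    filter_upwards [(countable_singleton T).ae_notMem MeasureTheory.volume] with t htT ht
    rw [uIoc_of_le hb.le] at ht
    exact hcongr t ⟨(ha.trans_le hab).trans ht.1, lt_of_le_of_ne ht.2 htT⟩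
      fun h => absurd (h.2.trans_lt hβb) (not_lt.2 ht.1.le)
  rw [hsplit hfs, hsplit hq, e1, e2]
  ring

/-- Along a variation with field W, local minimality of q makes s = 0 a local minimum of the action.
The second derivative there is then nonnegative, but it equals the index form of W. -/
theorem not_isOmegaLocalMinimizer (hV : ContMDiff (𝓡 n) 𝓘(ℝ, ℝ) ∞ V)
    (hq : IsModifiedCubic (n := n) V T q) (hT : 0 < T) (hα : 0 < α) (hβ : β < T)
    (hW : IsSmoothField T q W) (hWαβ : ∀ t ∉ Icc α β, W t = 0) (hneg : indexForm V T q W W < 0) :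
    ¬ IsOmegaLocalMinimizer V T ξ η q := by
  rintro ⟨hqΩ, N, hN, hqN, hmin⟩
  obtain ⟨f, δ, h⟩ := exists_isVariation hq.1 hα hβ hW hWαβ
  -- The interval [a, b] surrounds [α, β] and stays inside (0, T), where the density is jointly
  -- smooth in (s, t). Comparison with T/2 secures a ≤ b even when [α, β] is empty.
  obtain ⟨a, ha, haα, haT⟩ : ∃ a, 0 < a ∧ a < α ∧ a ≤ T / 2 :=
    ⟨min (α / 2) (T / 2), by positivity, (min_le_left _ _).trans_lt (by linarith), min_le_right _ _⟩
  obtain ⟨b, hb, hβb, hTb⟩ : ∃ b, b < T ∧ β < b ∧ T / 2 ≤ b :=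
    ⟨max ((β + T) / 2) (T / 2), max_lt (by linarith) (by linarith),
      lt_of_lt_of_le (by linarith) (le_max_left _ _), le_max_right _ _⟩
  have hab : a ≤ b := haT.trans hTb
  have hf0 : f 0 = q := funext h.zero
  have hloc : IsLocalMin (fun s => ∫ t in a..b, actionDensity (n := n) V T (f s) t) 0 := by
    filter_upwards [h.eventually_mem hα hβ hN hqN,
      Ioo_mem_nhds (neg_lt_zero.2 h.pos) h.pos] with s hs hsδ
    have h1 := hmin (f s) (h.mem_Omega hT hqΩ hq.1 hα hβ hsδ) hs
    have h2 := h.action_sub_eq hV hq.1 ha haα hab hβb hb hsδ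
    rw [hf0]
    linarith
  have h3 := integral_second_deriv_nonneg h.pos (h.contDiffOn_actionDensity hV hT hq.1 hα hβ) hab
    (fun t ht => ⟨ha.trans_le ht.1, ht.2.trans_lt hb⟩) hloc
  rw [h.integral_second_variation hV hq hα hβ hW hWαβ ha haα hab hβb hb] at h3
  exact absurd hneg (not_lt.2 h3)

theorem IsGlobalMinimizer.isOmegaLocalMinimizer (h : IsGlobalMinimizer V T ξ η q) :
    IsOmegaLocalMinimizer V T ξ η q :=
  ⟨h.1, univ, isOpen_univ, fun _ _ => mem_univ _, fun γ hγ _ => h.2 γ hγ⟩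

end Omega

end ObstacleAvoidance

end

/-! ### The theorem. -/

theorem mainTheorem2 {n : ℕ} {Q : Type*} [MetricSpace Q]
    [ChartedSpace (EuclideanSpace ℝ (Fin n)) Q] [IsManifold (𝓡 n) ∞ Q]
    [RiemannianBundle (fun x : Q => TangentSpace (𝓡 n) x)]
    [IsContMDiffRiemannianBundle (𝓡 n) ∞ (EuclideanSpace ℝ (Fin n))
      (fun x : Q => TangentSpace (𝓡 n) x)]
    [IsRiemannianManifold (𝓡 n) Q] [ConnectedSpace Q] [CompleteSpace Q]
    (V : Q → ℝ) (hV : ContMDiff (𝓡 n) 𝓘(ℝ, ℝ) ∞ V) (hV_nonneg : ∀ x, 0 ≤ V x)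
    (T : ℝ) (ξ η : TangentBundle (𝓡 n) Q) (q : ℝ → Q)
    (hq : q ∈ ObstacleAvoidance.Omega T ξ η) (hcubic : ObstacleAvoidance.IsModifiedCubic (n := n) V T q)
    (t₁ t₂ : ℝ) (ht₁ : 0 ≤ t₁) (ht₁₂ : t₁ < t₂) (ht₂ : t₂ < T)
    (hbi : ObstacleAvoidance.AreBiconjugate (n := n) V T q t₁ t₂) :
    (∃ X ∈ ObstacleAvoidance.TangentOmega (n := n) T q, ObstacleAvoidance.indexForm V T q X X < 0) ∧
      ¬ ObstacleAvoidance.IsOmegaLocalMinimizer V T ξ η q ∧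
      ¬ ObstacleAvoidance.IsGlobalMinimizer V T ξ η q := by
  obtain ⟨X, ⟨hXs, hXJ⟩, hne, hX1, hX2, hD1, hD2⟩ := hbi
  have hT : 0 < T := (ht₁.trans_lt ht₁₂).trans ht₂
  have hJ : ∀ t ∈ Icc 0 T, ObstacleAvoidance.jacobiField V T q X t = 0 := fun t ht =>
    (add_assoc _ _ _).symm.trans (hXJ t ht)
  obtain ⟨W, α, β, hW, hα, hβ, hWαβ, hneg⟩ := ObstacleAvoidance.exists_indexForm_neg hV hcubic hXs hJ
    hne ht₁ ht₁₂ ht₂ hX1 hX2 hD1 hD2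
  have hmin := ObstacleAvoidance.not_isOmegaLocalMinimizer (ξ := ξ) (η := η) hV hcubic hT hα hβ hW
    hWαβ hneg
  exact ⟨⟨W, ObstacleAvoidance.mem_TangentOmega hT hW hα hβ hWαβ, hneg⟩, hmin,
    fun h => hmin h.isOmegaLocalMinimizer⟩
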